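/- **Conventions.** Let $G$ be a discrete group and $P\subseteq G$ a submonoid with $P\cap P^{-1}=\{1\}$; it induces the left-invariant partial order $a\le b\iff a^{-1}b\in P$. The order is *total* if moreover $P\cup P^{-1}=G$. Write $C^*(G)$ for the full group $C^*$-algebra, with universal unitary representation $g\mapsto U_g$, and $\otimes$ for the minimal tensor product. $G$ is called *amenable* if the canonical map $C^*(G)\to C^*_r(G)\subseteq B(\ell^2(G))$ onto the reduced group $C^*$-algebra is injective. A *coaction* of $G$ on a $C^*$-algebra $A$ is an injective nondegenerate $*$-homomorphism $\delta:A\to A\otimes C^*(G)$ with $(\delta\otimes\mathrm{id})\circ\delta=(\mathrm{id}\otimes\delta_G)\circ\delta$, where $\delta_G(U_g)=U_g\otimes U_g$. Put $A_g=\{a\in A:\delta(a)=a\otimes U_g\}$. The coaction is *normal* if the conditional expectation $A\to A_1$ that vanishes on $A_g$ for all $g\ne1$ is faithful. A *$P$-graph* is a small category $\Lambda$ with a degree functor $d:\Lambda\to P$ such that every morphism $\lambda$ with $d(\lambda)=p_1p_2$ factors uniquely as $\lambda=\mu\nu$ with $d(\mu)=p_1$, $d(\nu)=p_2$. Write $\mu\le\nu$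 if $\nu=\mu\nu'$ for some $\nu'$; a common extension of $\mu$ and $\nu$ is a $\kappa$ with $\mu,\nu\le\kappa$; $MCE(\mu,\nu)$ is the set of minimal common extensions, and $\Lambda$ is *finitely aligned* if these sets are all finite. A *representation* of $\Lambda$ is a family $(t_\mu)_{\mu\in\Lambda}$ in a $C^*$-algebra such that the $t_v$ for vertices $v$ are pairwise orthogonal projections, $t_\mu t_\nu=t_{\mu\nu}$ when $s(\mu)=r(\nu)$, $t_\mu^*t_\mu=t_{s(\mu)}$, and $t_\mu t_\mu^*t_\nu t_\nu^*=\sum_{\kappa\in MCE(\mu,\nu)}t_\kappa t_\kappa^*$. It is *$\Lambda$-faithful* if all $t_\mu\neq0$, and *tight* if $\prod_{\alpha\in E}(t_\mu t_\mu^*-t_\alpha t_\alpha^*)=0$ for every $\mu$ and every finite $E\subseteq\mu\Lambda$ such that each element of $\mu\Lambda$ has a common extension with an element of $E$. $C^*(t)$ is the $C^*$-algebra generated by the $t_\mu$; a *gauge coaction* for $t$ is a coaction $\delta$ of $G$ on $C^*(t)$ with $\delta(t_\mu)=t_\mu\otimes U_{d(\mu)}$. Two representations $s,t$ are *canonically isomorphic*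 if there is a $*$-isomorphism $C^*(s)\to C^*(t)$ with $s_\mu\mapsto t_\mu$. $C^*_{tight}(\Lambda)=C^*(T)$ for the universal tight representation $T$ of $\Lambda$. $C^*_{min}(\Lambda)=C^*(S)$ for a $\Lambda$-faithful tight representation $S$ that has a normal gauge coaction (such an $S$ is unique up to canonical isomorphism). **Lemma.** Let $P$ be the positive cone of a total order on $G$, and let $\Lambda=P$, regarded as a category with one object, with the identity as degree functor. Then $\Lambda$ is a finitely aligned $P$-graph, $(G,P)$ is weakly quasi-lattice ordered (any two elements of $P$ with a common upper bound in $P$ have a least one), and: 1. Every tight representation $t$ of $\Lambda$ extends uniquely to a unitary representation $\bar t$ of $G$ in $C^*(t)$; it is given by $\bar t_p=t_p$ and $\bar t_{p^{-1}}=t_p^*$ for $p\in P$. 2. There is a $*$-isomorphism $C^*_{tight}(\Lambda)\cong C^*(G)$ with $T_p\mapsto U_p$ for $p\in P$. 3. $T$ has a gauge coaction, and the gauge coaction on $C^*_{tight}(\Lambda)$ is normal if and only if $G$ is amenable. **Corollary.** The free group $F_2$ has a total order. If $R$ is the positive cone of any total order on $F_2$ and $\Lambda=R$ as above, then $T$ is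 a $\Lambda$-faithful tight representation with a gauge coaction, the representation $S$ that defines $C^*_{min}(\Lambda)$ exists, and $C^*_{tight}(\Lambda)\not\cong C^*_{min}(\Lambda)$: they are not even isomorphic as $C^*$-algebras. Hence there is no gauge-invariant uniqueness theorem for $\Lambda$: it is not true that any two $\Lambda$-faithful tight representations of $\Lambda$ with gauge coactions are canonically isomorphic. -/

import Mathlib

universe u v w u₁ u₂

open scoped TensorProduct
open UniformSpace

noncomputable section
namespace PGraphAlg

/-! ### C⋆-seminorms and completions -/

/-- A C⋆-seminorm on a (non-unital) complex ⋆-algebra. -/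
structure CStarSeminorm (F : Type u) [NonUnitalRing F] [Module ℂ F] [StarRing F] extends
    Seminorm ℂ F where
  mul_le' : ∀ x y, toFun (x * y) ≤ toFun x * toFun y
  star_mul_self' : ∀ x, toFun (star x * x) = toFun x * toFun x

namespace CStarSeminorm
variable {F : Type u} [NonUnitalRing F] [Module ℂ F] [StarRing F]

/-- The C⋆-seminorm `x ↦ ‖φ x‖` of a ⋆-homomorphism into a C⋆-algebra. -/
def comap {B : Type v} [NonUnitalCStarAlgebra B] (φ : F →⋆ₙₐ[ℂ] B) : CStarSeminorm F where
  toFun x := ‖φ x‖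
  map_zero' := by simp
  add_le' x y := by rw [map_add]; exact norm_add_le _ _
  neg' x := by
    have h : φ (-x) = -φ x := by
      rw [eq_neg_iff_add_eq_zero, ← map_add, neg_add_cancel, map_zero]
    rw [h, norm_neg]
  smul' c x := by rw [map_smul, norm_smul]
  mul_le' x y := by rw [map_mul]; exact norm_mul_le _ _
  star_mul_self' x := by rw [map_mul, map_star]; exact CStarRing.norm_star_mul_self

/-- The pointwise supremum of a pointwise bounded set of C⋆-seminorms. -/
def sup (S : Set (CStarSeminorm F)) (hS : ∀ x, ∃ C : ℝ, ∀ p ∈ S, p.toSeminorm x ≤ C) :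
    CStarSeminorm F :=
  have hle : ∀ x, ∀ p : S, p.1.toSeminorm x ≤ ⨆ q : S, q.1.toSeminorm x := fun x p =>
    le_ciSup (f := fun q : S => q.1.toSeminorm x)
      (let ⟨C, hC⟩ := hS x; ⟨C, by rintro _ ⟨q, rfl⟩; exact hC q.1 q.2⟩) p
  have h0 : ∀ x, 0 ≤ ⨆ q : S, q.1.toSeminorm x := fun x =>
    Real.iSup_nonneg fun q => apply_nonneg q.1.toSeminorm x
  { toFun := fun x => ⨆ p : S, p.1.toSeminorm x
    map_zero' := by simp
    add_le' := fun x y => Real.iSup_le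
      (fun p => (map_add_le_add p.1.toSeminorm x y).trans (add_le_add (hle x p) (hle y p)))
      (add_nonneg (h0 x) (h0 y))
    neg' := fun x => by simp
    smul' := fun c x => by
      simp only [map_smul_eq_mul]
      exact (Real.mul_iSup_of_nonneg (norm_nonneg c) _).symm
    mul_le' := fun x y => Real.iSup_le
      (fun p => (p.1.mul_le' x y).trans
        (mul_le_mul (hle x p) (hle y p) (apply_nonneg p.1.toSeminorm y) (h0 x)))
      (mul_nonneg (h0 x) (h0 y))
    star_mul_self' := fun x => by
      apply le_antisymm
      · exact Real.iSup_le (fun p => (p.1.star_mul_self' x).le.trans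
          (mul_le_mul (hle x p) (hle x p) (apply_nonneg p.1.toSeminorm x) (h0 x)))
          (mul_nonneg (h0 x) (h0 x))
      · have h1 : (⨆ p : S, p.1.toSeminorm x) ≤ √(⨆ p : S, p.1.toSeminorm (star x * x)) :=
          Real.iSup_le (fun p => Real.le_sqrt_of_sq_le (by
            rw [sq]; exact (p.1.star_mul_self' x).ge.trans (hle _ p))) (Real.sqrt_nonneg _)
        calc _ ≤ √(⨆ p : S, p.1.toSeminorm (star x * x)) *
              √(⨆ p : S, p.1.toSeminorm (star x * x)) :=
            mul_le_mul h1 h1 (h0 x) (Real.sqrt_nonneg _)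
          _ = _ := Real.mul_self_sqrt (h0 _) }

theorem sup_apply (S : Set (CStarSeminorm F)) (hS : ∀ x, ∃ C : ℝ, ∀ p ∈ S, p.toSeminorm x ≤ C)
    (x : F) : (sup S hS).toSeminorm x = ⨆ p : S, p.1.toSeminorm x := rfl

theorem le_sup (S : Set (CStarSeminorm F)) (hS : ∀ x, ∃ C : ℝ, ∀ p ∈ S, p.toSeminorm x ≤ C)
    {p : CStarSeminorm F} (hp : p ∈ S) (x : F) : p.toSeminorm x ≤ (sup S hS).toSeminorm x :=
  le_ciSup (f := fun q : S => q.1.toSeminorm x)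
    (let ⟨C, hC⟩ := hS x; ⟨C, by rintro _ ⟨q, rfl⟩; exact hC q.1 q.2⟩) ⟨p, hp⟩

end CStarSeminorm

section Completion

variable {F : Type u} [NonUnitalRing F] [Module ℂ F] [StarRing F]

/-- A type synonym of `F`, carrying the topology of the C⋆-seminorm `N`. -/
def PreCStar (_N : CStarSeminorm F) : Type u := F

variable (N : CStarSeminorm F)

instance : NonUnitalSeminormedRing (PreCStar N) :=
  { (inferInstance : NonUnitalRing F),
    N.toSeminorm.toAddGroupSeminorm.toSeminormedAddCommGroup with
    norm_mul_le := N.mul_le' }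

theorem PreCStar.norm_def (x : PreCStar N) : ‖x‖ = N.toSeminorm x := rfl

instance : NormedSpace ℂ (PreCStar N) :=
  { (inferInstance : Module ℂ F) with
    norm_smul_le := fun c x => (N.smul' c x).le }

instance : StarRing (PreCStar N) := { (inferInstance : StarRing F) with }
instance [StarModule ℂ F] : StarModule ℂ (PreCStar N) where
  star_smul := star_smul (R := ℂ) (A := F)
instance [IsScalarTower ℂ F F] : IsScalarTower ℂ (PreCStar N) (PreCStar N) where
  smul_assoc := smul_assoc (M := ℂ) (N := F) (α := F)
instance [SMulCommClass ℂ F F] : SMulCommClass ℂ (PreCStar N) (PreCStar N) where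
  smul_comm := smul_comm (M := ℂ) (N := F) (α := F)

theorem PreCStar.norm_star_mul_self (x : PreCStar N) : ‖star x * x‖ = ‖x‖ * ‖x‖ :=
  N.star_mul_self' x

instance : NormedStarGroup (PreCStar N) where
  norm_star_le := by
    have h : ∀ x : PreCStar N, ‖x‖ ≤ ‖star x‖ := fun x => by
      have h1 := PreCStar.norm_star_mul_self N x
      have h2 := norm_mul_le (star x) x
      by_contra hlt
      push Not at hlt
      have h3 : 0 < ‖x‖ := (norm_nonneg _).trans_lt hlt
      nlinarith
    intro x
    simpa using h (star x)

/-- The C⋆-algebra obtained by separating and completing `F` in the C⋆-seminorm `N`. -/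
def CStarCompletion : Type u := Completion (PreCStar N)

namespace CStarCompletion

instance : NormedAddCommGroup (CStarCompletion N) :=
  inferInstanceAs (NormedAddCommGroup (Completion (PreCStar N)))
instance : NormedSpace ℂ (CStarCompletion N) :=
  inferInstanceAs (NormedSpace ℂ (Completion (PreCStar N)))
instance : CompleteSpace (CStarCompletion N) :=
  inferInstanceAs (CompleteSpace (Completion (PreCStar N)))

/-- The canonical map `F → CStarCompletion N`. -/
def of (x : F) : CStarCompletion N := ((show PreCStar N from x : PreCStar N) : Completion (PreCStar N))

theorem denseRange_of : DenseRange (of N) := Completion.denseRange_coe (α := PreCStar N)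
theorem norm_of (x : F) : ‖of N x‖ = N.toSeminorm x := Completion.norm_coe (E := PreCStar N) x
theorem of_add (x y : F) : of N (x + y) = of N x + of N y :=
  Completion.coe_add (α := PreCStar N) x y
theorem of_zero : of N 0 = 0 := Completion.coe_zero (α := PreCStar N)
theorem of_smul (c : ℂ) (x : F) : of N (c • x) = c • of N x :=
  Completion.coe_smul (X := PreCStar N) c x

@[elab_as_elim]
theorem induction {p : CStarCompletion N → Prop} (x : CStarCompletion N)
    (hp : IsClosed {x | p x}) (ih : ∀ x, p (of N x)) : p x :=
  Completion.induction_on (α := PreCStar N) x hp ih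

instance : Mul (CStarCompletion N) where
  mul := Function.curry <| ((Completion.isDenseInducing_coe (α := PreCStar N)).prodMap
    (Completion.isDenseInducing_coe (α := PreCStar N))).extend
      (fun p : PreCStar N × PreCStar N => ((p.1 * p.2 : PreCStar N) : Completion (PreCStar N)))

theorem of_mul (x y : F) : of N (x * y) = of N x * of N y :=
  (((Completion.isDenseInducing_coe (α := PreCStar N)).prodMap
    (Completion.isDenseInducing_coe (α := PreCStar N))).extend_eq
      ((Completion.continuous_coe (PreCStar N)).comp continuous_mul) (x, y)).symm

instance : ContinuousMul (CStarCompletion N) where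
  continuous_mul := by
    let m := (AddMonoidHom.mul : PreCStar N →+ PreCStar N →+ PreCStar N).compr₂ Completion.toCompl
    have : Continuous fun p : PreCStar N × PreCStar N => m p.1 p.2 :=
      (Completion.continuous_coe (PreCStar N)).comp continuous_mul
    have di : IsDenseInducing (Completion.toCompl : PreCStar N → Completion (PreCStar N)) :=
      Completion.isDenseInducing_coe
    exact (di.extend_Z_bilin di this :)

instance : Star (CStarCompletion N) where
  star := Completion.map (star : PreCStar N → PreCStar N)

theorem of_star (x : F) : of N (star x) = star (of N x) :=
  (Completion.map_coe (α := PreCStar N) (β := PreCStar N)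
    (star_isometry (E := PreCStar N)).uniformContinuous x).symm

theorem continuous_star' : Continuous (star : CStarCompletion N → CStarCompletion N) :=
  Completion.continuous_map

@[elab_as_elim]
theorem induction₂ {p : CStarCompletion N → CStarCompletion N → Prop} (x y : CStarCompletion N)
    (hp : IsClosed {x : CStarCompletion N × CStarCompletion N | p x.1 x.2})
    (ih : ∀ x y, p (of N x) (of N y)) : p x y :=
  Completion.induction_on₂ (α := PreCStar N) (β := PreCStar N) x y hp ih

@[elab_as_elim]
theorem induction₃ {p : CStarCompletion N → CStarCompletion N → CStarCompletion N → Prop}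
    (x y z : CStarCompletion N)
    (hp : IsClosed {x : CStarCompletion N × CStarCompletion N × CStarCompletion N |
      p x.1 x.2.1 x.2.2})
    (ih : ∀ x y z, p (of N x) (of N y) (of N z)) : p x y z :=
  Completion.induction_on₃ (α := PreCStar N) (β := PreCStar N) (γ := PreCStar N) x y z hp ih

instance : NonUnitalNormedRing (CStarCompletion N) :=
  { (inferInstance : NormedAddCommGroup (CStarCompletion N)),
    (inferInstance : Mul (CStarCompletion N)) with
    zero_mul := fun a => induction N a (isClosed_eq (by fun_prop) (by fun_prop)) fun a => by
      rw [← of_zero, ← of_mul, zero_mul]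
    mul_zero := fun a => induction N a (isClosed_eq (by fun_prop) (by fun_prop)) fun a => by
      rw [← of_zero, ← of_mul, mul_zero]
    mul_assoc := fun a b c =>
      induction₃ N a b c (isClosed_eq (by fun_prop) (by fun_prop)) fun a b c => by
        rw [← of_mul, ← of_mul, ← of_mul, ← of_mul, mul_assoc]
    left_distrib := fun a b c =>
      induction₃ N a b c (isClosed_eq (by fun_prop) (by fun_prop)) fun a b c => by
        rw [← of_add, ← of_mul, ← of_mul, ← of_mul, ← of_add, mul_add]
    right_distrib := fun a b c =>
      induction₃ N a b c (isClosed_eq (by fun_prop) (by fun_prop)) fun a b c => by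
        rw [← of_add, ← of_mul, ← of_mul, ← of_mul, ← of_add, add_mul]
    norm_mul_le := fun a b =>
      induction₂ N a b (isClosed_le (by fun_prop) (by fun_prop)) fun a b => by
        rw [← of_mul, norm_of, norm_of, norm_of]
        exact N.mul_le' a b }

instance : StarRing (CStarCompletion N) where
  star_involutive := fun a =>
    induction N a (isClosed_eq ((continuous_star' N).comp (continuous_star' N)) continuous_id)
      fun a => by rw [← of_star, ← of_star, star_star]
  star_mul := fun a b =>
    induction₂ N a b
      (isClosed_eq ((continuous_star' N).comp (by fun_prop))
        (((continuous_star' N).comp continuous_snd).mul ((continuous_star' N).comp continuous_fst)))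
      fun a b => by rw [← of_mul, ← of_star, ← of_star, ← of_star, ← of_mul, star_mul]
  star_add := fun a b =>
    induction₂ N a b
      (isClosed_eq ((continuous_star' N).comp (by fun_prop))
        (((continuous_star' N).comp continuous_fst).add ((continuous_star' N).comp continuous_snd)))
      fun a b => by rw [← of_add, ← of_star, ← of_star, ← of_star, ← of_add, star_add]

instance : CStarRing (CStarCompletion N) where
  norm_mul_self_le := fun a =>
    induction N a
      (isClosed_le (by fun_prop) (((continuous_star' N).mul continuous_id).norm)) fun a => by
        rw [← of_star, ← of_mul, norm_of, norm_of]
        exact (N.star_mul_self' a).ge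

instance [IsScalarTower ℂ F F] : IsScalarTower ℂ (CStarCompletion N) (CStarCompletion N) where
  smul_assoc := fun c a b => by
    refine induction₂ N a b ?_ fun a b => ?_
    · exact isClosed_eq ((continuous_fst.const_smul c).mul continuous_snd)
        ((continuous_fst.mul continuous_snd).const_smul c)
    · rw [smul_eq_mul, smul_eq_mul, ← of_smul, ← of_mul, ← of_mul, ← of_smul, smul_mul_assoc]

instance [SMulCommClass ℂ F F] : SMulCommClass ℂ (CStarCompletion N) (CStarCompletion N) where
  smul_comm := fun c a b => by
    refine induction₂ N a b ?_ fun a b => ?_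
    · exact isClosed_eq ((continuous_fst.mul continuous_snd).const_smul c)
        (continuous_fst.mul (continuous_snd.const_smul c))
    · rw [smul_eq_mul, smul_eq_mul, ← of_smul, ← of_mul, ← of_mul, ← of_smul, mul_smul_comm]

instance [StarModule ℂ F] : StarModule ℂ (CStarCompletion N) where
  star_smul := fun c a => by
    refine induction N a ?_ fun a => ?_
    · exact isClosed_eq ((continuous_star' N).comp (continuous_const_smul c))
        (show Continuous fun x => star c • star x from (continuous_star' N).const_smul (star c))
    · rw [← of_smul, ← of_star, ← of_star, ← of_smul, star_smul]

instance [StarModule ℂ F] [IsScalarTower ℂ F F] [SMulCommClass ℂ F F] :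
    NonUnitalCStarAlgebra (CStarCompletion N) where

/-- The canonical ⋆-homomorphism `F → CStarCompletion N`. -/
def ofHom : F →⋆ₙₐ[ℂ] CStarCompletion N where
  toFun := of N
  map_smul' := of_smul N
  map_zero' := of_zero N
  map_add' := of_add N
  map_mul' := of_mul N
  map_star' := of_star N

@[simp] theorem ofHom_apply (x : F) : ofHom N x = of N x := rfl

section lift
variable {B : Type v} [NonUnitalCStarAlgebra B] (φ : F →⋆ₙₐ[ℂ] B)

/-- The continuous extension to the completion of a map dominated by the C⋆-seminorm. -/
def liftFun (_hφ : ∀ x, ‖φ x‖ ≤ N.toSeminorm x) : CStarCompletion N → B :=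
  Completion.extension (α := PreCStar N) (fun x => φ x)

theorem liftFun_uniformContinuous (hφ : ∀ x, ‖φ x‖ ≤ N.toSeminorm x) :
    UniformContinuous (fun x : PreCStar N => φ x) :=
  AddMonoidHomClass.uniformContinuous_of_bound
    (({ toFun := φ, map_zero' := map_zero φ, map_add' := map_add φ } : PreCStar N →+ B)) 1
    (fun x => (hφ x).trans (one_mul ‖x‖).ge)

theorem liftFun_of (hφ : ∀ x, ‖φ x‖ ≤ N.toSeminorm x) (x : F) :
    liftFun N φ hφ (of N x) = φ x :=
  Completion.extension_coe (α := PreCStar N) (liftFun_uniformContinuous N φ hφ) x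

theorem continuous_liftFun (hφ : ∀ x, ‖φ x‖ ≤ N.toSeminorm x) : Continuous (liftFun N φ hφ) := Completion.continuous_extension

/-- A ⋆-homomorphism dominated by the C⋆-seminorm `N` extends to the completion. -/
def lift (hφ : ∀ x, ‖φ x‖ ≤ N.toSeminorm x) :
    CStarCompletion N →⋆ₙₐ[ℂ] B where
  toFun := liftFun N φ hφ
  map_smul' := fun c a =>
    induction N a (isClosed_eq ((continuous_liftFun N φ hφ).comp (continuous_const_smul c))
      ((continuous_liftFun N φ hφ).const_smul _)) fun a => by
      simp only [MonoidHom.id_apply, ← of_smul, liftFun_of, map_smul]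
  map_zero' := by rw [← of_zero, liftFun_of, map_zero]
  map_add' := fun a b =>
    induction₂ N a b (isClosed_eq ((continuous_liftFun N φ hφ).comp (by fun_prop))
      (((continuous_liftFun N φ hφ).comp continuous_fst).add
        ((continuous_liftFun N φ hφ).comp continuous_snd))) fun a b => by
      simp only [← of_add, liftFun_of, map_add]
  map_mul' := fun a b =>
    induction₂ N a b (isClosed_eq ((continuous_liftFun N φ hφ).comp (by fun_prop))
      (((continuous_liftFun N φ hφ).comp continuous_fst).mul
        ((continuous_liftFun N φ hφ).comp continuous_snd))) fun a b => by
      simp only [← of_mul, liftFun_of, map_mul]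
  map_star' := fun a =>
    induction N a (isClosed_eq ((continuous_liftFun N φ hφ).comp (continuous_star' N))
      ((continuous_liftFun N φ hφ).star)) fun a => by
      simp only [← of_star, liftFun_of, map_star]

@[simp] theorem lift_of (hφ : ∀ x, ‖φ x‖ ≤ N.toSeminorm x) (x : F) :
    lift N φ hφ (of N x) = φ x := liftFun_of N φ hφ x

end lift

end CStarCompletion
end Completion


/-! ### Universal C⋆-algebras on generators and relations -/

section Free
variable (X : Type u)

/-- Words in the letters `x` (written `(x, false)`) and `x⋆` (written `(x, true)`). -/
abbrev StarWord : Type u := FreeSemigroup (X × Bool)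

variable {X} in
/-- The formal adjoint of a word, as a homomorphism into the opposite semigroup. -/
def StarWord.adjointHom : StarWord X →ₙ* (StarWord X)ᵐᵒᵖ :=
  FreeSemigroup.lift fun p => MulOpposite.op (FreeSemigroup.of (p.1, !p.2))

instance : StarMul (StarWord X) where
  star w := (StarWord.adjointHom w).unop
  star_involutive w := by
    induction w using FreeSemigroup.recOnMul with
    | ih1 p => simp [StarWord.adjointHom]
    | ih2 p w h1 h2 =>
      simp only [map_mul, MulOpposite.unop_mul]
      exact congrArg₂ (· * ·) h1 h2
  star_mul v w := by simp [map_mul]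

/-- The free (non-unital) complex ⋆-algebra on the set `X`. -/
abbrev FreeStarAlg : Type u := MonoidAlgebra ℂ (StarWord X)

namespace FreeStarAlg
variable {X}

/-- The additive map `∑ c_w w ↦ ∑ (conj c_w) w⋆`. -/
def starHom : FreeStarAlg X →+ FreeStarAlg X :=
  (Finsupp.liftAddHom fun w : StarWord X =>
    (MonoidAlgebra.singleAddHom (R := ℂ) (star w)).comp
      (starAddEquiv (R := ℂ)).toAddMonoidHom).comp
    (MonoidAlgebra.coeffAddEquiv (R := ℂ) (M := StarWord X)).toAddMonoidHom

theorem starHom_single (w : StarWord X) (c : ℂ) :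
    starHom (MonoidAlgebra.single w c) = MonoidAlgebra.single (star w) (star c) := by
  simp [starHom]

instance : StarRing (FreeStarAlg X) where
  star := starHom
  star_involutive x := by
    induction x using MonoidAlgebra.induction_linear with
    | zero => simp
    | single w c => rw [starHom_single, starHom_single, star_star, star_star]
    | add x y hx hy => rw [map_add, map_add, hx, hy]
  star_mul x y := by
    induction x using MonoidAlgebra.induction_linear with
    | zero => simp
    | add x x' hx hx' => rw [add_mul, map_add, hx, hx', map_add, mul_add]
    | single w c =>
      induction y using MonoidAlgebra.induction_linear with
      | zero => simp
      | add y y' hy hy' => rw [mul_add, map_add, hy, hy', map_add, add_mul]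
      | single v d =>
        rw [MonoidAlgebra.single_mul_single, starHom_single, starHom_single, starHom_single,
          MonoidAlgebra.single_mul_single, star_mul, star_mul]
  star_add x y := map_add _ x y

theorem star_single (w : StarWord X) (c : ℂ) :
    star (MonoidAlgebra.single w c : FreeStarAlg X) = MonoidAlgebra.single (star w) (star c) :=
  starHom_single w c

instance : StarModule ℂ (FreeStarAlg X) where
  star_smul c x := by
    induction x using MonoidAlgebra.induction_linear with
    | zero => simp
    | add x y hx hy => rw [smul_add, star_add, hx, hy, star_add, smul_add]
    | single w d => simp [star_single, MonoidAlgebra.smul_single]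

/-- The generator of the free ⋆-algebra belonging to `x`. -/
def gen (x : X) : FreeStarAlg X := MonoidAlgebra.single (FreeSemigroup.of (x, false)) 1

variable {B : Type v} [NonUnitalCStarAlgebra B]

/-- The value of a word under the substitution `x ↦ y x`. -/
def evalWord (y : X → B) : StarWord X →ₙ* B :=
  FreeSemigroup.lift fun p => bif p.2 then star (y p.1) else y p.1

theorem evalWord_star (y : X → B) (w : StarWord X) :
    evalWord y (star w) = star (evalWord y w) := by
  induction w using FreeSemigroup.recOnMul with
  | ih1 p =>
    have : star (FreeSemigroup.of p) = FreeSemigroup.of (p.1, !p.2) := rfl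
    rw [this]
    rcases p with ⟨x, _ | _⟩ <;> simp [evalWord]
  | ih2 p w h1 h2 => rw [star_mul, map_mul, map_mul, star_mul, h1, h2]

/-- The ⋆-homomorphism out of the free ⋆-algebra that substitutes `y x` for the generator `x`. -/
def eval (y : X → B) : FreeStarAlg X →⋆ₙₐ[ℂ] B where
  toNonUnitalAlgHom := MonoidAlgebra.liftMagma ℂ (evalWord y)
  map_star' a := by
    change MonoidAlgebra.liftMagma ℂ (evalWord y) (star a) =
      star (MonoidAlgebra.liftMagma ℂ (evalWord y) a)
    induction a using MonoidAlgebra.induction_linear with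
    | zero => simp
    | add a b ha hb => rw [star_add, map_add, ha, hb, map_add, star_add]
    | single w c => rw [star_single]; simp [evalWord_star]

theorem eval_single (y : X → B) (w : StarWord X) (c : ℂ) :
    eval y (MonoidAlgebra.single w c) = c • evalWord y w := by
  change MonoidAlgebra.liftMagma ℂ (evalWord y) _ = _
  simp

@[simp] theorem eval_gen (y : X → B) (x : X) : eval y (gen x) = y x := by
  rw [gen, eval_single]; simp [evalWord]

theorem norm_evalWord_le (y : X → B) (hy : ∀ x, ‖y x‖ ≤ 1) (w : StarWord X) :
    ‖evalWord y w‖ ≤ 1 := by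
  induction w using FreeSemigroup.recOnMul with
  | ih1 p => rcases p with ⟨x, _ | _⟩ <;> simpa [evalWord] using hy x
  | ih2 p w h1 h2 =>
    rw [map_mul]
    exact (norm_mul_le _ _).trans (mul_le_one₀ h1 (norm_nonneg _) h2)

theorem exists_norm_eval_le (a : FreeStarAlg X) :
    ∃ C : ℝ, ∀ (B : Type v) [NonUnitalCStarAlgebra B] (y : X → B), (∀ x, ‖y x‖ ≤ 1) →
      ‖eval y a‖ ≤ C := by
  induction a using MonoidAlgebra.induction_linear with
  | zero => exact ⟨0, fun B _ y _ => by simp⟩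
  | add a b ha hb =>
    obtain ⟨C, hC⟩ := ha
    obtain ⟨D, hD⟩ := hb
    exact ⟨C + D, fun B _ y hy => by
      rw [map_add]; exact (norm_add_le _ _).trans (add_le_add (hC B y hy) (hD B y hy))⟩
  | single w c =>
    refine ⟨‖c‖, fun B _ y hy => ?_⟩
    rw [eval_single, norm_smul]
    exact mul_le_of_le_one_right (norm_nonneg _) (norm_evalWord_le y hy w)

end FreeStarAlg

/-- A system of relations for a family `y : X → B` of elements of a C⋆-algebra `B`, all of whose
solutions consist of contractions. -/
structure StarRelations (X : Type u) where
  Holds : ∀ (B : Type u) [NonUnitalCStarAlgebra B], (X → B) → Prop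
  norm_le_one : ∀ (B : Type u) [NonUnitalCStarAlgebra B] (y : X → B), Holds B y → ∀ x, ‖y x‖ ≤ 1

end Free

section Universal
variable {X : Type u} (R : StarRelations X)

/-- The universal C⋆-seminorm: the supremum of the norms in all representations. -/
def StarRelations.universalSeminorm : CStarSeminorm (FreeStarAlg X) :=
  CStarSeminorm.sup
    {p | ∃ (B : Type u) (_ : NonUnitalCStarAlgebra B) (y : X → B),
      R.Holds B y ∧ p = CStarSeminorm.comap (FreeStarAlg.eval y)}
    (fun a => by
      obtain ⟨C, hC⟩ := FreeStarAlg.exists_norm_eval_le.{u, u} a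
      refine ⟨C, ?_⟩
      rintro _ ⟨B, _, y, hy, rfl⟩
      exact hC B y (R.norm_le_one B y hy))

theorem StarRelations.norm_eval_le {B : Type u} [NonUnitalCStarAlgebra B] (y : X → B)
    (hy : R.Holds B y) (a : FreeStarAlg X) :
    ‖FreeStarAlg.eval y a‖ ≤ R.universalSeminorm.toSeminorm a := by
  have hmem : CStarSeminorm.comap (FreeStarAlg.eval y) ∈
      {p | ∃ (B : Type u) (_ : NonUnitalCStarAlgebra B) (y : X → B),
        R.Holds B y ∧ p = CStarSeminorm.comap (FreeStarAlg.eval y)} := ⟨B, _, y, hy, rfl⟩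
  exact CStarSeminorm.le_sup _ _ hmem a

/-- The universal C⋆-algebra of the generators `X` and the relations `R`. -/
abbrev UniversalCStar : Type u := CStarCompletion R.universalSeminorm

namespace UniversalCStar

/-- The generator of the universal C⋆-algebra belonging to `x`. -/
def gen (x : X) : UniversalCStar R := CStarCompletion.of _ (FreeStarAlg.gen x)

variable {R} in
/-- The universal property. -/
def lift {B : Type u} [NonUnitalCStarAlgebra B] (y : X → B) (hy : R.Holds B y) :
    UniversalCStar R →⋆ₙₐ[ℂ] B :=
  CStarCompletion.lift R.universalSeminorm (FreeStarAlg.eval y) (R.norm_eval_le y hy)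

@[simp] theorem lift_gen {B : Type u} [NonUnitalCStarAlgebra B] (y : X → B) (hy : R.Holds B y)
    (x : X) : lift y hy (gen R x) = y x := by
  simp only [lift, gen]
  rw [CStarCompletion.lift_of, FreeStarAlg.eval_gen]

theorem of_eq_of {a b : FreeStarAlg X}
    (h : ∀ (B : Type u) [NonUnitalCStarAlgebra B] (y : X → B), R.Holds B y →
      FreeStarAlg.eval y a = FreeStarAlg.eval y b) :
    (CStarCompletion.of R.universalSeminorm a : UniversalCStar R) =
      CStarCompletion.of R.universalSeminorm b := by
  rw [← sub_eq_zero, ← norm_le_zero_iff, sub_eq_add_neg, ← neg_one_smul ℂ,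
    ← CStarCompletion.of_smul, ← CStarCompletion.of_add, CStarCompletion.norm_of]
  refine Real.iSup_le ?_ le_rfl
  rintro ⟨_, B, _, y, hy, rfl⟩
  change ‖FreeStarAlg.eval y (a + (-1 : ℂ) • b)‖ ≤ 0
  rw [map_add, map_smul, h B y hy, neg_one_smul, add_neg_cancel, norm_zero]

end UniversalCStar

end Universal

/-! ### The minimal tensor product -/

section Tensor

section
variable {E : Type u} [NormedAddCommGroup E] [InnerProductSpace ℂ E]

theorem completion_zero : (0 : E →L[ℂ] E).completion = 0 := by
  ext ξ
  induction ξ using Completion.induction_on with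
  | hp => exact isClosed_eq (by fun_prop) (by fun_prop)
  | ih ξ => simp

theorem completion_add (S T : E →L[ℂ] E) :
    (S + T).completion = S.completion + T.completion := by
  ext ξ
  induction ξ using Completion.induction_on with
  | hp => exact isClosed_eq (by fun_prop) (by fun_prop)
  | ih ξ => simp [Completion.coe_add]

theorem completion_smul (c : ℂ) (T : E →L[ℂ] E) : (c • T).completion = c • T.completion := by
  ext ξ
  change (c • T).completion ξ = c • T.completion ξ
  induction ξ using Completion.induction_on with
  | hp => exact isClosed_eq (by fun_prop) ((ContinuousLinearMap.continuous _).const_smul c)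
  | ih ξ =>
    rw [ContinuousLinearMap.completion_apply_coe, ContinuousLinearMap.completion_apply_coe,
      ← Completion.coe_smul]
    rfl

theorem completion_mul (S T : E →L[ℂ] E) :
    (S * T).completion = S.completion * T.completion := by
  ext ξ
  change (S * T).completion ξ = S.completion (T.completion ξ)
  induction ξ using Completion.induction_on with
  | hp => exact isClosed_eq (by fun_prop) (by fun_prop)
  | ih ξ =>
    rw [ContinuousLinearMap.completion_apply_coe, ContinuousLinearMap.completion_apply_coe,
      ContinuousLinearMap.completion_apply_coe]
    rfl

theorem completion_star (S T : E →L[ℂ] E) (h : ∀ ξ η, inner ℂ (S ξ) η = inner ℂ ξ (T η)) :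
    S.completion = star T.completion := by
  refine (ContinuousLinearMap.eq_adjoint_iff _ _).mpr ?_
  intro ξ η
  induction ξ, η using Completion.induction_on₂ with
  | hp => exact isClosed_eq (by fun_prop) (by fun_prop)
  | ih ξ η => simp [h]

theorem norm_completion_le (T : E →L[ℂ] E) : ‖T.completion‖ ≤ ‖T‖ := by
  refine ContinuousLinearMap.opNorm_le_bound _ (norm_nonneg _) fun ξ => ?_
  induction ξ using Completion.induction_on with
  | hp => exact isClosed_le (by fun_prop) (by fun_prop)
  | ih ξ => simpa using T.le_opNorm ξ

end

section Rep
variable {A : Type u₁} {B : Type u₂} [NonUnitalCStarAlgebra A] [NonUnitalCStarAlgebra B]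
variable {H : Type u} {K : Type v} [NormedAddCommGroup H] [InnerProductSpace ℂ H] [CompleteSpace H]
  [NormedAddCommGroup K] [InnerProductSpace ℂ K] [CompleteSpace K]

/-- The bounded linear operator `∑ π(aᵢ) ⊗ ρ(bᵢ)` on the (algebraic) tensor product. -/
def tensorOp (π : A →⋆ₙₐ[ℂ] (H →L[ℂ] H)) (ρ : B →⋆ₙₐ[ℂ] (K →L[ℂ] K)) :
    A ⊗[ℂ] B →ₗ[ℂ] (H ⊗[ℂ] K →L[ℂ] H ⊗[ℂ] K) :=
  TensorProduct.lift (LinearMap.mk₂ ℂ (fun a b => TensorProduct.mapL (π a) (ρ b))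
    (fun a a' b => by rw [map_add, TensorProduct.mapL_add_left])
    (fun c a b => by rw [map_smul, TensorProduct.mapL_smul_left])
    (fun a b b' => by rw [map_add, TensorProduct.mapL_add_right])
    (fun c a b => by rw [map_smul, TensorProduct.mapL_smul_right]))

@[simp] theorem tensorOp_tmul (π : A →⋆ₙₐ[ℂ] (H →L[ℂ] H)) (ρ : B →⋆ₙₐ[ℂ] (K →L[ℂ] K))
    (a : A) (b : B) : tensorOp π ρ (a ⊗ₜ b) = TensorProduct.mapL (π a) (ρ b) := rfl

theorem tensorOp_mul (π : A →⋆ₙₐ[ℂ] (H →L[ℂ] H)) (ρ : B →⋆ₙₐ[ℂ] (K →L[ℂ] K))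
    (x y : A ⊗[ℂ] B) : tensorOp π ρ (x * y) = tensorOp π ρ x * tensorOp π ρ y := by
  induction x with
  | zero => simp
  | add x x' hx hx' => rw [add_mul, map_add, hx, hx', map_add, add_mul]
  | tmul a b =>
    induction y with
    | zero => simp
    | add y y' hy hy' => rw [mul_add, map_add, hy, hy', map_add, mul_add]
    | tmul a' b' => simp [TensorProduct.mapL_mul]

theorem inner_tensorOp (π : A →⋆ₙₐ[ℂ] (H →L[ℂ] H)) (ρ : B →⋆ₙₐ[ℂ] (K →L[ℂ] K))
    (x : A ⊗[ℂ] B) (ξ η : H ⊗[ℂ] K) :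
    inner ℂ (tensorOp π ρ (star x) ξ) η = inner ℂ ξ (tensorOp π ρ x η) := by
  induction x with
  | zero => simp
  | add x x' hx hx' =>
    rw [star_add, map_add, map_add, add_apply, add_apply,
      inner_add_left, inner_add_right, hx, hx']
  | tmul a b =>
    induction ξ with
    | zero => simp
    | add ξ ξ' h h' => rw [map_add, inner_add_left, inner_add_left, h, h']
    | tmul h k =>
      induction η with
      | zero => simp
      | add η η' h h' => rw [map_add, inner_add_right, inner_add_right, h, h']
      | tmul h' k' =>
        rw [TensorProduct.star_tmul, tensorOp_tmul, tensorOp_tmul, TensorProduct.mapL_tmul,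
          TensorProduct.mapL_tmul, TensorProduct.inner_tmul, TensorProduct.inner_tmul,
          map_star, map_star, ContinuousLinearMap.star_eq_adjoint,
          ContinuousLinearMap.star_eq_adjoint, ContinuousLinearMap.adjoint_inner_left,
          ContinuousLinearMap.adjoint_inner_left]

/-- The representation `π ⊗ ρ` of `A ⊙ B` on the Hilbert space tensor product (the completion of
the algebraic tensor product) of `H` and `K`. -/
def tensorRep (π : A →⋆ₙₐ[ℂ] (H →L[ℂ] H)) (ρ : B →⋆ₙₐ[ℂ] (K →L[ℂ] K)) :
    A ⊗[ℂ] B →⋆ₙₐ[ℂ] (Completion (H ⊗[ℂ] K) →L[ℂ] Completion (H ⊗[ℂ] K)) where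
  toFun x := (tensorOp π ρ x).completion
  map_smul' c x := by
    rw [map_smul, completion_smul]; rfl
  map_zero' := by rw [map_zero, completion_zero]
  map_add' x y := by rw [map_add, completion_add]
  map_mul' x y := by rw [tensorOp_mul, completion_mul]
  map_star' x := completion_star _ _ (inner_tensorOp π ρ x)

/-- The C⋆-seminorm `x ↦ ‖(π ⊗ ρ) x‖` on `A ⊙ B`. -/
def tensorSeminorm (π : A →⋆ₙₐ[ℂ] (H →L[ℂ] H)) (ρ : B →⋆ₙₐ[ℂ] (K →L[ℂ] K)) :
    CStarSeminorm (A ⊗[ℂ] B) :=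
  CStarSeminorm.comap (B := Completion (H ⊗[ℂ] K) →L[ℂ] Completion (H ⊗[ℂ] K)) (tensorRep π ρ)

theorem norm_tensorRep_tmul_le (π : A →⋆ₙₐ[ℂ] (H →L[ℂ] H)) (ρ : B →⋆ₙₐ[ℂ] (K →L[ℂ] K))
    (a : A) (b : B) : ‖tensorRep π ρ (a ⊗ₜ b)‖ ≤ ‖a‖ * ‖b‖ := by
  change ‖(TensorProduct.mapL (π a) (ρ b)).completion‖ ≤ _
  exact (norm_completion_le _).trans ((TensorProduct.norm_mapL_le _ _).trans (mul_le_mul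
    (NonUnitalStarAlgHom.norm_apply_le π a) (NonUnitalStarAlgHom.norm_apply_le ρ b)
    (norm_nonneg _) (norm_nonneg _)))

end Rep
section Min
variable (A B : Type u) [NonUnitalCStarAlgebra A] [NonUnitalCStarAlgebra B]

/-- The C⋆-seminorms `x ↦ ‖(π ⊗ ρ) x‖` on `A ⊙ B`, where `π` and `ρ` are representations of `A` and
`B` on Hilbert spaces. -/
def productSeminorms : Set (CStarSeminorm (A ⊗[ℂ] B)) :=
  {p | ∃ (H : Type u) (_ : NormedAddCommGroup H) (_ : InnerProductSpace ℂ H) (_ : CompleteSpace H)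
    (K : Type u) (_ : NormedAddCommGroup K) (_ : InnerProductSpace ℂ K) (_ : CompleteSpace K)
    (π : A →⋆ₙₐ[ℂ] (H →L[ℂ] H)) (ρ : B →⋆ₙₐ[ℂ] (K →L[ℂ] K)),
    p = tensorSeminorm π ρ}

theorem productSeminorms_bounded (x : A ⊗[ℂ] B) :
    ∃ C : ℝ, ∀ p ∈ productSeminorms A B, p.toSeminorm x ≤ C := by
  induction x with
  | zero => exact ⟨0, fun p _ => by simp⟩
  | add x y hx hy =>
    obtain ⟨C, hC⟩ := hx
    obtain ⟨D, hD⟩ := hy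
    exact ⟨C + D, fun p hp => (map_add_le_add _ x y).trans (add_le_add (hC p hp) (hD p hp))⟩
  | tmul a b =>
    refine ⟨‖a‖ * ‖b‖, ?_⟩
    rintro _ ⟨H, _, _, _, K, _, _, _, π, ρ, rfl⟩
    exact norm_tensorRep_tmul_le π ρ a b

/-- The minimal norm on the algebraic tensor product `A ⊙ B`. -/
def minNorm : CStarSeminorm (A ⊗[ℂ] B) :=
  CStarSeminorm.sup (productSeminorms A B) (productSeminorms_bounded A B)

/-- The minimal (spatial) tensor product of two C⋆-algebras. -/
abbrev MinTensor : Type u := CStarCompletion (minNorm A B)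

variable {A B}

/-- The elementary tensor `a ⊗ b` in the minimal tensor product. -/
def minTmul (a : A) (b : B) : MinTensor A B := CStarCompletion.of (minNorm A B) (a ⊗ₜ b)

theorem norm_tensorRep_le {H K : Type u}
    [NormedAddCommGroup H] [InnerProductSpace ℂ H] [CompleteSpace H]
    [NormedAddCommGroup K] [InnerProductSpace ℂ K] [CompleteSpace K]
    (π : A →⋆ₙₐ[ℂ] (H →L[ℂ] H)) (ρ : B →⋆ₙₐ[ℂ] (K →L[ℂ] K)) (x : A ⊗[ℂ] B) :
    ‖tensorRep π ρ x‖ ≤ (minNorm A B).toSeminorm x :=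
  CStarSeminorm.le_sup _ _
    (show tensorSeminorm π ρ ∈ productSeminorms A B from
      ⟨H, _, _, _, K, _, _, _, π, ρ, rfl⟩) x

theorem minNorm_apply_le (x : A ⊗[ℂ] B) (c : ℝ) (hc : 0 ≤ c)
    (h : ∀ (H K : Type u) [NormedAddCommGroup H] [InnerProductSpace ℂ H] [CompleteSpace H]
      [NormedAddCommGroup K] [InnerProductSpace ℂ K] [CompleteSpace K]
      (π : A →⋆ₙₐ[ℂ] (H →L[ℂ] H)) (ρ : B →⋆ₙₐ[ℂ] (K →L[ℂ] K)), ‖tensorRep π ρ x‖ ≤ c) :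
    (minNorm A B).toSeminorm x ≤ c := by
  refine Real.iSup_le ?_ hc
  rintro ⟨_, H, _, _, _, K, _, _, _, π, ρ, rfl⟩
  exact h H K π ρ

variable {C D : Type u} [NonUnitalCStarAlgebra C] [NonUnitalCStarAlgebra D]

/-- The algebraic tensor product `φ ⊙ ψ` of two ⋆-homomorphisms. -/
def algTensorMap (φ : A →⋆ₙₐ[ℂ] C) (ψ : B →⋆ₙₐ[ℂ] D) : A ⊗[ℂ] B →⋆ₙₐ[ℂ] C ⊗[ℂ] D where
  toFun := TensorProduct.map (φ : A →ₗ[ℂ] C) (ψ : B →ₗ[ℂ] D)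
  map_smul' c x := by simp
  map_zero' := by simp
  map_add' x y := by simp
  map_mul' x y := by
    induction x with
    | zero => simp
    | add x x' hx hx' => rw [add_mul, map_add, hx, hx', map_add, add_mul]
    | tmul a b =>
      induction y with
      | zero => simp
      | add y y' hy hy' => rw [mul_add, map_add, hy, hy', map_add, mul_add]
      | tmul a' b' => simp
  map_star' x := by
    induction x with
    | zero => simp
    | add x y hx hy => rw [star_add, map_add, hx, hy, map_add, star_add]
    | tmul a b => simp [map_star]

@[simp] theorem algTensorMap_tmul (φ : A →⋆ₙₐ[ℂ] C) (ψ : B →⋆ₙₐ[ℂ] D) (a : A) (b : B) :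
    algTensorMap φ ψ (a ⊗ₜ b) = φ a ⊗ₜ ψ b := rfl

theorem tensorRep_algTensorMap {H K : Type u}
    [NormedAddCommGroup H] [InnerProductSpace ℂ H] [CompleteSpace H]
    [NormedAddCommGroup K] [InnerProductSpace ℂ K] [CompleteSpace K]
    (π : C →⋆ₙₐ[ℂ] (H →L[ℂ] H)) (ρ : D →⋆ₙₐ[ℂ] (K →L[ℂ] K))
    (φ : A →⋆ₙₐ[ℂ] C) (ψ : B →⋆ₙₐ[ℂ] D) (x : A ⊗[ℂ] B) :
    tensorRep π ρ (algTensorMap φ ψ x) = tensorRep (π.comp φ) (ρ.comp ψ) x := by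
  induction x with
  | zero => simp only [map_zero]
  | add x y hx hy => rw [map_add, map_add, hx, hy, map_add]
  | tmul a b => rfl

theorem minNorm_algTensorMap_le (φ : A →⋆ₙₐ[ℂ] C) (ψ : B →⋆ₙₐ[ℂ] D) (x : A ⊗[ℂ] B) :
    (minNorm C D).toSeminorm (algTensorMap φ ψ x) ≤ (minNorm A B).toSeminorm x := by
  refine minNorm_apply_le _ _ (apply_nonneg _ _) ?_
  intro H K _ _ _ _ _ _ π ρ
  rw [tensorRep_algTensorMap]
  exact norm_tensorRep_le _ _ _

/-- The ⋆-homomorphism `φ ⊗ ψ` of minimal tensor products. -/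
def minMap (φ : A →⋆ₙₐ[ℂ] C) (ψ : B →⋆ₙₐ[ℂ] D) : MinTensor A B →⋆ₙₐ[ℂ] MinTensor C D :=
  CStarCompletion.lift (minNorm A B)
    ((CStarCompletion.ofHom (minNorm C D)).comp (algTensorMap φ ψ)) fun x => by
      change ‖CStarCompletion.of (minNorm C D) (algTensorMap φ ψ x)‖ ≤ _
      rw [CStarCompletion.norm_of]
      exact minNorm_algTensorMap_le φ ψ x

@[simp] theorem minMap_tmul (φ : A →⋆ₙₐ[ℂ] C) (ψ : B →⋆ₙₐ[ℂ] D) (a : A) (b : B) :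
    minMap φ ψ (minTmul a b) = minTmul (φ a) (ψ b) :=
  CStarCompletion.lift_of _ _ _ _

/-- The algebraic map `A ⊙ B → A ⊗ B` as a linear map. -/
def minIncl (A B : Type u) [NonUnitalCStarAlgebra A] [NonUnitalCStarAlgebra B] :
    A ⊗[ℂ] B →ₗ[ℂ] MinTensor A B where
  toFun := CStarCompletion.of (minNorm A B)
  map_add' := CStarCompletion.of_add _
  map_smul' := CStarCompletion.of_smul _

/-- `AssocEq y z` says that `y ∈ (A ⊗ B) ⊗ C` and `z ∈ A ⊗ (B ⊗ C)` are the same element of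
`A ⊗ B ⊗ C`: the pair `(y, z)` lies in the graph of the canonical isometric isomorphism
`(a ⊗ b) ⊗ c ↦ a ⊗ (b ⊗ c)`, which is the closure of the graph of the associativity isomorphism of
the algebraic tensor products. -/
def AssocEq (y : MinTensor (MinTensor A B) C) (z : MinTensor A (MinTensor B C)) : Prop :=
  (y, z) ∈ closure (Set.range fun x : (A ⊗[ℂ] B) ⊗[ℂ] C =>
    (minIncl (MinTensor A B) C (TensorProduct.map (minIncl A B) LinearMap.id x),
      minIncl A (MinTensor B C) (TensorProduct.map LinearMap.id (minIncl B C)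
        (TensorProduct.assoc ℂ A B C x))))

end Min
end Tensor

/-! ### Group C⋆-algebras and amenability -/

section GroupAlgebra
variable (G : Type u) [Group G]

variable {G} in
/-- A representation of `G` by unitaries of the C⋆-algebra `A`; the first two conditions say that
`u 1` is the unit of `A`. -/
structure IsUnitaryRep {A : Type v} [NonUnitalCStarAlgebra A] (u : G → A) : Prop where
  one_mul : ∀ a, u 1 * a = a
  mul_one : ∀ a, a * u 1 = a
  map_mul : ∀ g h, u g * u h = u (g * h)
  map_star : ∀ g, star (u g) = u g⁻¹

variable {G} in
theorem IsUnitaryRep.norm_le_one {A : Type v} [NonUnitalCStarAlgebra A] {u : G → A}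
    (hu : IsUnitaryRep u) (g : G) : ‖u g‖ ≤ 1 := by
  have h : ∀ g, ‖u g‖ * ‖u g‖ = ‖u 1‖ := fun g => by
    rw [← CStarRing.norm_star_mul_self, hu.map_star, hu.map_mul, inv_mul_cancel]
  have h1 := h 1
  have hg := h g
  have h0 := norm_nonneg (u 1)
  have h2 : ‖u 1‖ ≤ 1 := by nlinarith
  nlinarith [norm_nonneg (u g)]

/-- The relations of unitary representations of `G`. -/
def groupRelations : StarRelations G where
  Holds _ _ u := IsUnitaryRep u
  norm_le_one _ _ _ hu := hu.norm_le_one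

/-- The full group C⋆-algebra of the discrete group `G`. -/
abbrev GroupCStar : Type u := UniversalCStar (groupRelations G)

variable {G} in
/-- The universal unitary representation `g ↦ U_g` of `G`. -/
def fullRep (g : G) : GroupCStar G := UniversalCStar.gen (groupRelations G) g

theorem fullRep_isUnitaryRep : IsUnitaryRep (fullRep : G → GroupCStar G) where
  one_mul a := by
    refine CStarCompletion.induction _ a (isClosed_eq (continuous_const.mul continuous_id)
      continuous_id) fun a => ?_
    rw [fullRep, UniversalCStar.gen, ← CStarCompletion.of_mul]
    refine UniversalCStar.of_eq_of (groupRelations G) fun B _ y hy => ?_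
    rw [map_mul, FreeStarAlg.eval_gen, hy.one_mul]
  mul_one a := by
    refine CStarCompletion.induction _ a (isClosed_eq (continuous_id.mul continuous_const)
      continuous_id) fun a => ?_
    rw [fullRep, UniversalCStar.gen, ← CStarCompletion.of_mul]
    refine UniversalCStar.of_eq_of (groupRelations G) fun B _ y hy => ?_
    rw [map_mul, FreeStarAlg.eval_gen, hy.mul_one]
  map_mul g h := by
    simp only [fullRep, UniversalCStar.gen, ← CStarCompletion.of_mul]
    refine UniversalCStar.of_eq_of (groupRelations G) fun B _ y hy => ?_
    rw [map_mul, FreeStarAlg.eval_gen, FreeStarAlg.eval_gen, FreeStarAlg.eval_gen, hy.map_mul]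
  map_star g := by
    simp only [fullRep, UniversalCStar.gen, ← CStarCompletion.of_star]
    refine UniversalCStar.of_eq_of (groupRelations G) fun B _ y hy => ?_
    rw [map_star, FreeStarAlg.eval_gen, FreeStarAlg.eval_gen, hy.map_star]

theorem minTmul_mul {A B : Type u} [NonUnitalCStarAlgebra A] [NonUnitalCStarAlgebra B]
    (a a' : A) (b b' : B) : minTmul a b * minTmul a' b' = minTmul (a * a') (b * b') := by
  simp only [minTmul, ← CStarCompletion.of_mul, Algebra.TensorProduct.tmul_mul_tmul]

theorem star_minTmul {A B : Type u} [NonUnitalCStarAlgebra A] [NonUnitalCStarAlgebra B]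
    (a : A) (b : B) : star (minTmul a b) = minTmul (star a) (star b) := by
  simp only [minTmul, ← CStarCompletion.of_star, TensorProduct.star_tmul]

theorem diagonal_isUnitaryRep :
    IsUnitaryRep fun g : G => minTmul (fullRep g) (fullRep g) where
  one_mul a := by
    refine CStarCompletion.induction _ a (isClosed_eq (continuous_const.mul continuous_id)
      continuous_id) fun a => ?_
    rw [minTmul, ← CStarCompletion.of_mul]
    congr 1
    induction a with
    | zero => simp
    | add x y hx hy => rw [mul_add, hx, hy]
    | tmul a b => rw [Algebra.TensorProduct.tmul_mul_tmul, (fullRep_isUnitaryRep G).one_mul,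
        (fullRep_isUnitaryRep G).one_mul]
  mul_one a := by
    refine CStarCompletion.induction _ a (isClosed_eq (continuous_id.mul continuous_const)
      continuous_id) fun a => ?_
    rw [minTmul, ← CStarCompletion.of_mul]
    congr 1
    induction a with
    | zero => simp
    | add x y hx hy => rw [add_mul, hx, hy]
    | tmul a b => rw [Algebra.TensorProduct.tmul_mul_tmul, (fullRep_isUnitaryRep G).mul_one,
        (fullRep_isUnitaryRep G).mul_one]
  map_mul g h := by rw [minTmul_mul, (fullRep_isUnitaryRep G).map_mul]
  map_star g := by rw [star_minTmul, (fullRep_isUnitaryRep G).map_star]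

/-- The comultiplication `δ_G : C⋆(G) → C⋆(G) ⊗ C⋆(G)`, `U_g ↦ U_g ⊗ U_g`. -/
def comul : GroupCStar G →⋆ₙₐ[ℂ] MinTensor (GroupCStar G) (GroupCStar G) :=
  UniversalCStar.lift (R := groupRelations G) (fun g => minTmul (fullRep g) (fullRep g))
    (diagonal_isUnitaryRep G)

/-- The Hilbert space `ℓ²(G)`. -/
abbrev EllTwo : Type u := lp (fun _ : G => ℂ) 2

variable {G} in
/-- The left translation `(L_g ξ)(h) = ξ(g⁻¹ h)` on `ℓ²(G)`, so that `L_g e_h = e_{gh}`. -/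
def leftTranslation (g : G) : EllTwo G →ₗᵢ[ℂ] EllTwo G where
  toFun ξ := ⟨fun h => ξ (g⁻¹ * h), by
    have h2 : (0 : ℝ) < (2 : ENNReal).toReal := by norm_num
    have := lp.memℓp ξ
    rw [memℓp_gen_iff h2] at this
    refine (memℓp_gen_iff h2).mpr ?_
    exact (Equiv.mulLeft g⁻¹).summable_iff.mpr this⟩
  map_add' ξ η := rfl
  map_smul' c ξ := rfl
  norm_map' ξ := by
    have h2 : (0 : ℝ) < (2 : ENNReal).toReal := by norm_num
    rw [lp.norm_eq_tsum_rpow h2, lp.norm_eq_tsum_rpow h2]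
    congr 1
    exact (Equiv.mulLeft g⁻¹).tsum_eq (fun h => ‖ξ h‖ ^ (2 : ENNReal).toReal)

variable {G} in
/-- The left-regular representation of `G` on `ℓ²(G)`. -/
def leftRegular (g : G) : EllTwo G →L[ℂ] EllTwo G := (leftTranslation g).toContinuousLinearMap

variable {G} in
theorem leftRegular_apply (g h : G) (ξ : EllTwo G) : leftRegular g ξ h = ξ (g⁻¹ * h) := rfl

theorem leftRegular_isUnitaryRep : IsUnitaryRep (leftRegular : G → EllTwo G →L[ℂ] EllTwo G) := by
  have h1 : (leftRegular (1 : G)) = 1 := by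
    ext ξ h
    simp [leftRegular_apply]
  have hm : ∀ g h : G, leftRegular g * leftRegular h = leftRegular (g * h) := fun g h => by
    ext ξ k
    change leftRegular g (leftRegular h ξ) k = _
    simp only [leftRegular_apply, mul_inv_rev, mul_assoc]
  refine ⟨fun a => by rw [h1, one_mul], fun a => by rw [h1, mul_one], hm, fun g => ?_⟩
  symm
  refine (ContinuousLinearMap.eq_adjoint_iff _ _).mpr fun ξ η => ?_
  rw [← (leftTranslation g).inner_map_map]
  change inner ℂ ((leftRegular g * leftRegular g⁻¹) ξ) _ = _
  rw [hm, mul_inv_cancel, h1]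
  rfl

/-- The ⋆-homomorphism `C⋆(G) → B(ℓ²(G))`, `U_g ↦ L_g`, whose range is the reduced group
C⋆-algebra. -/
def leftRegularHom : GroupCStar G →⋆ₙₐ[ℂ] (EllTwo G →L[ℂ] EllTwo G) :=
  UniversalCStar.lift (R := groupRelations G) (B := EllTwo G →L[ℂ] EllTwo G) leftRegular
    (leftRegular_isUnitaryRep G)

/-- A discrete group is amenable if its full and reduced C⋆-algebras coincide. -/
def IsAmenable : Prop := Function.Injective (leftRegularHom G)

end GroupAlgebra

/-! ### Coactions -/

section Coaction
variable {G : Type u} [Group G] {A : Type u} [NonUnitalCStarAlgebra A]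

/-- A coaction of the discrete group `G` on the C⋆-algebra `A`. -/
structure IsCoaction (δ : A →⋆ₙₐ[ℂ] MinTensor A (GroupCStar G)) : Prop where
  injective : Function.Injective δ
  nondegenerate :
    Dense (Submodule.span ℂ {x | ∃ a y, x = δ a * y} : Set (MinTensor A (GroupCStar G)))
  coaction_identity : ∀ a : A,
    AssocEq (minMap δ (NonUnitalStarAlgHom.id ℂ (GroupCStar G)) (δ a))
      (minMap (NonUnitalStarAlgHom.id ℂ A) (comul G) (δ a))

/-- The graded component `A_g = {a | δ(a) = a ⊗ U_g}` of a coaction. -/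
def gradedComponent (δ : A →⋆ₙₐ[ℂ] MinTensor A (GroupCStar G)) (g : G) : Set A :=
  {a | δ a = minTmul a (fullRep g)}

/-- `Φ` is the conditional expectation of `A` onto `A_1` that vanishes on `A_g` for `g ≠ 1`. -/
structure IsCoactionExpectation (δ : A →⋆ₙₐ[ℂ] MinTensor A (GroupCStar G)) (Φ : A →ₗ[ℂ] A) :
    Prop where
  contractive : ∀ a, ‖Φ a‖ ≤ ‖a‖
  mem : ∀ a, Φ a ∈ gradedComponent δ 1
  apply_of_mem : ∀ a ∈ gradedComponent δ 1, Φ a = a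
  apply_eq_zero : ∀ g ≠ 1, ∀ a ∈ gradedComponent δ g, Φ a = 0

/-- A coaction is normal if its conditional expectation is faithful: it sends no non-zero positive
element (that is, no non-zero element of the form `a⋆ a`) to zero. -/
def IsNormalCoaction (δ : A →⋆ₙₐ[ℂ] MinTensor A (GroupCStar G)) : Prop :=
  ∃ Φ : A →ₗ[ℂ] A, IsCoactionExpectation δ Φ ∧ ∀ a, Φ (star a * a) = 0 → star a * a = 0

end Coaction

/-! ### Ordered groups -/

section Order
variable {G : Type u} [Group G]

/-- A positive cone: a submonoid with `P ∩ P⁻¹ = {1}`. It induces the left-invariant partial order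
`a ≤ b ↔ a⁻¹ b ∈ P`. -/
def IsPositiveCone (P : Submonoid G) : Prop := ∀ g, g ∈ P → g⁻¹ ∈ P → g = 1

/-- The left-invariant partial order of `P` is total: `P ∩ P⁻¹ = {1}` and `P ∪ P⁻¹ = G`. -/
structure IsTotalCone (P : Submonoid G) : Prop where
  isPositiveCone : IsPositiveCone P
  mem_or_inv_mem : ∀ g, g ∈ P ∨ g⁻¹ ∈ P

/-- `a ≤ b` in the order induced by `P`. -/
def coneLE (P : Submonoid G) (a b : G) : Prop := a⁻¹ * b ∈ P

/-- `(G, P)` is weakly quasi-lattice ordered: any two elements of `P` with a common upper bound in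
`P` have a least one. -/
def IsWQLO (P : Submonoid G) : Prop :=
  IsPositiveCone P ∧ ∀ x ∈ P, ∀ y ∈ P, (∃ z ∈ P, coneLE P x z ∧ coneLE P y z) →
    ∃ z ∈ P, coneLE P x z ∧ coneLE P y z ∧ ∀ w ∈ P, coneLE P x w → coneLE P y w → coneLE P z w

end Order

/-! ### Graphs over ordered groups and their representations -/

open CategoryTheory

/-- The paths (morphisms) of a small category. -/
structure Path (Λ : Type w) [Category.{v} Λ] : Type (max w v) where
  source : Λ
  range : Λ
  hom : source ⟶ range

namespace Path
variable {Λ : Type w} [Category.{v} Λ]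

/-- The vertex `v`, as a path. -/
def vertex (x : Λ) : Path Λ := ⟨x, x, 𝟙 x⟩

/-- The product `αβ` of paths with `s(α) = r(β)`; it is "first `β`, then `α`". -/
def prod {x y z : Λ} (α : y ⟶ z) (β : x ⟶ y) : Path Λ := ⟨x, z, β ≫ α⟩

/-- `α ≤ β`: the path `β` is of the form `α α₁`. -/
def Le (α β : Path Λ) : Prop := ∃ (x : Λ) (α₁ : x ⟶ α.source), β = prod α.hom α₁

/-- The minimal common extensions of two paths. -/
def MCE (α β : Path Λ) : Set (Path Λ) :=
  {μ | Le α μ ∧ Le β μ ∧ ∀ ν, Le α ν → Le β ν → Le ν μ → ν = μ}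

/-- `E` is exhaustive for `F`: every element of `F` has a common extension with one of `E`. -/
def IsExhaustive (E F : Set (Path Λ)) : Prop :=
  ∀ β ∈ F, ∃ α ∈ E, ∃ μ, Le α μ ∧ Le β μ

end Path

section PGraph
variable {G : Type u} [Group G] {P : Submonoid G} {Λ : Type w} [Category.{v} Λ]

/-- The degree of a morphism with respect to a functor to the monoid `P`, viewed as a category with
one object. -/
def homDegree (d : Λ ⥤ SingleObj P) {x y : Λ} (f : x ⟶ y) : P := d.map f

/-- The degree of a path. -/
def degree (d : Λ ⥤ SingleObj P) (μ : Path Λ) : P := homDegree d μ.hom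

/-- The unique factorization property, which makes `Λ` with the degree functor `d` a `P`-graph.
(Countability of `Λ` is not required.) -/
def IsPGraph (d : Λ ⥤ SingleObj P) : Prop :=
  ∀ (x z : Λ) (f : x ⟶ z) (p₁ p₂ : P), p₁ * p₂ = homDegree d f →
    ∃! q : Σ y : Λ, (y ⟶ z) × (x ⟶ y),
      q.2.2 ≫ q.2.1 = f ∧ homDegree d q.2.1 = p₁ ∧ homDegree d q.2.2 = p₂

variable (Λ) in
/-- `Λ` is finitely aligned: all sets of minimal common extensions are finite. -/
def IsFinitelyAligned : Prop := ∀ μ ν : Path Λ, (Path.MCE μ ν).Finite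

variable {B : Type u₁} [NonUnitalCStarAlgebra B]

/-- A representation of the finitely aligned graph `Λ` in a C⋆-algebra: relations (T1)-(T4). -/
structure IsRep (t : Path Λ → B) : Prop where
  star_vertex : ∀ x : Λ, star (t (Path.vertex x)) = t (Path.vertex x)
  vertex_mul_self : ∀ x : Λ, t (Path.vertex x) * t (Path.vertex x) = t (Path.vertex x)
  vertex_mul : ∀ x y : Λ, x ≠ y → t (Path.vertex x) * t (Path.vertex y) = 0
  mul : ∀ {x y z : Λ} (α : y ⟶ z) (β : x ⟶ y), t ⟨y, z, α⟩ * t ⟨x, y, β⟩ = t (Path.prod α β)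
  star_mul : ∀ μ : Path Λ, star (t μ) * t μ = t (Path.vertex μ.source)
  range_mul : ∀ μ ν : Path Λ, t μ * star (t μ) * (t ν * star (t ν)) =
    ∑ᶠ κ ∈ Path.MCE μ ν, t κ * star (t κ)

/-- The representation is `Λ`-faithful: no generator is zero. -/
def IsFaithfulRep (t : Path Λ → B) : Prop := ∀ μ, t μ ≠ 0

/-- The representation is tight: `∏_{α ∈ E} (t_μ t_μ⋆ - t_α t_α⋆) = 0` whenever `E ⊆ μΛ` is finite
and exhaustive for `μΛ = {ν | μ ≤ ν}`. Such an `E` is not empty; it is given here by a list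
`α :: E` without repetitions. -/
def IsTight (t : Path Λ → B) : Prop :=
  ∀ (μ α : Path Λ) (E : List (Path Λ)), (α :: E).Nodup → (∀ β ∈ α :: E, Path.Le μ β) →
    Path.IsExhaustive {β | β ∈ α :: E} {ν | Path.Le μ ν} →
    (E.map fun β => t μ * star (t μ) - t β * star (t β)).foldl (· * ·)
      (t μ * star (t μ) - t α * star (t α)) = 0

/-- The C⋆-algebra `C⋆(t)` generated by the family `t`. -/
def generatedCStar {ι : Type*} (t : ι → B) : NonUnitalStarSubalgebra ℂ B :=
  (NonUnitalStarAlgebra.adjoin ℂ (Set.range t)).topologicalClosure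

instance {ι : Type*} (t : ι → B) : IsClosed (generatedCStar t : Set B) :=
  NonUnitalStarSubalgebra.isClosed_topologicalClosure _

/-- The generator `t_i`, as an element of `C⋆(t)`. -/
def generator {ι : Type*} (t : ι → B) (i : ι) : generatedCStar t :=
  ⟨t i, NonUnitalStarSubalgebra.le_topologicalClosure _
    (NonUnitalStarAlgebra.subset_adjoin ℂ _ ⟨i, rfl⟩)⟩

/-- Two representations are canonically isomorphic if there is an isomorphism of the generated
C⋆-algebras that respects the generators. -/
def CanonicallyIsomorphic {ι : Type*} {B' : Type u₂} [NonUnitalCStarAlgebra B'] (s : ι → B)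
    (t : ι → B') : Prop :=
  ∃ φ : generatedCStar s ≃⋆ₐ[ℂ] generatedCStar t, ∀ i, φ (generator s i) = generator t i

theorem IsRep.norm_le_one {t : Path Λ → B} (ht : IsRep t) (μ : Path Λ) : ‖t μ‖ ≤ 1 := by
  have h1 : ‖t μ‖ * ‖t μ‖ = ‖t (Path.vertex μ.source)‖ := by
    rw [← CStarRing.norm_star_mul_self, ht.star_mul]
  have h2 : ‖t (Path.vertex μ.source)‖ * ‖t (Path.vertex μ.source)‖ =
      ‖t (Path.vertex μ.source)‖ := by
    rw [← CStarRing.norm_star_mul_self, ht.star_vertex, ht.vertex_mul_self]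
  have h0 := norm_nonneg (t (Path.vertex μ.source))
  have h3 : ‖t (Path.vertex μ.source)‖ ≤ 1 := by nlinarith
  nlinarith [norm_nonneg (t μ)]

variable (Λ) in
/-- The relations of tight representations of `Λ`. -/
def tightRelations : StarRelations (Path Λ) where
  Holds _ _ t := IsRep t ∧ IsTight t
  norm_le_one _ _ _ ht := ht.1.norm_le_one

/-- The universal tight representation `T` of `Λ`. -/
def tightRep (μ : Path Λ) : UniversalCStar (tightRelations Λ) := UniversalCStar.gen _ μ

variable (Λ) in
/-- The tight C⋆-algebra of `Λ`: the C⋆-algebra generated by the universal tight representation. -/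
abbrev TightCStar : Type (max w v) :=
  generatedCStar (tightRep : Path Λ → UniversalCStar (tightRelations Λ))

end PGraph

section Gauge
variable {G : Type u} [Group G] {P : Submonoid G} {Λ : Type w} [Category.{v} Λ]
  {B : Type u} [NonUnitalCStarAlgebra B]

/-- `δ` is a gauge coaction on `C⋆(t)`: a coaction with `δ(t_μ) = t_μ ⊗ U_{d(μ)}`. -/
structure IsGaugeCoaction (d : Λ ⥤ SingleObj P) (t : Path Λ → B)
    (δ : generatedCStar t →⋆ₙₐ[ℂ] MinTensor (generatedCStar t) (GroupCStar G)) : Prop extends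
    IsCoaction δ where
  apply_generator : ∀ μ, δ (generator t μ) = minTmul (generator t μ) (fullRep (degree d μ : G))

/-- `t` is a `Λ`-faithful, tight representation that has a gauge coaction. -/
structure IsFaithfulTightGauge (d : Λ ⥤ SingleObj P) (t : Path Λ → B) : Prop where
  isRep : IsRep t
  isFaithfulRep : IsFaithfulRep t
  isTight : IsTight t
  gauge : ∃ δ, IsGaugeCoaction d t δ

/-- `S` is the co-universal representation: a `Λ`-faithful, tight representation that has a normal
gauge coaction. (It is unique up to canonical isomorphism, and `C⋆_min(Λ)` is the C⋆-algebra
`C⋆(S)` generated by it.) -/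
structure IsCoUniversalRep (d : Λ ⥤ SingleObj P) (S : Path Λ → B) : Prop where
  isRep : IsRep S
  isFaithfulRep : IsFaithfulRep S
  isTight : IsTight S
  normal_gauge : ∃ δ, IsGaugeCoaction d S δ ∧ IsNormalCoaction δ

/-- The element `p` of the monoid `P`, as a path of the one-object category `P`. -/
def monoidPath (p : P) : Path (SingleObj P) := ⟨SingleObj.star P, SingleObj.star P, p⟩

end Gauge

end PGraphAlg

end

/-! In a total order any two elements of `P` are comparable, so the larger of two is their only
minimal common extension and every singleton `{p}` is exhaustive. Tightness for `{p}` at the vertex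
gives `t_p t_p⋆ = t_1`: a tight representation consists of unitaries of `C⋆(t)`. Conversely, such
unitaries satisfy every tightness relation, because all range projections coincide. Since `G = P ∪
P⁻¹`, these unitaries extend to `G` (`coneExtend_mul`), and `C⋆_tight(P)` acquires the universal
property of `C⋆(G)` (`tightEquivGroup`).

Normality is treated for any C⋆-algebra `A` densely spanned by a unitary representation `v`, with a
coaction `v_g ↦ v_g ⊗ U_g` and a representation `θ` on `ℓ²(G)` sending `v_g` to the translation
`L_g`. The expectation is then `a ↦ τ(a) v_1` with `τ(a) = ⟨e_1, θ(a) e_1⟩`. As `τ` is a trace,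
`τ(a⋆a) = 0` forces `θ(a) = 0`; so the coaction is normal exactly when `θ` is injective
(`isNormalCoaction_iff`). For `A = C⋆(G)` this is amenability. For the reduced algebra `θ` is the
inclusion, so the restriction of the regular representation to `P` is co-universal as soon as the
coaction exists there. Existence comes from slicing: a matrix entry of `L_g` determines `g`, so the
slices of an element vanish when its image in the regular representation does (`slice_eq_zero`,
`exists_coaction_of_injective`).

To separate the two algebras for `F_2`, characters are counted. The trivial representation is a
character of `C⋆(F_2)`. Any algebra with a normal gauge coaction is dominated by the regular
representation (`norm_groupLift_le_of_isNormalCoaction`), where `n` suitable translations with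
unimodular coefficients sum to an operator of norm at most `2√n` (`norm_sum_conjGenerator_le`). A
character with phases adjusted would take the value `n` on such a sum, which is impossible for `n =
9` (`character_eq_zero`).

Both the norm estimate and the order on `F_2` come from shears. Over `ℤ` with parameter `3` they
play ping-pong, which gives freeness and the disjoint sets of the estimate. Over `ℤ[X]` with
parameter `X` they preserve a lexicographic order on pairs of polynomials; comparing images of the
two basis vectors with the vectors themselves orders the group (`isTotalCone_lexCone`), and the
specialization `X = 3` shows that only the identity fixes both. -/

noncomputable section

namespace PGraphAlg

open scoped CStarAlgebra InnerProductSpace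

/-! ### Representations separate the elements of a C⋆-algebra -/

section Separation
variable {A : Type u} [NonUnitalCStarAlgebra A]

open scoped ComplexStarModule ComplexOrder in
/-- A real continuous functional that is nonnegative on the positive cone induces a positive
linear functional with the same values on positive elements. -/
theorem exists_positiveLinearMap_of_nonneg [PartialOrder A] [StarOrderedRing A]
    (f : StrongDual ℝ A) (hf : ∀ a : A, 0 ≤ a → 0 ≤ f a) :
    ∃ F : A →ₚ[ℂ] ℂ, ∀ a : A, 0 ≤ a → F a = f a := by
  -- The functional `f` is only real-linear, so it is restricted to selfadjoint elements through the
  -- real part and then complexified. On selfadjoint `a` the correction term involves the real part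
  -- of `i a`, which is zero.
  let f' : A →ₗ[ℝ] ℝ := f.toLinearMap ∘ₗ (selfAdjoint.submodule ℝ A).subtype ∘ₗ realPart
  let F : A →ₗ[ℂ] ℂ := Module.Dual.extendRCLike f'
  have hF : ∀ a : A, 0 ≤ a → F a = f a := by
    intro a ha
    have h1 : IsSelfAdjoint a := IsSelfAdjoint.of_nonneg ha
    have h2 : f' a = f a := by
      change f (realPart a : A) = f a
      rw [h1.coe_realPart]
    have h3 : f' ((RCLike.I : ℂ) • a) = 0 := by
      change f (realPart ((RCLike.I : ℂ) • a) : A) = 0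
      have : realPart (Complex.I • a) = 0 := by
        rw [realPart_I_smul, h1.imaginaryPart, neg_zero]
      rw [show (RCLike.I : ℂ) = Complex.I from rfl, this]
      simp
    rw [Module.Dual.extendRCLike_apply, h2, h3]
    simp
  refine ⟨PositiveLinearMap.mk₀ F fun a ha => ?_, hF⟩
  rw [hF a ha]
  exact_mod_cast hf a ha

open scoped ComplexOrder in
/-- Every nonzero positive element is detected by a positive linear functional. -/
theorem exists_positiveLinearMap_apply_pos [PartialOrder A] [StarOrderedRing A] {b : A}
    (hb : 0 ≤ b) (hb0 : b ≠ 0) : ∃ (F : A →ₚ[ℂ] ℂ) (r : ℝ), 0 < r ∧ F b = r := by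
  let C : ProperCone ℝ A :=
    { carrier := {a | 0 ≤ a}
      add_mem' := fun ha hb => add_nonneg ha hb
      zero_mem' := le_rfl
      smul_mem' := fun c a ha => by
        change (0 : A) ≤ (c : ℝ) • a
        exact smul_nonneg c.2 ha
      isClosed' := CStarAlgebra.isClosed_nonneg }
  have hmem : ∀ a, a ∈ C ↔ 0 ≤ a := fun a => Iff.rfl
  -- The closed positive cone is separated from `-b`: the functional is nonnegative on the cone and
  -- negative at `-b`.
  have hnot : -b ∉ C := by
    rw [hmem]
    intro h
    exact hb0 (le_antisymm (neg_nonneg.mp h) hb)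
  obtain ⟨f, hf, hfb⟩ := C.hyperplane_separation_point hnot
  obtain ⟨F, hF⟩ := exists_positiveLinearMap_of_nonneg f fun a ha => hf a ((hmem a).mpr ha)
  refine ⟨F, f b, ?_, hF b hb⟩
  rw [map_neg] at hfb
  linarith

open scoped ComplexOrder in
/-- Representations on Hilbert spaces separate the elements of a C⋆-algebra. -/
theorem exists_rep_apply_ne_zero {a : A} (ha : a ≠ 0) :
    ∃ (H : Type u) (_ : NormedAddCommGroup H) (_ : InnerProductSpace ℂ H) (_ : CompleteSpace H)
      (π : A →⋆ₙₐ[ℂ] (H →L[ℂ] H)), π a ≠ 0 := by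
  let _ := CStarAlgebra.spectralOrder A
  have _ := CStarAlgebra.spectralOrderedRing A
  -- There need not be a unit to serve as a cyclic vector. The GNS vector of `star a` replaces it:
  -- its image under `a` has squared norm `F ((a a⋆)⋆ (a a⋆))`.
  have h1 : a * star a ≠ 0 := by
    rwa [Ne, CStarRing.mul_star_self_eq_zero_iff]
  have h2 : star (a * star a) * (a * star a) ≠ 0 := by
    rwa [Ne, CStarRing.star_mul_self_eq_zero_iff]
  obtain ⟨F, r, hr, hF⟩ := exists_positiveLinearMap_apply_pos (star_mul_self_nonneg _) h2
  refine ⟨F.GNS, inferInstance, inferInstance, inferInstance, F.gnsNonUnitalStarAlgHom, ?_⟩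
  intro h0
  have h3 : F.gnsNonUnitalStarAlgHom a (F.toPreGNS (star a)) = 0 := by rw [h0]; rfl
  rw [PositiveLinearMap.gnsNonUnitalStarAlgHom_apply_coe] at h3
  have h4 : ‖F.leftMulMapPreGNS a (F.toPreGNS (star a))‖ = 0 := by
    rw [← Completion.norm_coe, h3, norm_zero]
  have h5 := F.preGNS_norm_sq (F.leftMulMapPreGNS a (F.toPreGNS (star a)))
  rw [h4] at h5
  have h6 : F.ofPreGNS (F.leftMulMapPreGNS a (F.toPreGNS (star a))) = a * star a := by simp
  rw [h6, hF] at h5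
  norm_num at h5
  exact hr.ne (by exact_mod_cast h5)

/-- Two elements with the same image in every representation on a Hilbert space are equal. -/
theorem eq_of_forall_rep {a b : A}
    (h : ∀ (H : Type u) [NormedAddCommGroup H] [InnerProductSpace ℂ H] [CompleteSpace H]
      (π : A →⋆ₙₐ[ℂ] (H →L[ℂ] H)), π a = π b) : a = b := by
  by_contra hab
  obtain ⟨H, _, _, _, π, hπ⟩ := exists_rep_apply_ne_zero (sub_ne_zero.mpr hab)
  exact hπ (by rw [map_sub, h H π, sub_self])

end Separation

/-! ### Comparison and factorization of ⋆-homomorphisms -/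

section Comparison
variable {C : Type u} {A : Type v} {D : Type w} [NonUnitalCStarAlgebra C]
  [NonUnitalCStarAlgebra A] [NonUnitalCStarAlgebra D]

/-- If the kernel of `f` is contained in the kernel of `g`, then `‖g b‖ ≤ ‖f b‖` for selfadjoint
elements `b`. -/
theorem norm_le_of_ker_le_of_isSelfAdjoint (f : C →⋆ₙₐ[ℂ] A) (g : C →⋆ₙₐ[ℂ] D)
    (h : ∀ a, f a = 0 → g a = 0) {b : C} (hb : IsSelfAdjoint b) : ‖g b‖ ≤ ‖f b‖ := by
  -- This function vanishes exactly on `[-‖f b‖, ‖f b‖]`. By functional calculus `k(b)` is killed by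
  -- `f`, hence by `g`, which confines the spectrum of `g b` to that interval.
  let k : ℝ → ℝ := fun x => max (|x| - ‖f b‖) 0
  have hk : Continuous k := by fun_prop
  have hk0 : k 0 = 0 := by simp [k]
  have hfb : IsSelfAdjoint (f b) := hb.map f
  have hgb : IsSelfAdjoint (g b) := hb.map g
  have h1 : f (cfcₙ k b) = 0 := by
    rw [NonUnitalStarAlgHom.map_cfcₙ f k b hk.continuousOn hk0 (map_continuous f) hb hfb,
      ← norm_le_zero_iff]
    refine norm_cfcₙ_le fun x hx => ?_
    have h2 := norm_apply_le_norm_cfcₙ (fun x : ℝ => x) (f b) hx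
    rw [cfcₙ_id' ℝ (f b), Real.norm_eq_abs] at h2
    have : k x = 0 := max_eq_right (by linarith)
    rw [this, norm_zero]
  have h3 : cfcₙ k (g b) = 0 := by
    rw [← NonUnitalStarAlgHom.map_cfcₙ g k b hk.continuousOn hk0 (map_continuous g) hb hgb]
    exact h _ h1
  have h4 : ‖cfcₙ (fun x : ℝ => x) (g b)‖ ≤ ‖f b‖ := by
    refine norm_cfcₙ_le fun x hx => ?_
    have h5 := norm_apply_le_norm_cfcₙ k (g b) hx hk.continuousOn hk0 hgb
    rw [h3, norm_zero, norm_le_zero_iff] at h5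
    have h6 : |x| - ‖f b‖ ≤ k x := le_max_left _ _
    rw [Real.norm_eq_abs]
    linarith
  rwa [cfcₙ_id' ℝ (g b)] at h4

/-- If the kernel of `f` is contained in the kernel of `g`, then `‖g a‖ ≤ ‖f a‖`. -/
theorem norm_le_of_ker_le (f : C →⋆ₙₐ[ℂ] A) (g : C →⋆ₙₐ[ℂ] D)
    (h : ∀ a, f a = 0 → g a = 0) (a : C) : ‖g a‖ ≤ ‖f a‖ := by
  have h1 := norm_le_of_ker_le_of_isSelfAdjoint f g h (IsSelfAdjoint.star_mul_self a)
  rw [map_mul, map_star, map_mul, map_star, CStarRing.norm_star_mul_self,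
    CStarRing.norm_star_mul_self] at h1
  exact (mul_self_le_mul_self_iff (norm_nonneg _) (norm_nonneg _)).mpr h1

/-- A ⋆-homomorphism `g` with `‖g c‖ ≤ ‖q c‖` factors through the ⋆-homomorphism `q` with dense
range. -/
theorem exists_factor_of_norm_le (q : C →⋆ₙₐ[ℂ] A) (hq : DenseRange q) (g : C →⋆ₙₐ[ℂ] D)
    (h : ∀ c, ‖g c‖ ≤ ‖q c‖) : ∃ δ : A →⋆ₙₐ[ℂ] D, ∀ c, δ (q c) = g c := by
  -- `A` is identified with the completion of `C` in the seminorm `‖q ·‖`: the induced map `e` is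
  -- isometric, so its range is closed, and it is dense. The universal property of the completion
  -- then produces the factor.
  let N : CStarSeminorm C := CStarSeminorm.comap q
  have hN : ∀ c, N.toSeminorm c = ‖q c‖ := fun c => rfl
  let e : CStarCompletion N →⋆ₙₐ[ℂ] A := CStarCompletion.lift N q fun c => (hN c).ge
  have he : ∀ x, ‖e x‖ = ‖x‖ := by
    intro x
    refine CStarCompletion.induction N x
      (isClosed_eq (map_continuous e).norm continuous_norm) fun c => ?_
    rw [CStarCompletion.norm_of, CStarCompletion.lift_of, hN]
  have hiso : Isometry e := AddMonoidHomClass.isometry_of_norm e he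
  have hsurj : Function.Surjective e := by
    have h1 : IsClosed (Set.range e) := hiso.isClosedEmbedding.isClosed_range
    have h2 : Set.range q ⊆ Set.range e := by
      rintro _ ⟨c, rfl⟩
      exact ⟨CStarCompletion.of N c, CStarCompletion.lift_of _ _ _ _⟩
    rw [← Set.range_eq_univ, ← h1.closure_eq]
    exact (hq.mono h2).closure_eq
  let E := StarAlgEquiv.ofBijective e ⟨hiso.injective, hsurj⟩
  let δ' : CStarCompletion N →⋆ₙₐ[ℂ] D := CStarCompletion.lift N g h
  refine ⟨δ'.comp (E.symm : A →⋆ₙₐ[ℂ] CStarCompletion N), fun c => ?_⟩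
  have h3 : E (CStarCompletion.of N c) = q c :=
    CStarCompletion.lift_of N q (fun c => (hN c).ge) c
  change δ' (E.symm (q c)) = g c
  rw [← h3, StarAlgEquiv.symm_apply_apply]
  exact CStarCompletion.lift_of _ _ _ _

/-- Continuous linear maps that agree on a set with dense span are equal. -/
theorem eq_of_dense_span {E F : Type*} [NormedAddCommGroup E] [NormedSpace ℂ E]
    [NormedAddCommGroup F] [NormedSpace ℂ F] {s : Set E}
    (hs : Dense (Submodule.span ℂ s : Set E)) {f g : E → F}
    (hf : Continuous f) (hg : Continuous g) (hfl : IsLinearMap ℂ f) (hgl : IsLinearMap ℂ g)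
    (h : ∀ x ∈ s, f x = g x) : f = g := by
  refine Continuous.ext_on hs hf hg fun x hx => ?_
  exact LinearMap.eqOn_span (f := hfl.mk' f) (g := hgl.mk' g) h hx

/-- ⋆-homomorphisms that agree on a set with dense span are equal. -/
theorem starAlgHom_ext_of_dense_span {s : Set C} (hs : Dense (Submodule.span ℂ s : Set C))
    {f g : C →⋆ₙₐ[ℂ] A} (h : ∀ x ∈ s, f x = g x) : f = g :=
  DFunLike.coe_injective <| eq_of_dense_span hs (map_continuous f) (map_continuous g)
    ⟨map_add f, map_smul f⟩ ⟨map_add g, map_smul g⟩ h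

end Comparison

/-! ### Extension of representations to completions -/

section OperatorLift
variable {F : Type u} [NonUnitalRing F] [Module ℂ F] [StarRing F] (N : CStarSeminorm F)
  {E : Type v} [NormedAddCommGroup E] [InnerProductSpace ℂ E] [CompleteSpace E]

/-- The extension to the completion of a representation dominated by the C⋆-seminorm `N`. -/
def opLift (φ : F →⋆ₙₐ[ℂ] (E →L[ℂ] E)) (hφ : ∀ x, ‖φ x‖ ≤ N.toSeminorm x) :
    CStarCompletion N →⋆ₙₐ[ℂ] (E →L[ℂ] E) :=
  CStarCompletion.lift (B := E →L[ℂ] E) N φ hφ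

theorem opLift_of (φ : F →⋆ₙₐ[ℂ] (E →L[ℂ] E)) (hφ : ∀ x, ‖φ x‖ ≤ N.toSeminorm x) (x : F) :
    opLift N φ hφ (CStarCompletion.of N x) = φ x :=
  CStarCompletion.lift_of (B := E →L[ℂ] E) N φ hφ x

theorem continuous_opLift (φ : F →⋆ₙₐ[ℂ] (E →L[ℂ] E)) (hφ : ∀ x, ‖φ x‖ ≤ N.toSeminorm x) :
    Continuous (opLift N φ hφ) :=
  CStarCompletion.continuous_liftFun (B := E →L[ℂ] E) N φ hφ

theorem norm_opLift_le (φ : F →⋆ₙₐ[ℂ] (E →L[ℂ] E)) (hφ : ∀ x, ‖φ x‖ ≤ N.toSeminorm x)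
    (x : CStarCompletion N) : ‖opLift N φ hφ x‖ ≤ ‖x‖ := by
  refine CStarCompletion.induction N x
    (isClosed_le (continuous_opLift N φ hφ).norm continuous_norm) fun z => ?_
  rw [opLift_of, CStarCompletion.norm_of]
  exact hφ z

end OperatorLift

/-! ### Product representations of the minimal tensor product -/

section MinTensor
variable {A B : Type u} [NonUnitalCStarAlgebra A] [NonUnitalCStarAlgebra B]
variable {H K : Type u} [NormedAddCommGroup H] [InnerProductSpace ℂ H] [CompleteSpace H]
  [NormedAddCommGroup K] [InnerProductSpace ℂ K] [CompleteSpace K]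

/-- The representation `π ⊗ ρ` of the minimal tensor product. -/
def minRep (π : A →⋆ₙₐ[ℂ] (H →L[ℂ] H)) (ρ : B →⋆ₙₐ[ℂ] (K →L[ℂ] K)) :
    MinTensor A B →⋆ₙₐ[ℂ] (Completion (H ⊗[ℂ] K) →L[ℂ] Completion (H ⊗[ℂ] K)) :=
  opLift (minNorm A B) (tensorRep π ρ) (norm_tensorRep_le π ρ)

theorem minRep_of (π : A →⋆ₙₐ[ℂ] (H →L[ℂ] H)) (ρ : B →⋆ₙₐ[ℂ] (K →L[ℂ] K)) (x : A ⊗[ℂ] B) :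
    minRep π ρ (CStarCompletion.of _ x) = tensorRep π ρ x :=
  opLift_of _ _ _ _

theorem continuous_minRep (π : A →⋆ₙₐ[ℂ] (H →L[ℂ] H)) (ρ : B →⋆ₙₐ[ℂ] (K →L[ℂ] K)) :
    Continuous (minRep π ρ) :=
  continuous_opLift _ _ _

theorem norm_minRep_le (π : A →⋆ₙₐ[ℂ] (H →L[ℂ] H)) (ρ : B →⋆ₙₐ[ℂ] (K →L[ℂ] K))
    (x : MinTensor A B) : ‖minRep π ρ x‖ ≤ ‖x‖ :=
  norm_opLift_le _ _ _ _

theorem minRep_minTmul_apply (π : A →⋆ₙₐ[ℂ] (H →L[ℂ] H)) (ρ : B →⋆ₙₐ[ℂ] (K →L[ℂ] K)) (a : A)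
    (b : B) (ξ : H) (η : K) :
    minRep π ρ (minTmul a b) ((ξ ⊗ₜ[ℂ] η : H ⊗[ℂ] K) : Completion (H ⊗[ℂ] K)) =
      ((π a ξ ⊗ₜ[ℂ] ρ b η : H ⊗[ℂ] K) : Completion (H ⊗[ℂ] K)) := by
  rw [minTmul, minRep_of]
  exact ContinuousLinearMap.completion_apply_coe _ _

theorem inner_minRep_minTmul (π : A →⋆ₙₐ[ℂ] (H →L[ℂ] H)) (ρ : B →⋆ₙₐ[ℂ] (K →L[ℂ] K)) (a : A)
    (b : B) (ξ ξ' : H) (η η' : K) :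
    inner ℂ ((ξ' ⊗ₜ[ℂ] η' : H ⊗[ℂ] K) : Completion (H ⊗[ℂ] K))
      (minRep π ρ (minTmul a b) ((ξ ⊗ₜ[ℂ] η : H ⊗[ℂ] K) : Completion (H ⊗[ℂ] K))) =
      inner ℂ ξ' (π a ξ) * inner ℂ η' (ρ b η) := by
  rw [minRep_minTmul_apply, Completion.inner_coe, TensorProduct.inner_tmul]

/-- The representations `π ⊗ ρ` separate the elements of the minimal tensor product. -/
theorem minTensor_eq_zero {x : MinTensor A B}
    (h : ∀ (H K : Type u) [NormedAddCommGroup H] [InnerProductSpace ℂ H] [CompleteSpace H]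
      [NormedAddCommGroup K] [InnerProductSpace ℂ K] [CompleteSpace K]
      (π : A →⋆ₙₐ[ℂ] (H →L[ℂ] H)) (ρ : B →⋆ₙₐ[ℂ] (K →L[ℂ] K)), minRep π ρ x = 0) : x = 0 := by
  rw [← norm_le_zero_iff]
  refine le_of_forall_pos_le_add fun ε hε => ?_
  -- The norm is a supremum over product representations only on algebraic tensors, so `x` is
  -- approximated by one. Its product representations are small because those of `x` vanish.
  obtain ⟨z, hz⟩ := Metric.denseRange_iff.mp (CStarCompletion.denseRange_of (minNorm A B)) x
    (ε / 2) (half_pos hε)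
  rw [dist_eq_norm] at hz
  have h1 : ‖CStarCompletion.of (minNorm A B) z‖ ≤ ε / 2 := by
    rw [CStarCompletion.norm_of]
    refine minNorm_apply_le z _ (half_pos hε).le ?_
    intro H K _ _ _ _ _ _ π ρ
    rw [← minRep_of]
    have h2 : minRep π ρ (CStarCompletion.of _ z) =
        minRep π ρ (CStarCompletion.of _ z - x) := by
      rw [map_sub, h H K π ρ, sub_zero]
    rw [h2]
    exact (norm_minRep_le π ρ _).trans ((norm_sub_rev _ _).trans_le hz.le)
  calc ‖x‖ = ‖(x - CStarCompletion.of _ z) + CStarCompletion.of _ z‖ := by rw [sub_add_cancel]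
    _ ≤ ε / 2 + ε / 2 := (norm_add_le _ _).trans (add_le_add hz.le h1)
    _ = 0 + ε := by ring

end MinTensor

/-- An operator on the tensor product of Hilbert spaces is determined by its matrix coefficients
at elementary tensors. -/
theorem tensorOperator_eq_zero {H : Type u} {K : Type v} [NormedAddCommGroup H]
    [InnerProductSpace ℂ H] [NormedAddCommGroup K] [InnerProductSpace ℂ K]
    {T : Completion (H ⊗[ℂ] K) →L[ℂ] Completion (H ⊗[ℂ] K)}
    (h : ∀ (ξ ξ' : H) (η η' : K), inner ℂ ((ξ' ⊗ₜ[ℂ] η' : H ⊗[ℂ] K) : Completion (H ⊗[ℂ] K))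
      (T ((ξ ⊗ₜ[ℂ] η : H ⊗[ℂ] K) : Completion (H ⊗[ℂ] K))) = 0) : T = 0 := by
  have h1 : ∀ x y : Completion (H ⊗[ℂ] K), inner ℂ x (T y) = 0 := by
    intro x y
    induction x, y using Completion.induction_on₂ with
    | hp => exact isClosed_eq (by fun_prop) (by fun_prop)
    | ih x y =>
      induction x with
      | zero => rw [Completion.coe_zero, inner_zero_left]
      | add x x' hx hx' => rw [Completion.coe_add, inner_add_left, hx, hx', add_zero]
      | tmul ξ' η' =>
        induction y with
        | zero => rw [Completion.coe_zero, map_zero, inner_zero_right]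
        | add y y' hy hy' => rw [Completion.coe_add, map_add, inner_add_right, hy, hy', add_zero]
        | tmul ξ η => exact h ξ ξ' η η'
  ext y
  exact inner_self_eq_zero.mp (h1 (T y) y)

end PGraphAlg

namespace PGraphAlg

open CategoryTheory

/-! ### Unitary representations with dense span -/

section DenseSpan
variable {G : Type u} [Group G]

/-- The linear span of a family that is closed under products and adjoints, and contains a family
of generators, is dense. -/
theorem dense_span_of_generator {B : Type v} [NonUnitalCStarAlgebra B] {ι : Type*} {t : ι → B}
    {u : G → generatedCStar t} (hmul : ∀ g h, u g * u h = u (g * h))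
    (hstar : ∀ g, star (u g) = u g⁻¹) (hgen : ∀ i, ∃ g, u g = generator t i) :
    Dense (Submodule.span ℂ (Set.range u) : Set (generatedCStar t)) := by
  -- The span is formed in `B`, since `C⋆(t)` is defined as a closure there. It already contains the
  -- algebraic ⋆-algebra generated by `t`.
  let V : Submodule ℂ B := Submodule.span ℂ (Set.range fun g => (u g : B))
  have hV : ∀ x ∈ NonUnitalStarAlgebra.adjoin ℂ (Set.range t), x ∈ V := by
    intro x hx
    induction hx using NonUnitalStarAlgebra.adjoin_induction with
    | mem x hx =>
      obtain ⟨i, rfl⟩ := hx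
      obtain ⟨g, hg⟩ := hgen i
      exact Submodule.subset_span ⟨g, congrArg Subtype.val hg⟩
    | add x y _ _ hx hy => exact V.add_mem hx hy
    | zero => exact V.zero_mem
    | smul c x _ hx => exact V.smul_mem c hx
    | mul x y hx0 hy0 hx hy =>
      clear hx0 hy0
      induction hx using Submodule.span_induction with
      | zero => rw [zero_mul]; exact V.zero_mem
      | add x x' _ _ hx hx' => rw [add_mul]; exact V.add_mem hx hx'
      | smul c x _ hx => rw [smul_mul_assoc]; exact V.smul_mem c hx
      | mem x hx =>
        obtain ⟨g, rfl⟩ := hx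
        induction hy using Submodule.span_induction with
        | zero => rw [mul_zero]; exact V.zero_mem
        | add y y' _ _ hy hy' => rw [mul_add]; exact V.add_mem hy hy'
        | smul c y _ hy => rw [mul_smul_comm]; exact V.smul_mem c hy
        | mem y hy =>
          obtain ⟨h, rfl⟩ := hy
          exact Submodule.subset_span ⟨g * h, (congrArg Subtype.val (hmul g h)).symm⟩
    | star x hx0 hx =>
      clear hx0
      induction hx using Submodule.span_induction with
      | zero => rw [star_zero]; exact V.zero_mem
      | add x x' _ _ hx hx' => rw [star_add]; exact V.add_mem hx hx'
      | smul c x _ hx => rw [star_smul]; exact V.smul_mem _ hx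
      | mem x hx =>
        obtain ⟨g, rfl⟩ := hx
        exact Submodule.subset_span ⟨g⁻¹, (congrArg Subtype.val (hstar g)).symm⟩
  have himage : (Subtype.val '' (Submodule.span ℂ (Set.range u) : Set (generatedCStar t))) =
      (V : Set B) := by
    have h1 : V = (Submodule.span ℂ (Set.range u)).map
        ((NonUnitalSubalgebraClass.subtype (generatedCStar t) :
          generatedCStar t →ₙₐ[ℂ] B) : generatedCStar t →ₗ[ℂ] B) := by
      rw [Submodule.map_span, ← Set.range_comp]
      rfl
    rw [h1]
    rfl
  intro x
  have hx : (x : B) ∈ closure (V : Set B) := closure_mono hV x.2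
  rw [← himage] at hx
  rw [Topology.IsInducing.subtypeVal.closure_eq_preimage_closure_image]
  exact hx

/-- A multiplicative, ⋆-preserving family with dense span is a unitary representation. -/
theorem isUnitaryRep_of_dense_span {A : Type v} [NonUnitalCStarAlgebra A] {u : G → A}
    (hmul : ∀ g h, u g * u h = u (g * h)) (hstar : ∀ g, star (u g) = u g⁻¹)
    (hd : Dense (Submodule.span ℂ (Set.range u) : Set A)) : IsUnitaryRep u where
  one_mul a := by
    refine congrFun (eq_of_dense_span hd (f := fun a => u 1 * a) (g := fun a => a) (by fun_prop)
      (by fun_prop) ⟨mul_add _, fun c a => mul_smul_comm c _ a⟩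
      ⟨fun _ _ => rfl, fun _ _ => rfl⟩ ?_) a
    rintro _ ⟨g, rfl⟩
    rw [hmul, _root_.one_mul]
  mul_one a := by
    refine congrFun (eq_of_dense_span hd (f := fun a => a * u 1) (g := fun a => a) (by fun_prop)
      (by fun_prop) ⟨fun a b => add_mul a b _, fun c a => smul_mul_assoc c a _⟩
      ⟨fun _ _ => rfl, fun _ _ => rfl⟩ ?_) a
    rintro _ ⟨g, rfl⟩
    rw [hmul, _root_.mul_one]
  map_mul := hmul
  map_star := hstar

variable (G) in
/-- The universal unitaries span a dense subspace of the full group C⋆-algebra. -/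
theorem dense_span_fullRep :
    Dense (Submodule.span ℂ (Set.range (fullRep : G → GroupCStar G)) : Set (GroupCStar G)) := by
  let N := (groupRelations G).universalSeminorm
  let V : Submodule ℂ (GroupCStar G) := Submodule.span ℂ (Set.range fullRep)
  have hU := fullRep_isUnitaryRep G
  -- Words in the letters and their adjoints multiply out to a single unitary, so linear
  -- combinations of the `U_g` already exhaust the image of the free ⋆-algebra.
  have hword : ∀ w : StarWord G, ∃ g : G,
      CStarCompletion.of N (MonoidAlgebra.single w 1) = fullRep g := by
    have hletter : ∀ p : G × Bool, ∃ g : G,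
        CStarCompletion.of N (MonoidAlgebra.single (FreeSemigroup.of p) 1) = fullRep g := by
      rintro ⟨g, _ | _⟩
      · exact ⟨g, rfl⟩
      · refine ⟨g⁻¹, ?_⟩
        rw [← hU.map_star, fullRep, UniversalCStar.gen, ← CStarCompletion.of_star, FreeStarAlg.gen,
          FreeStarAlg.star_single, star_one]
        rfl
    intro w
    induction w using FreeSemigroup.recOnMul with
    | ih1 p => exact hletter p
    | ih2 p w _ h2 =>
      obtain ⟨g, hg⟩ := hletter p
      obtain ⟨h, hh⟩ := h2
      refine ⟨g * h, ?_⟩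
      rw [← hU.map_mul, ← hg, ← hh, ← CStarCompletion.of_mul, MonoidAlgebra.single_mul_single,
        _root_.mul_one]
  have hall : ∀ a : FreeStarAlg G, CStarCompletion.of N a ∈ V := by
    intro a
    induction a using MonoidAlgebra.induction_linear with
    | zero => rw [CStarCompletion.of_zero]; exact V.zero_mem
    | add a b ha hb => rw [CStarCompletion.of_add]; exact V.add_mem ha hb
    | single w c =>
      obtain ⟨g, hg⟩ := hword w
      have h1 : (MonoidAlgebra.single w c : FreeStarAlg G) =
          c • MonoidAlgebra.single w (1 : ℂ) := by
        rw [MonoidAlgebra.smul_single, smul_eq_mul, _root_.mul_one]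
      rw [h1, CStarCompletion.of_smul, hg]
      exact V.smul_mem c (Submodule.subset_span ⟨g, rfl⟩)
  refine (CStarCompletion.denseRange_of N).mono ?_
  rintro _ ⟨a, rfl⟩
  exact hall a

/-- The ⋆-homomorphism of the full group C⋆-algebra induced by a unitary representation. -/
def groupLift {A : Type u} [NonUnitalCStarAlgebra A] {v : G → A} (hv : IsUnitaryRep v) :
    GroupCStar G →⋆ₙₐ[ℂ] A :=
  UniversalCStar.lift (R := groupRelations G) v hv

@[simp] theorem groupLift_fullRep {A : Type u} [NonUnitalCStarAlgebra A] {v : G → A}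
    (hv : IsUnitaryRep v) (g : G) : groupLift hv (fullRep g) = v g :=
  UniversalCStar.lift_gen (R := groupRelations G) v hv g

theorem denseRange_groupLift {A : Type u} [NonUnitalCStarAlgebra A] {v : G → A}
    (hv : IsUnitaryRep v) (hd : Dense (Submodule.span ℂ (Set.range v) : Set A)) :
    DenseRange (groupLift hv) := by
  refine hd.mono ?_
  have h : Submodule.span ℂ (Set.range v) ≤
      LinearMap.range ((groupLift hv : GroupCStar G →⋆ₙₐ[ℂ] A) : GroupCStar G →ₗ[ℂ] A) := by
    rw [Submodule.span_le]
    rintro _ ⟨g, rfl⟩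
    exact ⟨fullRep g, groupLift_fullRep hv g⟩
  exact h

end DenseSpan

/-! ### Unitary representations of a total cone -/

section Cone
variable {G : Type u} [Group G] {P : Submonoid G} {B : Type v} [NonUnitalCStarAlgebra B]

/-- A representation of the monoid `P` by elements that are unitary relative to the projection
`s 1`. -/
structure IsConeRep (s : P → B) : Prop where
  star_one : star (s 1) = s 1
  map_mul : ∀ p q, s p * s q = s (p * q)
  star_mul : ∀ p, star (s p) * s p = s 1
  mul_star : ∀ p, s p * star (s p) = s 1

open Classical in
/-- The extension of a representation of the cone `P` to the group. -/
def coneExtend (s : P → B) (g : G) : B :=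
  -- The value `0` is a default that is never reached when the cone is total.
  if h : g ∈ P then s ⟨g, h⟩ else if h : g⁻¹ ∈ P then star (s ⟨g⁻¹, h⟩) else 0

theorem coneExtend_coe (s : P → B) (p : P) : coneExtend s (p : G) = s p := by
  rw [coneExtend, dif_pos p.2]

/-- The two branches of the definition overlap only at the identity, by `P ∩ P⁻¹ = {1}`, and they
agree there because `s 1` is selfadjoint. -/
theorem IsConeRep.coneExtend_inv {s : P → B} (hs : IsConeRep s) (hP : IsTotalCone P) (p : P) :
    coneExtend s (p : G)⁻¹ = star (s p) := by
  by_cases h : (p : G)⁻¹ ∈ P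
  · have h1 : p = 1 := Subtype.ext (hP.isPositiveCone p p.2 h)
    subst h1
    rw [hs.star_one]
    have h2 : ((1 : P) : G)⁻¹ = ((1 : P) : G) := by simp
    rw [h2, coneExtend_coe]
  · rw [coneExtend, dif_neg h, dif_pos (by simp)]
    simp

theorem IsTotalCone.eq_coe_or_eq_inv (hP : IsTotalCone P) (g : G) :
    (∃ p : P, g = p) ∨ ∃ p : P, g = (p : G)⁻¹ := by
  rcases hP.mem_or_inv_mem g with h | h
  · exact Or.inl ⟨⟨g, h⟩, rfl⟩
  · exact Or.inr ⟨⟨g⁻¹, h⟩, by simp⟩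

/-- Two elements of a total cone are comparable. -/
theorem IsTotalCone.exists_eq_mul (hP : IsTotalCone P) (p q : P) :
    (∃ r, q = p * r) ∨ ∃ r, p = q * r := by
  rcases hP.eq_coe_or_eq_inv ((p : G)⁻¹ * q) with ⟨r, hr⟩ | ⟨r, hr⟩
  · exact Or.inl ⟨r, Subtype.ext (by rw [Submonoid.coe_mul, ← hr]; group)⟩
  · refine Or.inr ⟨r, Subtype.ext ?_⟩
    rw [Submonoid.coe_mul, ← inv_inv (r : G), ← hr]
    group

namespace IsConeRep
variable {s : P → B} (hs : IsConeRep s) (hP : IsTotalCone P)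
include hs

theorem star_mul_mul (p q : P) : star (s p) * s (p * q) = s q := by
  rw [← hs.map_mul, ← mul_assoc, hs.star_mul, hs.map_mul, one_mul]

include hP

theorem star_coneExtend (g : G) : star (coneExtend s g) = coneExtend s g⁻¹ := by
  rcases hP.eq_coe_or_eq_inv g with ⟨p, rfl⟩ | ⟨p, rfl⟩
  · rw [coneExtend_coe, hs.coneExtend_inv hP]
  · rw [inv_inv, coneExtend_coe, hs.coneExtend_inv hP, star_star]

/-- For `g = p⁻¹` totality enters: one of `p`, `q` is a left factor of the other, and cancelling the
common factor leaves `s r` or `(s r)⋆`, according to which is larger. -/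
theorem coneExtend_mul_coe (g : G) (q : P) :
    coneExtend s g * s q = coneExtend s (g * q) := by
  rcases hP.eq_coe_or_eq_inv g with ⟨p, rfl⟩ | ⟨p, rfl⟩
  · rw [coneExtend_coe, hs.map_mul, ← Submonoid.coe_mul, coneExtend_coe]
  · rw [hs.coneExtend_inv hP]
    rcases hP.exists_eq_mul p q with ⟨r, rfl⟩ | ⟨r, rfl⟩
    · rw [hs.star_mul_mul, Submonoid.coe_mul, inv_mul_cancel_left, coneExtend_coe]
    · have h1 : star (s (q * r)) * s q = star (s r) := by
        rw [← hs.star_mul_mul q r, StarMul.star_mul, star_star]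
      rw [h1, Submonoid.coe_mul, mul_inv_rev, mul_assoc, inv_mul_cancel, mul_one,
        hs.coneExtend_inv hP]

/-- A right factor `q⁻¹` is moved to the other side: `g = (g q⁻¹) q` falls under
`coneExtend_mul_coe`, and `s q (s q)⋆ = s 1` acts as a right unit. -/
theorem coneExtend_mul (g h : G) : coneExtend s g * coneExtend s h = coneExtend s (g * h) := by
  rcases hP.eq_coe_or_eq_inv h with ⟨q, rfl⟩ | ⟨q, rfl⟩
  · rw [coneExtend_coe, hs.coneExtend_mul_coe hP]
  · have h1 := hs.coneExtend_mul_coe hP (g * (q : G)⁻¹) q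
    rw [mul_assoc, inv_mul_cancel, mul_one] at h1
    have h2 : coneExtend s (g * (q : G)⁻¹) * s 1 = coneExtend s (g * (q : G)⁻¹) := by
      rw [hs.coneExtend_mul_coe hP, Submonoid.coe_one, mul_one]
    rw [hs.coneExtend_inv hP, ← h1, mul_assoc, hs.mul_star, h2]

end IsConeRep

end Cone

/-! ### The one-object category of a total cone -/

section OneObject
variable {G : Type u} [Group G] {P : Submonoid G}

theorem eq_monoidPath (μ : Path (SingleObj P)) : ∃ p : P, μ = monoidPath p := ⟨μ.hom, rfl⟩

theorem monoidPath_injective : Function.Injective (monoidPath : P → Path (SingleObj P)) := by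
  intro p q h
  exact congrArg (fun μ : Path (SingleObj P) => (show P from μ.hom)) h

theorem monoidPath_le_iff {p q : P} :
    Path.Le (monoidPath p) (monoidPath q) ↔ ∃ r, q = p * r := by
  constructor
  · rintro ⟨x, α, h⟩
    exact ⟨α, monoidPath_injective h⟩
  · rintro ⟨r, rfl⟩
    exact ⟨SingleObj.star P, r, rfl⟩

theorem IsPositiveCone.eq_of_eq_mul (hP : IsPositiveCone P) {p q r r' : P} (h : q = p * r)
    (h' : p = q * r') : p = q := by
  have h1 : r * r' = 1 := by
    rw [h, mul_assoc] at h'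
    exact Subtype.ext (by simpa using congrArg Subtype.val h')
  have h2 : (r : G) = 1 := by
    refine hP r r.2 ?_
    have : (r : G) * r' = 1 := by rw [← Submonoid.coe_mul, h1, Submonoid.coe_one]
    rw [inv_eq_of_mul_eq_one_right this]
    exact r'.2
  rw [h, show r = 1 from Subtype.ext h2, mul_one]

/-- When `p ≤ q`, the element `q` is itself the least common extension, and antisymmetry excludes
any other minimal one. -/
theorem mce_monoidPath_of_eq_mul (hP : IsPositiveCone P) {p q r : P} (h : q = p * r) :
    Path.MCE (monoidPath p) (monoidPath q) = {monoidPath q} := by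
  ext μ
  obtain ⟨m, rfl⟩ := eq_monoidPath μ
  rw [Set.mem_singleton_iff]
  constructor
  · rintro ⟨_, h2, h3⟩
    exact (h3 _ (monoidPath_le_iff.mpr ⟨r, h⟩) (monoidPath_le_iff.mpr ⟨1, (mul_one q).symm⟩)
      h2).symm
  · intro hm
    rw [hm]
    refine ⟨monoidPath_le_iff.mpr ⟨r, h⟩, monoidPath_le_iff.mpr ⟨1, (mul_one q).symm⟩, ?_⟩
    intro ν _ h2 h3
    obtain ⟨n, rfl⟩ := eq_monoidPath ν
    obtain ⟨r1, h4⟩ := monoidPath_le_iff.mp h2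
    obtain ⟨r2, h5⟩ := monoidPath_le_iff.mp h3
    rw [hP.eq_of_eq_mul h5 h4]

theorem mce_comm {Λ : Type w} [Category.{v} Λ] (α β : Path Λ) :
    Path.MCE α β = Path.MCE β α := by
  ext μ
  exact ⟨fun h => ⟨h.2.1, h.1, fun ν h1 h2 => h.2.2 ν h2 h1⟩,
    fun h => ⟨h.2.1, h.1, fun ν h1 h2 => h.2.2 ν h2 h1⟩⟩

/-- Minimal common extensions in a total cone: there is exactly one. -/
theorem exists_mce_eq_singleton (hP : IsTotalCone P) (μ ν : Path (SingleObj P)) :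
    ∃ κ, Path.MCE μ ν = {κ} := by
  obtain ⟨p, rfl⟩ := eq_monoidPath μ
  obtain ⟨q, rfl⟩ := eq_monoidPath ν
  rcases hP.exists_eq_mul p q with ⟨r, h⟩ | ⟨r, h⟩
  · exact ⟨_, mce_monoidPath_of_eq_mul hP.isPositiveCone h⟩
  · exact ⟨_, (mce_comm _ _).trans (mce_monoidPath_of_eq_mul hP.isPositiveCone h)⟩

theorem isFinitelyAligned_of_isTotalCone (hP : IsTotalCone P) :
    IsFinitelyAligned (SingleObj P) := by
  intro μ ν
  obtain ⟨κ, h⟩ := exists_mce_eq_singleton hP μ ν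
  rw [h]
  exact Set.finite_singleton κ

/-- The degree of a morphism is the morphism itself, so prescribing the degrees of two factors
prescribes the factors; composition in diagrammatic order is reversed multiplication in `P`. -/
theorem isPGraph_singleObj : IsPGraph (P := P) (Functor.id (SingleObj P)) := by
  intro x z f p₁ p₂ h
  refine ⟨⟨SingleObj.star P, p₁, p₂⟩, ⟨h, rfl, rfl⟩, ?_⟩
  rintro ⟨y, a, b⟩ ⟨_, h2, h3⟩
  change a = p₁ at h2
  change b = p₂ at h3
  subst h2 h3
  rfl

theorem isWQLO_of_isTotalCone (hP : IsTotalCone P) : IsWQLO P := by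
  refine ⟨hP.isPositiveCone, fun x hx y hy _ => ?_⟩
  have hrefl : ∀ z : G, coneLE P z z := fun z => by
    rw [coneLE, inv_mul_cancel]; exact P.one_mem
  rcases hP.mem_or_inv_mem (x⁻¹ * y) with h | h
  · exact ⟨y, hy, h, hrefl y, fun w _ _ h' => h'⟩
  · rw [mul_inv_rev, inv_inv] at h
    exact ⟨x, hx, hrefl x, h, fun w _ h' _ => h'⟩

variable {B : Type v} [NonUnitalCStarAlgebra B]

theorem foldl_mul_zero (E : List B) : E.foldl (· * ·) (0 : B) = 0 := by
  induction E with
  | nil => rfl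
  | cons a E ih => rw [List.foldl_cons, zero_mul, ih]

/-- The tight representations of the one-object category `P` are the representations of the
monoid `P` by unitaries of a corner. -/
theorem isConeRep_of_isTight (hP : IsTotalCone P) {t : Path (SingleObj P) → B} (ht : IsRep t)
    (ht' : IsTight t) : IsConeRep fun p : P => t (monoidPath p) where
  star_one := ht.star_vertex (SingleObj.star P)
  map_mul p q := ht.mul (x := SingleObj.star P) (y := SingleObj.star P) (z := SingleObj.star P) p q
  star_mul p := ht.star_mul (monoidPath p)
  mul_star p := by
    have h1 : t (monoidPath 1) * star (t (monoidPath 1)) = t (monoidPath (1 : P)) := by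
      have h2 := ht.star_vertex (SingleObj.star P)
      have h3 := ht.vertex_mul_self (SingleObj.star P)
      change star (t (monoidPath 1)) = t (monoidPath 1) at h2
      change t (monoidPath 1) * t (monoidPath 1) = t (monoidPath 1) at h3
      rw [h2, h3]
    -- By comparability every path has a common extension with `p`, so `{p}` is exhaustive at the
    -- vertex. The tightness product then has the single factor `t_1 t_1⋆ - t_p t_p⋆`.
    have h4 := ht' (monoidPath 1) (monoidPath p) [] (List.nodup_singleton _) (fun β hβ => by
      rw [List.mem_singleton.mp hβ]
      exact monoidPath_le_iff.mpr ⟨p, (one_mul p).symm⟩) (fun ν _ => by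
      obtain ⟨q, rfl⟩ := eq_monoidPath ν
      refine ⟨monoidPath p, List.mem_singleton_self _, ?_⟩
      obtain ⟨κ, hκ⟩ := exists_mce_eq_singleton hP (monoidPath p) (monoidPath q)
      have : κ ∈ Path.MCE (monoidPath p) (monoidPath q) := by rw [hκ]; rfl
      exact ⟨κ, this.1, this.2.1⟩)
    rw [List.map_nil, List.foldl_nil, sub_eq_zero, h1] at h4
    exact h4.symm

/-- All range projections are equal to the projection `s 1`, and there is exactly one minimal common
extension, so the last relation reduces to idempotence of `s 1`. -/
theorem IsConeRep.isRep (hP : IsTotalCone P) {t : Path (SingleObj P) → B}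
    (hs : IsConeRep fun p : P => t (monoidPath p)) : IsRep t where
  star_vertex _ := hs.star_one
  vertex_mul_self _ := (hs.map_mul 1 1).trans (by rw [mul_one]; rfl)
  vertex_mul x y h := absurd (Subsingleton.elim x y) h
  mul α β := hs.map_mul α β
  star_mul μ := hs.star_mul μ.hom
  range_mul μ ν := by
    obtain ⟨κ, hκ⟩ := exists_mce_eq_singleton hP μ ν
    have h := hs.mul_star
    rw [hκ, finsum_mem_singleton]
    obtain ⟨p, rfl⟩ := eq_monoidPath μ
    obtain ⟨q, rfl⟩ := eq_monoidPath ν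
    obtain ⟨r, rfl⟩ := eq_monoidPath κ
    rw [h p, h q, h r]
    exact (hs.map_mul 1 1).trans (by rw [mul_one])

/-- Since all range projections coincide, the first factor of the product is already zero. -/
theorem IsConeRep.isTight {t : Path (SingleObj P) → B}
    (hs : IsConeRep fun p : P => t (monoidPath p)) : IsTight t := by
  intro μ α E _ _ _
  obtain ⟨p, rfl⟩ := eq_monoidPath μ
  obtain ⟨q, rfl⟩ := eq_monoidPath α
  have h := hs.mul_star
  rw [h p, h q, sub_self, foldl_mul_zero]

theorem IsConeRep.generator {t : Path (SingleObj P) → B}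
    (hs : IsConeRep fun p : P => t (monoidPath p)) :
    IsConeRep fun p : P => generator t (monoidPath p) where
  star_one := Subtype.ext hs.star_one
  map_mul p q := Subtype.ext (hs.map_mul p q)
  star_mul p := Subtype.ext (hs.star_mul p)
  mul_star p := Subtype.ext (hs.mul_star p)

/-- The extension to `G` of a tight representation, with values in the generated C⋆-algebra. -/
def tightExtend (t : Path (SingleObj P) → B) (g : G) : generatedCStar t :=
  coneExtend (fun p : P => generator t (monoidPath p)) g

theorem tightExtend_coe (t : Path (SingleObj P) → B) (p : P) :
    tightExtend t (p : G) = generator t (monoidPath p) :=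
  coneExtend_coe _ p

theorem IsConeRep.dense_span_tightExtend (hP : IsTotalCone P) {t : Path (SingleObj P) → B}
    (hs : IsConeRep fun p : P => t (monoidPath p)) :
    Dense (Submodule.span ℂ (Set.range (tightExtend t)) : Set (generatedCStar t)) := by
  refine dense_span_of_generator (hs.generator.coneExtend_mul hP)
    (hs.generator.star_coneExtend hP) fun μ => ?_
  obtain ⟨p, rfl⟩ := eq_monoidPath μ
  exact ⟨p, coneExtend_coe _ p⟩

theorem IsConeRep.isUnitaryRep_tightExtend (hP : IsTotalCone P) {t : Path (SingleObj P) → B}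
    (hs : IsConeRep fun p : P => t (monoidPath p)) : IsUnitaryRep (tightExtend t) :=
  isUnitaryRep_of_dense_span (hs.generator.coneExtend_mul hP)
    (hs.generator.star_coneExtend hP) (hs.dense_span_tightExtend hP)

/-- A tight representation of a total cone extends uniquely to a unitary representation of the
group. -/
theorem exists_unique_unitary_extension (hP : IsTotalCone P) {t : Path (SingleObj P) → B}
    (ht : IsRep t) (ht' : IsTight t) :
    ∃ tbar : G → generatedCStar t, IsUnitaryRep tbar ∧
      (∀ p : P, tbar (p : G) = PGraphAlg.generator t (monoidPath p)) ∧
      (∀ p : P, tbar (p : G)⁻¹ = star (PGraphAlg.generator t (monoidPath p))) ∧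
      ∀ u : G → generatedCStar t, IsUnitaryRep u →
        (∀ p : P, u (p : G) = PGraphAlg.generator t (monoidPath p)) → u = tbar := by
  have hs := isConeRep_of_isTight hP ht ht'
  refine ⟨tightExtend t, hs.isUnitaryRep_tightExtend hP, tightExtend_coe t,
    hs.generator.coneExtend_inv hP, fun u hu h => ?_⟩
  funext g
  rcases hP.eq_coe_or_eq_inv g with ⟨p, rfl⟩ | ⟨p, rfl⟩
  · rw [h, tightExtend_coe]
  · rw [← hu.map_star, h]
    exact (hs.generator.coneExtend_inv hP p).symm

end OneObject

/-! ### The universal tight representation of a total cone -/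

section TightRep
variable {G : Type u} [Group G] {P : Submonoid G}

/-- An identity between ⋆-polynomials in the generators holds in the universal algebra once it holds
in every tight representation. The cone relations are of this form, and they give back both the
representation relations and tightness. -/
theorem isConeRep_tightRep (hP : IsTotalCone P) :
    IsConeRep fun p : P => (tightRep (monoidPath p) : UniversalCStar (tightRelations (SingleObj P)))
    where
  star_one := by
    simp only [tightRep, UniversalCStar.gen, ← CStarCompletion.of_star]
    refine UniversalCStar.of_eq_of (tightRelations (SingleObj P)) fun B _ y hy => ?_
    rw [map_star, FreeStarAlg.eval_gen]
    exact (isConeRep_of_isTight hP hy.1 hy.2).star_one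
  map_mul p q := by
    simp only [tightRep, UniversalCStar.gen, ← CStarCompletion.of_mul]
    refine UniversalCStar.of_eq_of (tightRelations (SingleObj P)) fun B _ y hy => ?_
    simp only [map_mul, FreeStarAlg.eval_gen]
    exact (isConeRep_of_isTight hP hy.1 hy.2).map_mul p q
  star_mul p := by
    simp only [tightRep, UniversalCStar.gen, ← CStarCompletion.of_mul, ← CStarCompletion.of_star]
    refine UniversalCStar.of_eq_of (tightRelations (SingleObj P)) fun B _ y hy => ?_
    simp only [map_mul, map_star, FreeStarAlg.eval_gen]
    exact (isConeRep_of_isTight hP hy.1 hy.2).star_mul p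
  mul_star p := by
    simp only [tightRep, UniversalCStar.gen, ← CStarCompletion.of_mul, ← CStarCompletion.of_star]
    refine UniversalCStar.of_eq_of (tightRelations (SingleObj P)) fun B _ y hy => ?_
    simp only [map_mul, map_star, FreeStarAlg.eval_gen]
    exact (isConeRep_of_isTight hP hy.1 hy.2).mul_star p

theorem IsUnitaryRep.isConeRep {A : Type v} [NonUnitalCStarAlgebra A] {u : G → A}
    (hu : IsUnitaryRep u) : IsConeRep fun p : P => u (p : G) where
  star_one := by rw [hu.map_star, Submonoid.coe_one, inv_one]
  map_mul p q := by rw [hu.map_mul, Submonoid.coe_mul]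
  star_mul p := by rw [hu.map_star, hu.map_mul, inv_mul_cancel, Submonoid.coe_one]
  mul_star p := by rw [hu.map_star, hu.map_mul, mul_inv_cancel, Submonoid.coe_one]

/-- The restriction to `P` of a unitary representation of `G`, as a family indexed by paths. -/
def restrictPaths {A : Type v} (u : G → A) (μ : Path (SingleObj P)) : A :=
  u ((show P from μ.hom : P) : G)

theorem IsUnitaryRep.restrictPaths_isTight (hP : IsTotalCone P) {A : Type v}
    [NonUnitalCStarAlgebra A] {u : G → A} (hu : IsUnitaryRep u) :
    IsRep (restrictPaths u : Path (SingleObj P) → A) ∧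
      IsTight (restrictPaths u : Path (SingleObj P) → A) :=
  have h : IsConeRep fun p : P => restrictPaths u (monoidPath p) := hu.isConeRep
  ⟨h.isRep hP, h.isTight⟩

/-- The canonical ⋆-homomorphism `C⋆_tight(P) → C⋆(G)`. -/
def tightToGroup (hP : IsTotalCone P) :
    TightCStar (SingleObj P) →⋆ₙₐ[ℂ] GroupCStar G :=
  (UniversalCStar.lift (R := tightRelations (SingleObj P)) (restrictPaths fullRep)
    ((fullRep_isUnitaryRep G).restrictPaths_isTight hP)).comp (NonUnitalStarSubalgebraClass.subtype (generatedCStar tightRep))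

theorem tightToGroup_generator (hP : IsTotalCone P) (p : P) :
    tightToGroup hP (generator tightRep (monoidPath p)) = fullRep (p : G) :=
  UniversalCStar.lift_gen (R := tightRelations (SingleObj P)) _
    ((fullRep_isUnitaryRep G).restrictPaths_isTight hP) (monoidPath p)

theorem tightToGroup_tightExtend (hP : IsTotalCone P) (g : G) :
    tightToGroup hP (tightExtend tightRep g) = fullRep g := by
  rcases hP.eq_coe_or_eq_inv g with ⟨p, rfl⟩ | ⟨p, rfl⟩
  · rw [tightExtend_coe, tightToGroup_generator]
  · rw [tightExtend, (isConeRep_tightRep hP).generator.coneExtend_inv hP, map_star,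
      tightToGroup_generator, (fullRep_isUnitaryRep G).map_star]

/-- The isomorphism `C⋆_tight(P) ≅ C⋆(G)`. -/
def tightEquivGroup (hP : IsTotalCone P) : TightCStar (SingleObj P) ≃⋆ₐ[ℂ] GroupCStar G :=
  StarAlgEquiv.ofBijective (tightToGroup hP) <| by
    have hs := isConeRep_tightRep hP
    let ψ : GroupCStar G →⋆ₙₐ[ℂ] TightCStar (SingleObj P) :=
      groupLift (hs.isUnitaryRep_tightExtend hP)
    have h1 : (tightToGroup hP).comp ψ = NonUnitalStarAlgHom.id ℂ _ := by
      refine starAlgHom_ext_of_dense_span (dense_span_fullRep G) ?_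
      rintro _ ⟨g, rfl⟩
      change tightToGroup hP (ψ (fullRep g)) = fullRep g
      rw [groupLift_fullRep, tightToGroup_tightExtend]
    have h2 : ψ.comp (tightToGroup hP) = NonUnitalStarAlgHom.id ℂ _ := by
      refine starAlgHom_ext_of_dense_span (hs.dense_span_tightExtend hP) ?_
      rintro _ ⟨g, rfl⟩
      change ψ (tightToGroup hP (tightExtend tightRep g)) = tightExtend tightRep g
      rw [tightToGroup_tightExtend, groupLift_fullRep]
    exact Function.bijective_iff_has_inverse.mpr
      ⟨ψ, fun a => DFunLike.congr_fun h2 a, fun a => DFunLike.congr_fun h1 a⟩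

end TightRep

end PGraphAlg

namespace PGraphAlg

open scoped CStarAlgebra

/-! ### Matrix coefficients -/

section Coefficients

/-- A ⋆-homomorphism of C⋆-algebras as a continuous linear map. -/
def homCLM {A : Type u} {B : Type v} [NonUnitalCStarAlgebra A] [NonUnitalCStarAlgebra B]
    (φ : A →⋆ₙₐ[ℂ] B) : A →L[ℂ] B :=
  ⟨(φ : A →ₗ[ℂ] B), map_continuous φ⟩

@[simp] theorem homCLM_apply {A : Type u} {B : Type v} [NonUnitalCStarAlgebra A]
    [NonUnitalCStarAlgebra B] (φ : A →⋆ₙₐ[ℂ] B) (a : A) : homCLM φ a = φ a := rfl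

variable {E : Type u} [NormedAddCommGroup E] [InnerProductSpace ℂ E]

/-- The matrix coefficient `T ↦ ⟨y, T x⟩`. -/
def opCoeff (x y : E) : (E →L[ℂ] E) →L[ℂ] ℂ :=
  (innerSL ℂ y).comp (ContinuousLinearMap.apply ℂ E x)

@[simp] theorem opCoeff_apply (x y : E) (T : E →L[ℂ] E) : opCoeff x y T = inner ℂ y (T x) := rfl

/-- The compression `T ↦ W⋆ T V` of operators. -/
def compress {E' : Type v} [NormedAddCommGroup E'] [InnerProductSpace ℂ E'] [CompleteSpace E]
    [CompleteSpace E'] (V W : E →L[ℂ] E') : (E' →L[ℂ] E') →L[ℂ] (E →L[ℂ] E) :=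
  (ContinuousLinearMap.compL ℂ E E' E (ContinuousLinearMap.adjoint W)).comp
    ((ContinuousLinearMap.compL ℂ E E' E').flip V)

theorem inner_compress_apply {E' : Type v} [NormedAddCommGroup E'] [InnerProductSpace ℂ E']
    [CompleteSpace E] [CompleteSpace E'] (V W : E →L[ℂ] E') (T : E' →L[ℂ] E') (x y : E) :
    inner ℂ y (compress V W T x) = inner ℂ (W y) (T (V x)) :=
  ContinuousLinearMap.adjoint_inner_right W y (T (V x))

variable {A B : Type u} [NonUnitalCStarAlgebra A] [NonUnitalCStarAlgebra B]
variable {H K : Type u} [NormedAddCommGroup H] [InnerProductSpace ℂ H] [CompleteSpace H]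
  [NormedAddCommGroup K] [InnerProductSpace ℂ K] [CompleteSpace K]

/-- The representation `π ⊗ ρ` as a continuous linear map. -/
def minRepCLM (π : A →⋆ₙₐ[ℂ] (H →L[ℂ] H)) (ρ : B →⋆ₙₐ[ℂ] (K →L[ℂ] K)) :
    MinTensor A B →L[ℂ] (Completion (H ⊗[ℂ] K) →L[ℂ] Completion (H ⊗[ℂ] K)) :=
  ⟨{ toFun := minRep π ρ, map_add' := map_add _, map_smul' := map_smul _ }, continuous_minRep π ρ⟩

/-- The matrix coefficient `x ↦ ⟨ξ' ⊗ η', (π ⊗ ρ)(x) (ξ ⊗ η)⟩` on the minimal tensor product. -/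
def tensorCoeff (π : A →⋆ₙₐ[ℂ] (H →L[ℂ] H)) (ρ : B →⋆ₙₐ[ℂ] (K →L[ℂ] K)) (ξ ξ' : H) (η η' : K) :
    MinTensor A B →L[ℂ] ℂ :=
  (opCoeff ((ξ ⊗ₜ[ℂ] η : H ⊗[ℂ] K) : Completion (H ⊗[ℂ] K))
    ((ξ' ⊗ₜ[ℂ] η' : H ⊗[ℂ] K) : Completion (H ⊗[ℂ] K))).comp (minRepCLM π ρ)

theorem tensorCoeff_minTmul (π : A →⋆ₙₐ[ℂ] (H →L[ℂ] H)) (ρ : B →⋆ₙₐ[ℂ] (K →L[ℂ] K)) (ξ ξ' : H)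
    (η η' : K) (a : A) (b : B) : tensorCoeff π ρ ξ ξ' η η' (minTmul a b) =
      inner ℂ ξ' (π a ξ) * inner ℂ η' (ρ b η) :=
  inner_minRep_minTmul π ρ a b ξ ξ' η η'

/-- The map `ξ ↦ ξ ⊗ η` into the Hilbert space tensor product. -/
def tensorRight (H : Type u) [NormedAddCommGroup H] [InnerProductSpace ℂ H] {K : Type v}
    [NormedAddCommGroup K] [InnerProductSpace ℂ K] (η : K) :
    H →L[ℂ] Completion (H ⊗[ℂ] K) :=
  LinearMap.mkContinuous
    { toFun := fun ξ => ((ξ ⊗ₜ[ℂ] η : H ⊗[ℂ] K) : Completion (H ⊗[ℂ] K))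
      map_add' := fun ξ ξ' => by rw [TensorProduct.add_tmul, Completion.coe_add]
      map_smul' := fun c ξ => by
        rw [← TensorProduct.smul_tmul', Completion.coe_smul]; rfl } ‖η‖ fun ξ => by
    change ‖((ξ ⊗ₜ[ℂ] η : H ⊗[ℂ] K) : Completion (H ⊗[ℂ] K))‖ ≤ _
    rw [Completion.norm_coe, TensorProduct.norm_tmul, mul_comm]

theorem tensorRight_apply {H : Type u} {K : Type v} [NormedAddCommGroup H]
    [InnerProductSpace ℂ H] [NormedAddCommGroup K] [InnerProductSpace ℂ K] (η : K) (ξ : H) :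
    tensorRight H η ξ = ((ξ ⊗ₜ[ℂ] η : H ⊗[ℂ] K) : Completion (H ⊗[ℂ] K)) := rfl

end Coefficients

/-! ### The standard basis of `ℓ²(G)` -/

section Basis
variable {G : Type u}

open Classical in
/-- The basis vector `e_g` of `ℓ²(G)`. -/
def basisVec (g : G) : EllTwo G := lp.single 2 g 1

open Classical in
theorem basisVec_apply (g h : G) : basisVec g h = if h = g then 1 else 0 := by
  rw [basisVec, lp.coeFn_single, Pi.single_apply]

theorem inner_basisVec (g : G) (ξ : EllTwo G) : inner ℂ (basisVec g) ξ = ξ g := by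
  classical
  rw [basisVec, lp.inner_single_left]
  simp

theorem norm_basisVec (g : G) : ‖basisVec g‖ = 1 := by
  classical
  rw [basisVec, lp.norm_single (by norm_num)]
  simp

theorem leftRegular_basisVec [Group G] (g h : G) : leftRegular g (basisVec h) = basisVec (g * h) := by
  classical
  ext k
  rw [leftRegular_apply, basisVec_apply, basisVec_apply]
  simp only [inv_mul_eq_iff_eq_mul]

open Classical in
theorem inner_leftRegular_basisVec [Group G] (g h k : G) :
    inner ℂ (basisVec k) (leftRegular g (basisVec h)) = if k = g * h then 1 else 0 := by
  rw [leftRegular_basisVec, inner_basisVec, basisVec_apply]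

/-- A bounded operator on `ℓ²(G)` that vanishes on the basis is zero. -/
theorem eq_zero_of_basisVec {T : EllTwo G →L[ℂ] EllTwo G} (h : ∀ g, T (basisVec g) = 0) :
    T = 0 := by
  classical
  ext1 ξ
  have h1 := (lp.hasSum_single (by norm_num) ξ).mapL T
  have h2 : ∀ g, T (lp.single 2 g (ξ g)) = 0 := by
    intro g
    have : (lp.single 2 g (ξ g) : EllTwo G) = ξ g • basisVec g := by
      rw [basisVec, ← lp.single_smul, smul_eq_mul, mul_one]
    rw [this, map_smul, h, smul_zero]
  simp only [h2] at h1
  exact h1.unique hasSum_zero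

/-- A bounded operator on `ℓ²(G)` with vanishing matrix is zero. -/
theorem eq_zero_of_inner_basisVec {T : EllTwo G →L[ℂ] EllTwo G}
    (h : ∀ g k, inner ℂ (basisVec k) (T (basisVec g)) = 0) : T = 0 := by
  refine eq_zero_of_basisVec fun g => ?_
  ext k
  rw [← inner_basisVec, h]
  rfl

theorem leftRegular_ne_zero [Group G] (g : G) : (leftRegular g : EllTwo G →L[ℂ] EllTwo G) ≠ 0 := by
  intro h
  have h1 : ‖leftRegular g (basisVec 1)‖ = 1 := by
    rw [leftRegular_basisVec, norm_basisVec]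
  rw [h] at h1
  simp at h1

end Basis

/-! ### Coactions on C⋆-algebras generated by a unitary representation -/

section Coaction
variable {G : Type u} [Group G] {A : Type u} [NonUnitalCStarAlgebra A]

theorem IsUnitaryRep.minTmul {B : Type u} [NonUnitalCStarAlgebra B] {v : G → A} {w : G → B}
    (hv : IsUnitaryRep v) (hw : IsUnitaryRep w) :
    IsUnitaryRep fun g : G => PGraphAlg.minTmul (v g) (w g) where
  one_mul a := by
    refine CStarCompletion.induction _ a (isClosed_eq (continuous_const.mul continuous_id)
      continuous_id) fun a => ?_
    rw [PGraphAlg.minTmul, ← CStarCompletion.of_mul]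
    congr 1
    induction a with
    | zero => simp
    | add x y hx hy => rw [mul_add, hx, hy]
    | tmul a b => rw [Algebra.TensorProduct.tmul_mul_tmul, hv.one_mul, hw.one_mul]
  mul_one a := by
    refine CStarCompletion.induction _ a (isClosed_eq (continuous_id.mul continuous_const)
      continuous_id) fun a => ?_
    rw [PGraphAlg.minTmul, ← CStarCompletion.of_mul]
    congr 1
    induction a with
    | zero => simp
    | add x y hx hy => rw [add_mul, hx, hy]
    | tmul a b => rw [Algebra.TensorProduct.tmul_mul_tmul, hv.mul_one, hw.mul_one]
  map_mul g h := by rw [minTmul_mul, hv.map_mul, hw.map_mul]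
  map_star g := by rw [star_minTmul, hv.map_star, hw.map_star]

theorem smul_minTmul {B : Type u} [NonUnitalCStarAlgebra B] (c : ℂ) (a : A) (b : B) :
    minTmul (c • a) b = c • minTmul a b := by
  rw [minTmul, ← TensorProduct.smul_tmul', CStarCompletion.of_smul]
  rfl

variable (G) in
/-- The one-dimensional Hilbert space, in the universe of `G`. -/
abbrev OneDim : Type u := EuclideanSpace ℂ PUnit.{u + 1}

theorem isUnitaryRep_one {E : Type v} [NormedAddCommGroup E] [InnerProductSpace ℂ E]
    [CompleteSpace E] : IsUnitaryRep fun _ : G => (1 : E →L[ℂ] E) where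
  one_mul a := _root_.one_mul a
  mul_one a := _root_.mul_one a
  map_mul _ _ := _root_.one_mul 1
  map_star _ := star_one _

variable {v : G → A} {δ : A →⋆ₙₐ[ℂ] MinTensor A (GroupCStar G)}

/-- The trivial representation `ε` of `C⋆(G)` undoes the coaction: slicing gives `(id ⊗ ε) ∘ δ =
id`. The identity is tested on matrix coefficients of representations of `A`, which separate its
elements. -/
theorem injective_of_apply_eq_minTmul (hd : Dense (Submodule.span ℂ (Set.range v) : Set A))
    (hδ : ∀ g, δ (v g) = minTmul (v g) (fullRep g)) : Function.Injective δ := by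
  rw [injective_iff_map_eq_zero]
  intro a ha
  refine eq_of_forall_rep fun H _ _ _ π => ?_
  rw [map_zero]
  let η : OneDim := EuclideanSpace.single PUnit.unit 1
  have hη : inner ℂ η η = 1 := by simp [η]
  let ε : GroupCStar G →⋆ₙₐ[ℂ] (OneDim →L[ℂ] OneDim) :=
    groupLift (A := OneDim →L[ℂ] OneDim) isUnitaryRep_one
  have key : ∀ ξ ξ', (tensorCoeff π ε ξ ξ' η η).comp (homCLM δ) =
      (opCoeff ξ ξ').comp (homCLM π) := by
    intro ξ ξ'
    refine ContinuousLinearMap.ext_on hd ?_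
    rintro _ ⟨g, rfl⟩
    have h1 : ε (fullRep g) = 1 := groupLift_fullRep (A := OneDim →L[ℂ] OneDim) _ g
    rw [ContinuousLinearMap.comp_apply, ContinuousLinearMap.comp_apply, homCLM_apply, hδ,
      tensorCoeff_minTmul, h1, one_apply_eq_self, hη, mul_one]
    rfl
  ext ξ
  refine ext_inner_left ℂ fun ξ' => ?_
  have h2 := DFunLike.congr_fun (key ξ ξ') a
  rw [ContinuousLinearMap.comp_apply, ContinuousLinearMap.comp_apply, homCLM_apply, ha,
    map_zero] at h2
  rw [zero_apply, inner_zero_right]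
  exact h2.symm

/-- If two ⋆-homomorphisms agree on a generating family with the components of a linear map `L`,
then their values always lie in the closure of the range of `L`. -/
theorem pair_mem_closure_range_of_dense {ι : Type v} {v : ι → A} {X Y : Type u} [NonUnitalCStarAlgebra X]
    [NonUnitalCStarAlgebra Y] {E : Type u} [AddCommGroup E] [Module ℂ E] {L₁ : E →ₗ[ℂ] X}
    {L₂ : E →ₗ[ℂ] Y} {Φ₁ : A →⋆ₙₐ[ℂ] X} {Φ₂ : A →⋆ₙₐ[ℂ] Y}
    (hd : Dense (Submodule.span ℂ (Set.range v) : Set A))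
    (h : ∀ g, ∃ x, L₁ x = Φ₁ (v g) ∧ L₂ x = Φ₂ (v g)) (a : A) :
    (Φ₁ a, Φ₂ a) ∈ closure (Set.range fun x => (L₁ x, L₂ x)) := by
  let Φ : A →L[ℂ] X × Y := (homCLM Φ₁).prod (homCLM Φ₂)
  have hcl : IsClosed (Φ ⁻¹' closure (Set.range (L₁.prod L₂))) :=
    isClosed_closure.preimage Φ.continuous
  have h3 : Submodule.span ℂ (Set.range v) ≤
      (LinearMap.range (L₁.prod L₂)).comap (Φ : A →ₗ[ℂ] X × Y) := by
    rw [Submodule.span_le]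
    rintro _ ⟨g, rfl⟩
    obtain ⟨x, h1, h2⟩ := h g
    exact ⟨x, Prod.ext h1 h2⟩
  exact hcl.closure_subset_iff.mpr (fun x hx => subset_closure (h3 hx)) (hd a)

/-- A ⋆-homomorphism `A → A ⊗ C⋆(G)` with `v_g ↦ v_g ⊗ U_g` is a coaction if the unitary
representation `v` generates `A`. -/
theorem isCoaction_of_apply_eq_minTmul (hv : IsUnitaryRep v)
    (hd : Dense (Submodule.span ℂ (Set.range v) : Set A))
    (hδ : ∀ g, δ (v g) = minTmul (v g) (fullRep g)) : IsCoaction δ where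
  injective := injective_of_apply_eq_minTmul hd hδ
  nondegenerate := by
    have h1 := (hv.minTmul (fullRep_isUnitaryRep G)).one_mul
    -- No density argument is needed: `δ (v 1) = v_1 ⊗ U_1` is the unit of the tensor product, so
    -- every element already has the form `δ a * y`.
    have h2 : (Submodule.span ℂ {x | ∃ a y, x = δ a * y} : Set (MinTensor A (GroupCStar G))) =
        Set.univ := by
      refine Set.eq_univ_of_forall fun x => Submodule.subset_span ⟨v 1, x, ?_⟩
      rw [hδ, h1]
    rw [h2]
    exact dense_univ
  coaction_identity := by
    have hcomul : ∀ g, comul G (fullRep g) = minTmul (fullRep g) (fullRep g) := fun g =>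
      groupLift_fullRep (diagonal_isUnitaryRep G) g
    refine pair_mem_closure_range_of_dense
      (L₁ := (minIncl (MinTensor A (GroupCStar G)) (GroupCStar G)).comp
        (TensorProduct.map (minIncl A (GroupCStar G)) LinearMap.id))
      (L₂ := (minIncl A (MinTensor (GroupCStar G) (GroupCStar G))).comp
        ((TensorProduct.map LinearMap.id (minIncl (GroupCStar G) (GroupCStar G))).comp
          (TensorProduct.assoc ℂ A (GroupCStar G) (GroupCStar G)).toLinearMap))
      (Φ₁ := (minMap δ (NonUnitalStarAlgHom.id ℂ (GroupCStar G))).comp δ)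
      (Φ₂ := (minMap (NonUnitalStarAlgHom.id ℂ A) (comul G)).comp δ) hd fun g =>
      ⟨(v g ⊗ₜ fullRep g) ⊗ₜ fullRep g, ?_, ?_⟩
    · rw [NonUnitalStarAlgHom.comp_apply, hδ, minMap_tmul, hδ]
      rfl
    · rw [NonUnitalStarAlgHom.comp_apply, hδ, minMap_tmul, hcomul]
      rfl

end Coaction

/-! ### Normality and the regular representation -/

section Normal
variable {G : Type u} [Group G] {A : Type u} [NonUnitalCStarAlgebra A]
  {v : G → A} {δ : A →⋆ₙₐ[ℂ] MinTensor A (GroupCStar G)}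
  {θ : A →⋆ₙₐ[ℂ] (EllTwo G →L[ℂ] EllTwo G)}

/-- The vector functional `a ↦ ⟨e_1, θ(a) e_1⟩`. -/
def vectorTrace (θ : A →⋆ₙₐ[ℂ] (EllTwo G →L[ℂ] EllTwo G)) : A →L[ℂ] ℂ :=
  (opCoeff (basisVec 1) (basisVec 1)).comp (homCLM θ)

theorem vectorTrace_apply (a : A) :
    vectorTrace θ a = inner ℂ (basisVec 1) (θ a (basisVec 1)) := rfl

open Classical in
theorem vectorTrace_unitary (hθ : ∀ g, θ (v g) = leftRegular g) (g : G) :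
    vectorTrace θ (v g) = if g = 1 then 1 else 0 := by
  rw [vectorTrace_apply, hθ, inner_leftRegular_basisVec, mul_one]
  simp only [eq_comm]

theorem norm_vectorTrace_le (a : A) : ‖vectorTrace θ a‖ ≤ ‖a‖ := by
  rw [vectorTrace_apply]
  have h1 : ‖θ a (basisVec 1)‖ ≤ ‖θ a‖ * ‖basisVec (1 : G)‖ := (θ a).le_opNorm _
  have h2 : ‖θ a‖ ≤ ‖a‖ := NonUnitalStarAlgHom.norm_apply_le θ a
  have h3 := norm_inner_le_norm (𝕜 := ℂ) (basisVec (1 : G)) (θ a (basisVec 1))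
  rw [norm_basisVec] at h1 h3
  linarith

theorem vectorTrace_star_mul_self (a : A) :
    vectorTrace θ (star a * a) = (‖θ a (basisVec 1)‖ ^ 2 : ℝ) := by
  rw [vectorTrace_apply, map_mul, map_star]
  change inner ℂ (basisVec 1) (ContinuousLinearMap.adjoint (θ a) (θ a (basisVec 1))) = _
  rw [ContinuousLinearMap.adjoint_inner_right, inner_self_eq_norm_sq_to_K]
  norm_cast

/-- On the spanning unitaries this is the fact that `h⁻¹ g h = 1` exactly when `g = 1`. It carries
information about the vector `e_1` to all basis vectors. -/
theorem vectorTrace_conj (hv : IsUnitaryRep v)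
    (hd : Dense (Submodule.span ℂ (Set.range v) : Set A))
    (hθ : ∀ g, θ (v g) = leftRegular g) (h : G) (a : A) :
    vectorTrace θ (v h⁻¹ * a * v h) = vectorTrace θ a := by
  classical
  have h1 : (fun a => vectorTrace θ (v h⁻¹ * a * v h)) = fun a => vectorTrace θ a := by
    refine eq_of_dense_span hd (by fun_prop) (by fun_prop) ⟨?_, ?_⟩
      ⟨map_add _, map_smul _⟩ ?_
    · intro x y
      rw [mul_add, add_mul, map_add]
    · intro c x
      rw [mul_smul_comm, smul_mul_assoc, map_smul]
    · rintro _ ⟨g, rfl⟩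
      rw [hv.map_mul, hv.map_mul, vectorTrace_unitary hθ, vectorTrace_unitary hθ]
      have : h⁻¹ * g * h = 1 ↔ g = 1 := by
        simpa using conj_eq_one_iff (a := h⁻¹) (b := g)
      simp only [this]
  exact congrFun h1 a

/-- The vector trace is a trace, so that `θ a` vanishes if the trace of `a⋆ a` does. -/
theorem apply_eq_zero_of_vectorTrace_eq_zero (hv : IsUnitaryRep v)
    (hd : Dense (Submodule.span ℂ (Set.range v) : Set A))
    (hθ : ∀ g, θ (v g) = leftRegular g) {a : A} (ha : vectorTrace θ (star a * a) = 0) :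
    θ a = 0 := by
  refine eq_zero_of_basisVec fun h => ?_
  -- Translating `e_1` by `v h` gives `τ((a v_h)⋆ (a v_h)) = ‖θ(a) e_h‖²`, while conjugation
  -- invariance turns the left side into `τ(a⋆ a)`.
  have h1 := vectorTrace_star_mul_self (θ := θ) (a * v h)
  have h2 : star (a * v h) * (a * v h) = v h⁻¹ * (star a * a) * v h := by
    rw [star_mul, hv.map_star, mul_assoc, mul_assoc, mul_assoc]
  rw [h2, vectorTrace_conj hv hd hθ, ha, map_mul, hθ] at h1
  have h3 : (θ a * leftRegular h) (basisVec 1) = θ a (basisVec h) := by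
    change θ a (leftRegular h (basisVec 1)) = _
    rw [leftRegular_basisVec, mul_one]
  rw [h3] at h1
  have h4 : ‖θ a (basisVec h)‖ ^ 2 = 0 := by exact_mod_cast h1.symm
  simpa using h4

/-- Slicing `δ a` by the regular vector state at `e_1` can be computed twice: from `δ a = a ⊗ U_g`,
and by continuity from the unitaries, where it yields `τ(a) v_1`. Hence an element of degree `1`
equals `τ(a) v_1`, and `τ(a) v_1 = 0` in any other degree; both are stated through matrix
coefficients. -/
theorem mul_inner_eq_of_mem_gradedComponent
    (hd : Dense (Submodule.span ℂ (Set.range v) : Set A))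
    (hδ : ∀ g, δ (v g) = minTmul (v g) (fullRep g)) (hθ : ∀ g, θ (v g) = leftRegular g)
    {g : G} {a : A} (ha : a ∈ gradedComponent δ g) {H : Type u} [NormedAddCommGroup H]
    [InnerProductSpace ℂ H] [CompleteSpace H] (π : A →⋆ₙₐ[ℂ] (H →L[ℂ] H)) (ξ ξ' : H) :
    inner ℂ ξ' (π a ξ) * inner ℂ (basisVec 1) (leftRegular g (basisVec 1)) =
      vectorTrace θ a * inner ℂ ξ' (π (v 1) ξ) := by
  classical
  have hreg : ∀ g : G, leftRegularHom G (fullRep g) = leftRegular g := fun g =>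
    groupLift_fullRep (A := EllTwo G →L[ℂ] EllTwo G) (leftRegular_isUnitaryRep G) g
  have key : (tensorCoeff π (leftRegularHom G) ξ ξ' (basisVec 1) (basisVec 1)).comp (homCLM δ) =
      (inner ℂ ξ' (π (v 1) ξ)) • vectorTrace θ := by
    refine ContinuousLinearMap.ext_on hd ?_
    rintro _ ⟨h, rfl⟩
    rw [ContinuousLinearMap.comp_apply, homCLM_apply, hδ, tensorCoeff_minTmul, hreg,
      smul_apply, vectorTrace_unitary hθ, inner_leftRegular_basisVec, mul_one]
    by_cases hh : h = 1
    · subst hh; simp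
    · rw [if_neg hh, if_neg (Ne.symm hh)]; simp
  have h1 := DFunLike.congr_fun key a
  have h2 : δ a = minTmul a (fullRep g) := ha
  rw [ContinuousLinearMap.comp_apply, homCLM_apply, h2, tensorCoeff_minTmul, hreg,
    smul_apply, smul_eq_mul, mul_comm (inner ℂ ξ' (π (v 1) ξ))] at h1
  exact h1

/-- The expectation `a ↦ ⟨e_1, θ(a) e_1⟩ v_1`. -/
theorem isCoactionExpectation_vectorTrace (hv : IsUnitaryRep v)
    (hd : Dense (Submodule.span ℂ (Set.range v) : Set A))
    (hδ : ∀ g, δ (v g) = minTmul (v g) (fullRep g)) (hθ : ∀ g, θ (v g) = leftRegular g) :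
    IsCoactionExpectation δ ((vectorTrace θ : A →ₗ[ℂ] ℂ).smulRight (v 1)) where
  contractive a := by
    change ‖vectorTrace θ a • v 1‖ ≤ ‖a‖
    rw [norm_smul]
    have h1 := norm_vectorTrace_le (θ := θ) a
    have h2 := hv.norm_le_one 1
    nlinarith [norm_nonneg (vectorTrace θ a), norm_nonneg (v 1)]
  mem a := by
    change δ (vectorTrace θ a • v 1) = minTmul (vectorTrace θ a • v 1) (fullRep 1)
    rw [map_smul, hδ, smul_minTmul]
  apply_of_mem a ha := by
    classical
    change vectorTrace θ a • v 1 = a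
    refine eq_of_forall_rep fun H _ _ _ π => ?_
    ext ξ
    refine ext_inner_left ℂ fun ξ' => ?_
    have h1 := mul_inner_eq_of_mem_gradedComponent hd hδ hθ ha π ξ ξ'
    rw [inner_leftRegular_basisVec, mul_one, if_pos rfl, mul_one] at h1
    rw [h1, map_smul, smul_apply, inner_smul_right]
  apply_eq_zero g hg a ha := by
    classical
    change vectorTrace θ a • v 1 = 0
    refine eq_of_forall_rep fun H _ _ _ π => ?_
    ext ξ
    refine ext_inner_left ℂ fun ξ' => ?_
    have h1 := mul_inner_eq_of_mem_gradedComponent hd hδ hθ ha π ξ ξ'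
    rw [inner_leftRegular_basisVec, mul_one, if_neg (Ne.symm hg), mul_zero] at h1
    rw [map_smul, smul_apply, inner_smul_right, ← h1, map_zero,
      zero_apply, inner_zero_right]

/-- The conditional expectation of the coaction is `a ↦ τ(a) v_1`, for the canonical trace `τ`. -/
theorem IsCoactionExpectation.apply_eq {Φ : A →ₗ[ℂ] A} (hΦ : IsCoactionExpectation δ Φ)
    (hd : Dense (Submodule.span ℂ (Set.range v) : Set A))
    (hδ : ∀ g, δ (v g) = minTmul (v g) (fullRep g)) {τ : A →L[ℂ] ℂ}
    (hτ : τ (v 1) = 1) (hτ' : ∀ g ≠ 1, τ (v g) = 0) (a : A) : Φ a = τ a • v 1 := by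
  -- Contractivity makes the expectation continuous, so its values on the homogeneous elements `v g`
  -- determine it.
  let Φ' : A →L[ℂ] A := Φ.mkContinuous 1 fun a => by rw [one_mul]; exact hΦ.contractive a
  have h1 : Φ' = τ.smulRight (v 1) := by
    refine ContinuousLinearMap.ext_on hd ?_
    rintro _ ⟨g, rfl⟩
    change Φ (v g) = τ (v g) • v 1
    by_cases hg : g = 1
    · subst hg
      rw [hΦ.apply_of_mem _ (hδ 1), hτ, one_smul]
    · rw [hΦ.apply_eq_zero g hg _ (hδ g), hτ' g hg, zero_smul]
  exact DFunLike.congr_fun h1 a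

/-- The coaction is normal if and only if the regular representation is faithful on `A`. -/
theorem isNormalCoaction_iff (hv : IsUnitaryRep v)
    (hd : Dense (Submodule.span ℂ (Set.range v) : Set A))
    (hδ : ∀ g, δ (v g) = minTmul (v g) (fullRep g)) (hθ : ∀ g, θ (v g) = leftRegular g) :
    IsNormalCoaction δ ↔ Function.Injective θ := by
  classical
  constructor
  · rintro ⟨Φ, hΦ, hfaith⟩
    rw [injective_iff_map_eq_zero]
    intro a ha
    -- From `θ a = 0` follows `τ(a⋆ a) = 0`, so the expectation kills `a⋆ a` and faithfulness
    -- applies.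
    rw [← CStarRing.star_mul_self_eq_zero_iff]
    refine hfaith a ?_
    rw [hΦ.apply_eq hd hδ (τ := vectorTrace θ) (by rw [vectorTrace_unitary hθ, if_pos rfl])
      (fun g hg => by rw [vectorTrace_unitary hθ, if_neg hg]), vectorTrace_star_mul_self, ha]
    simp
  · intro hinj
    refine ⟨_, isCoactionExpectation_vectorTrace hv hd hδ hθ, fun a ha => ?_⟩
    have h1 : vectorTrace θ (star a * a) • v 1 = 0 := ha
    have h2 : v 1 ≠ 0 := by
      intro h
      have h3 := hθ 1
      rw [h, map_zero] at h3
      exact leftRegular_ne_zero 1 h3.symm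
    have h4 := apply_eq_zero_of_vectorTrace_eq_zero hv hd hθ
      ((smul_eq_zero.mp h1).resolve_right h2)
    rw [CStarRing.star_mul_self_eq_zero_iff]
    exact hinj (by rw [h4, map_zero])

end Normal

end PGraphAlg

namespace PGraphAlg

open scoped CStarAlgebra

/-! ### The coaction on a quotient of the group algebra in the regular representation -/

section RegularCoaction
variable {G : Type u} [Group G] {A : Type u} [NonUnitalCStarAlgebra A] {v : G → A}
  {θ : A →⋆ₙₐ[ℂ] (EllTwo G →L[ℂ] EllTwo G)}

/-- Slicing `v_g ⊗ U_g ↦ ω(U_g) v_g` by a vector functional `ω` gives a bounded map on the full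
group C⋆-algebra with values in `A`, as `A` is closed in `B(ℓ²(G))`. -/
theorem exists_slice (hv : IsUnitaryRep v) (hinj : Function.Injective θ) {K : Type u} [NormedAddCommGroup K] [InnerProductSpace ℂ K]
    [CompleteSpace K] (ρ : GroupCStar G →⋆ₙₐ[ℂ] (K →L[ℂ] K)) (η η' : K) :
    ∃ R : GroupCStar G →L[ℂ] A, ∀ g, R (fullRep g) = inner ℂ η' (ρ (fullRep g) η) • v g := by
  let β := groupLift (hv.minTmul (fullRep_isUnitaryRep G))
  -- The slice is first built as an operator on `ℓ²(G)`, by compressing `(θ ⊗ ρ) ∘ β` between the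
  -- embeddings `ξ ↦ ξ ⊗ η` and `ξ ↦ ξ ⊗ η'`.
  let R₀ : GroupCStar G →L[ℂ] (EllTwo G →L[ℂ] EllTwo G) :=
    ((compress (tensorRight (EllTwo G) η) (tensorRight (EllTwo G) η')).comp (minRepCLM θ ρ)).comp
      (homCLM β)
  let θi : A →ₗᵢ[ℂ] (EllTwo G →L[ℂ] EllTwo G) :=
    ⟨(θ : A →ₗ[ℂ] (EllTwo G →L[ℂ] EllTwo G)), NonUnitalStarAlgHom.norm_map θ hinj⟩
  have hR₀ : ∀ g, R₀ (fullRep g) = θi (inner ℂ η' (ρ (fullRep g) η) • v g) := by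
    intro g
    ext1 ξ
    refine ext_inner_left ℂ fun ξ' => ?_
    change inner ℂ ξ' (compress _ _ (minRep θ ρ (β (fullRep g))) ξ) = _
    rw [inner_compress_apply, groupLift_fullRep, tensorRight_apply, tensorRight_apply,
      inner_minRep_minTmul, map_smul, smul_apply, inner_smul_right, mul_comm]
    rfl
  have hclosed : IsClosed (LinearMap.range θi.toLinearMap : Set (EllTwo G →L[ℂ] EllTwo G)) := by
    have := θi.isometry.isClosedEmbedding.isClosed_range
    exact this
  -- The values on the unitaries lie in the range of `θ`. This range is closed because an injective
  -- ⋆-homomorphism is isometric, so all values lie in it and can be pulled back to `A`.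
  have hmem : ∀ a, R₀ a ∈ LinearMap.range θi.toLinearMap := by
    intro a
    have hsub : Submodule.span ℂ (Set.range fullRep) ≤
        (LinearMap.range θi.toLinearMap).comap (R₀ : GroupCStar G →ₗ[ℂ] _) := by
      rw [Submodule.span_le]
      rintro _ ⟨g, rfl⟩
      exact ⟨_, (hR₀ g).symm⟩
    exact (hclosed.preimage R₀.continuous).closure_subset_iff.mpr hsub (dense_span_fullRep G a)
  refine ⟨(θi.equivRange.symm.toContinuousLinearEquiv :
    LinearMap.range θi.toLinearMap →L[ℂ] A).comp (R₀.codRestrict _ hmem), fun g => ?_⟩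
  refine (LinearIsometryEquiv.symm_apply_eq _).mpr ?_
  exact Subtype.ext (hR₀ g)

/-- The slices of an element of the full group C⋆-algebra that vanishes in `A` are zero. -/
theorem slice_eq_zero (hv : IsUnitaryRep v) (hθ : ∀ g, θ (v g) = leftRegular g)
    (hinj : Function.Injective θ) {R : GroupCStar G →L[ℂ] A} {ω : G → ℂ}
    (hR : ∀ g, R (fullRep g) = ω g • v g) {a : GroupCStar G} (ha : groupLift hv a = 0) :
    R a = 0 := by
  classical
  refine hinj ?_
  rw [map_zero]
  refine eq_zero_of_inner_basisVec fun h k => ?_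
  -- The entry of `L_g` at `(k, h)` is nonzero only for `g = k h⁻¹`. At a fixed entry the varying
  -- weight `ω g` may therefore be replaced by the constant `ω (k h⁻¹)`, so slicing multiplies the
  -- matrix entrywise.
  have key : (opCoeff (basisVec h) (basisVec k)).comp ((homCLM θ).comp R) =
      ω (k * h⁻¹) • (opCoeff (basisVec h) (basisVec k)).comp
        ((homCLM θ).comp (homCLM (groupLift hv))) := by
    refine ContinuousLinearMap.ext_on (dense_span_fullRep G) ?_
    rintro _ ⟨g, rfl⟩
    change inner ℂ (basisVec k) (θ (R (fullRep g)) (basisVec h)) =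
      ω (k * h⁻¹) • inner ℂ (basisVec k) (θ (groupLift hv (fullRep g)) (basisVec h))
    rw [hR, map_smul, groupLift_fullRep, hθ, smul_apply, inner_smul_right,
      inner_leftRegular_basisVec, smul_eq_mul]
    by_cases hk : k = g * h
    · rw [hk, mul_inv_cancel_right]
    · rw [if_neg hk, mul_zero, mul_zero]
  have h1 := DFunLike.congr_fun key a
  change inner ℂ (basisVec k) (θ (R a) (basisVec h)) =
      ω (k * h⁻¹) • inner ℂ (basisVec k) (θ (groupLift hv a) (basisVec h)) at h1
  rw [h1, ha, map_zero, zero_apply, inner_zero_right, smul_zero]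

/-- If the regular representation is faithful on `A`, there is a coaction `v_g ↦ v_g ⊗ U_g`. -/
theorem exists_coaction_of_injective (hv : IsUnitaryRep v)
    (hd : Dense (Submodule.span ℂ (Set.range v) : Set A))
    (hθ : ∀ g, θ (v g) = leftRegular g) (hinj : Function.Injective θ) :
    ∃ δ : A →⋆ₙₐ[ℂ] MinTensor A (GroupCStar G), ∀ g, δ (v g) = minTmul (v g) (fullRep g) := by
  let β := groupLift (hv.minTmul (fullRep_isUnitaryRep G))
  -- The wanted map must factor through `C⋆(G) → A`, so it suffices that every product
  -- representation kills `β a` when the image of `a` in `A` is zero. Its coefficients at elementary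
  -- tensors are coefficients of slices.
  have hker : ∀ a, groupLift hv a = 0 → β a = 0 := by
    intro a ha
    refine minTensor_eq_zero fun H K _ _ _ _ _ _ π ρ => ?_
    refine tensorOperator_eq_zero fun ξ ξ' η η' => ?_
    obtain ⟨R, hR⟩ := exists_slice hv hinj ρ η η'
    have key : (tensorCoeff π ρ ξ ξ' η η').comp (homCLM β) =
        (opCoeff ξ ξ').comp ((homCLM π).comp R) := by
      refine ContinuousLinearMap.ext_on (dense_span_fullRep G) ?_
      rintro _ ⟨g, rfl⟩
      change tensorCoeff π ρ ξ ξ' η η' (β (fullRep g)) = inner ℂ ξ' (π (R (fullRep g)) ξ)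
      rw [groupLift_fullRep, tensorCoeff_minTmul, hR, map_smul, smul_apply, inner_smul_right,
        mul_comm]
    have h1 := DFunLike.congr_fun key a
    change tensorCoeff π ρ ξ ξ' η η' (β a) = inner ℂ ξ' (π (R a) ξ) at h1
    rw [slice_eq_zero hv hθ hinj hR ha, map_zero, zero_apply, inner_zero_right] at h1
    exact h1
  obtain ⟨δ, hδ⟩ := exists_factor_of_norm_le (groupLift hv) (denseRange_groupLift hv hd) β
    (norm_le_of_ker_le _ _ hker)
  refine ⟨δ, fun g => ?_⟩
  have h1 := hδ (fullRep g)
  rw [groupLift_fullRep] at h1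
  exact h1.trans (groupLift_fullRep (hv.minTmul (fullRep_isUnitaryRep G)) g)

/-- If `v` is mapped to the universal unitary representation, there is a coaction
`v_g ↦ v_g ⊗ U_g`. -/
theorem exists_coaction_of_hom (hv : IsUnitaryRep v) (φ : A →⋆ₙₐ[ℂ] GroupCStar G)
    (hφ : ∀ g, φ (v g) = fullRep g) :
    ∃ δ : A →⋆ₙₐ[ℂ] MinTensor A (GroupCStar G), ∀ g, δ (v g) = minTmul (v g) (fullRep g) := by
  refine ⟨(groupLift (hv.minTmul (fullRep_isUnitaryRep G))).comp φ, fun g => ?_⟩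
  rw [NonUnitalStarAlgHom.comp_apply, hφ]
  exact groupLift_fullRep (hv.minTmul (fullRep_isUnitaryRep G)) g

end RegularCoaction

/-! ### Gauge coactions on tight representations of a total cone -/

section Gauge
variable {G : Type u} [Group G] {P : Submonoid G} {B : Type u} [NonUnitalCStarAlgebra B]
  {t : Path (CategoryTheory.SingleObj P) → B}

/-- A gauge coaction is prescribed on `P` only; adjoints give its values on `P⁻¹`, hence on all of
`G`. This brings an arbitrary gauge coaction under the criteria for unitary representations. -/
theorem IsGaugeCoaction.apply_tightExtend (hP : IsTotalCone P)
    (hs : IsConeRep fun p : P => t (monoidPath p))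
    {δ : generatedCStar t →⋆ₙₐ[ℂ] MinTensor (generatedCStar t) (GroupCStar G)}
    (hδ : IsGaugeCoaction (CategoryTheory.Functor.id (CategoryTheory.SingleObj P)) t δ) (g : G) :
    δ (tightExtend t g) = minTmul (tightExtend t g) (fullRep g) := by
  rcases hP.eq_coe_or_eq_inv g with ⟨p, rfl⟩ | ⟨p, rfl⟩
  · rw [tightExtend_coe]
    exact hδ.apply_generator (monoidPath p)
  · have h1 : δ (generator t (monoidPath p)) =
        minTmul (generator t (monoidPath p)) (fullRep (p : G)) :=
      hδ.apply_generator (monoidPath p)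
    rw [tightExtend, hs.generator.coneExtend_inv hP, map_star, h1, star_minTmul,
      (fullRep_isUnitaryRep G).map_star]

theorem isGaugeCoaction_of_apply_tightExtend (hP : IsTotalCone P)
    (hs : IsConeRep fun p : P => t (monoidPath p))
    {δ : generatedCStar t →⋆ₙₐ[ℂ] MinTensor (generatedCStar t) (GroupCStar G)}
    (hδ : ∀ g, δ (tightExtend t g) = minTmul (tightExtend t g) (fullRep g)) :
    IsGaugeCoaction (CategoryTheory.Functor.id (CategoryTheory.SingleObj P)) t δ where
  toIsCoaction := isCoaction_of_apply_eq_minTmul (hs.isUnitaryRep_tightExtend hP)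
    (hs.dense_span_tightExtend hP) hδ
  apply_generator μ := by
    obtain ⟨p, rfl⟩ := eq_monoidPath μ
    have h1 := hδ (p : G)
    rw [tightExtend_coe] at h1
    exact h1

/-- The universal tight representation of a total cone has a gauge coaction. -/
theorem exists_gaugeCoaction_tightRep (hP : IsTotalCone P) :
    ∃ δ, IsGaugeCoaction (CategoryTheory.Functor.id (CategoryTheory.SingleObj P))
      (tightRep : Path (CategoryTheory.SingleObj P) → _) δ := by
  have hs := isConeRep_tightRep hP
  obtain ⟨δ, hδ⟩ := exists_coaction_of_hom (hs.isUnitaryRep_tightExtend hP) (tightToGroup hP)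
    (tightToGroup_tightExtend hP)
  exact ⟨δ, isGaugeCoaction_of_apply_tightExtend hP hs hδ⟩

theorem leftRegularHom_fullRep (g : G) : leftRegularHom G (fullRep g) = leftRegular g :=
  groupLift_fullRep (A := EllTwo G →L[ℂ] EllTwo G) (leftRegular_isUnitaryRep G) g

/-- The gauge coaction on the tight C⋆-algebra of a total cone is normal if and only if the group
is amenable. -/
theorem isNormalCoaction_tightRep_iff (hP : IsTotalCone P)
    {δ : TightCStar (CategoryTheory.SingleObj P) →⋆ₙₐ[ℂ]
      MinTensor (TightCStar (CategoryTheory.SingleObj P)) (GroupCStar G)}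
    (hδ : IsGaugeCoaction (CategoryTheory.Functor.id (CategoryTheory.SingleObj P)) tightRep δ) :
    IsNormalCoaction δ ↔ IsAmenable G := by
  have hs := isConeRep_tightRep hP
  rw [isNormalCoaction_iff (θ := (leftRegularHom G).comp (tightToGroup hP))
    (hs.isUnitaryRep_tightExtend hP) (hs.dense_span_tightExtend hP) (hδ.apply_tightExtend hP hs)
    (fun g => by rw [NonUnitalStarAlgHom.comp_apply, tightToGroup_tightExtend,
      leftRegularHom_fullRep])]
  exact Function.Injective.of_comp_iff' _ (tightEquivGroup hP).bijective

/-- The universal tight representation of a total cone is faithful and tight and has a gauge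
coaction. -/
theorem isFaithfulTightGauge_tightRep (hP : IsTotalCone P) :
    IsFaithfulTightGauge (CategoryTheory.Functor.id (CategoryTheory.SingleObj P))
      (tightRep : Path (CategoryTheory.SingleObj P) → _) where
  isRep := (isConeRep_tightRep hP).isRep hP
  isTight := (isConeRep_tightRep hP).isTight
  gauge := exists_gaugeCoaction_tightRep hP
  isFaithfulRep μ h := by
    obtain ⟨p, rfl⟩ := eq_monoidPath μ
    have h1 : generator tightRep (monoidPath p) = 0 := Subtype.ext h
    have h2 := congrArg (leftRegularHom G) (tightToGroup_generator hP p)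
    rw [h1, map_zero, map_zero, leftRegularHom_fullRep] at h2
    exact leftRegular_ne_zero _ h2.symm

/-- The restriction of the left-regular representation of `G` to the cone `P`. -/
def regularRep (P : Submonoid G) (μ : Path (CategoryTheory.SingleObj P)) :
    EllTwo G →L[ℂ] EllTwo G :=
  restrictPaths leftRegular μ

theorem isConeRep_regularRep : IsConeRep fun p : P => regularRep P (monoidPath p) :=
  (leftRegular_isUnitaryRep G).isConeRep

theorem coe_tightExtend_regularRep (hP : IsTotalCone P) (g : G) :
    (tightExtend (regularRep P) g : EllTwo G →L[ℂ] EllTwo G) = leftRegular g := by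
  rcases hP.eq_coe_or_eq_inv g with ⟨p, rfl⟩ | ⟨p, rfl⟩
  · rw [tightExtend_coe]
    rfl
  · rw [tightExtend, (isConeRep_regularRep (P := P)).generator.coneExtend_inv hP,
      ← (leftRegular_isUnitaryRep G).map_star]
    rfl

/-- The restriction of the left-regular representation is the co-universal representation. -/
theorem isCoUniversalRep_regularRep (hP : IsTotalCone P) :
    IsCoUniversalRep (B := EllTwo G →L[ℂ] EllTwo G)
      (CategoryTheory.Functor.id (CategoryTheory.SingleObj P)) (regularRep P) where
  isRep := (isConeRep_regularRep (P := P)).isRep hP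
  isTight := (isConeRep_regularRep (P := P)).isTight
  isFaithfulRep μ := leftRegular_ne_zero _
  normal_gauge := by
    have hs := isConeRep_regularRep (P := P)
    let θ := NonUnitalStarSubalgebraClass.subtype (generatedCStar (regularRep P))
    have hθ : ∀ g, θ (tightExtend (regularRep P) g) = leftRegular g :=
      coe_tightExtend_regularRep hP
    have hinj : Function.Injective θ := Subtype.val_injective
    obtain ⟨δ, hδ⟩ := exists_coaction_of_injective (hs.isUnitaryRep_tightExtend hP)
      (hs.dense_span_tightExtend hP) hθ hinj
    exact ⟨δ, isGaugeCoaction_of_apply_tightExtend hP hs hδ,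
      (isNormalCoaction_iff (hs.isUnitaryRep_tightExtend hP) (hs.dense_span_tightExtend hP) hδ
        hθ).mpr hinj⟩

/-- A unitary representation that carries a normal coaction is dominated by the regular
representation. -/
theorem norm_groupLift_le_of_isNormalCoaction {A : Type u} [NonUnitalCStarAlgebra A] {v : G → A}
    (hv : IsUnitaryRep v) {δ : A →⋆ₙₐ[ℂ] MinTensor A (GroupCStar G)}
    (hδ : ∀ g, δ (v g) = minTmul (v g) (fullRep g)) (hn : IsNormalCoaction δ)
    (a : GroupCStar G) : ‖groupLift hv a‖ ≤ ‖leftRegularHom G a‖ := by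
  classical
  refine norm_le_of_ker_le (leftRegularHom G) (groupLift hv) (fun a ha => ?_) a
  obtain ⟨Φ, hΦ, hfaith⟩ := hn
  let Φ' : A →L[ℂ] A := Φ.mkContinuous 1 fun a => by rw [one_mul]; exact hΦ.contractive a
  -- On `C⋆(G)` the expectation of the image in `A` is given by the trace of the regular
  -- representation. If the latter kills `a`, the expectation kills the image of `a⋆ a`, and
  -- faithfulness kills the image itself.
  have key : Φ'.comp (homCLM (groupLift hv)) =
      (vectorTrace (leftRegularHom G)).smulRight (v 1) := by
    refine ContinuousLinearMap.ext_on (dense_span_fullRep G) ?_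
    rintro _ ⟨g, rfl⟩
    change Φ (groupLift hv (fullRep g)) = vectorTrace (leftRegularHom G) (fullRep g) • v 1
    rw [groupLift_fullRep, vectorTrace_unitary leftRegularHom_fullRep]
    by_cases hg : g = 1
    · subst hg
      rw [hΦ.apply_of_mem _ (hδ 1), if_pos rfl, one_smul]
    · rw [hΦ.apply_eq_zero g hg _ (hδ g), if_neg hg, zero_smul]
  have h1 := DFunLike.congr_fun key (star a * a)
  change Φ (groupLift hv (star a * a)) =
    vectorTrace (leftRegularHom G) (star a * a) • v 1 at h1
  rw [vectorTrace_star_mul_self, ha, map_mul, map_star] at h1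
  rw [← CStarRing.star_mul_self_eq_zero_iff]
  refine hfaith _ ?_
  rw [h1]
  simp

end Gauge

end PGraphAlg

namespace PGraphAlg

/-! ### A norm estimate for sums of translations -/

section NormEstimate
variable {G : Type u} {ι : Type v} [Fintype ι]

theorem hasSum_norm_sq (ξ : EllTwo G) : HasSum (fun g => ‖ξ g‖ ^ 2) (‖ξ‖ ^ 2) := by
  have h := lp.hasSum_norm (p := 2) (by norm_num) ξ
  simpa using h

open Classical in
theorem sum_indicator_le_one {D : ι → Set G} (hD : Pairwise (Function.onFun Disjoint D)) (g : G) :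
    ∑ i, (if g ∈ D i then (1 : ℝ) else 0) ≤ 1 := by
  rw [Finset.sum_boole]
  have h : (Finset.univ.filter fun i => g ∈ D i).card ≤ 1 := by
    rw [Finset.card_le_one]
    intro i hi j hj
    by_contra hij
    exact Set.disjoint_left.mp (hD hij) (Finset.mem_filter.mp hi).2 (Finset.mem_filter.mp hj).2
  exact_mod_cast h

open Classical in
/-- The pointwise estimate: the terms with `g ∈ D i` contribute at most one summand, the others are
estimated by the Cauchy-Schwarz inequality. -/
theorem norm_sum_sq_le_of_disjoint {D : ι → Set G}
    (hD : Pairwise (Function.onFun Disjoint D)) (g : G) {c z : ι → ℂ} (hc : ∀ i, ‖c i‖ ≤ 1) :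
    ‖∑ i, c i * z i‖ ^ 2 ≤ 2 * ∑ i, ‖z i‖ ^ 2 +
      2 * Fintype.card ι * ∑ i, (if g ∈ D i then 0 else ‖z i‖ ^ 2) := by
  have h1 : ‖∑ i, c i * z i‖ ≤ ∑ i, (if g ∈ D i then (1 : ℝ) else 0) * ‖z i‖ +
      ∑ i, 1 * (if g ∈ D i then 0 else ‖z i‖) := by
    rw [← Finset.sum_add_distrib]
    refine (norm_sum_le _ _).trans (Finset.sum_le_sum fun i _ => ?_)
    rw [norm_mul]
    have := mul_le_of_le_one_left (norm_nonneg (z i)) (hc i)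
    split_ifs <;> simpa using this
  have h2 := Finset.sum_mul_sq_le_sq_mul_sq Finset.univ
    (fun i => if g ∈ D i then (1 : ℝ) else 0) fun i => ‖z i‖
  have h3 := Finset.sum_mul_sq_le_sq_mul_sq Finset.univ
    (fun _ : ι => (1 : ℝ)) fun i => if g ∈ D i then 0 else ‖z i‖
  have h4 : ∑ i, (if g ∈ D i then (1 : ℝ) else 0) ^ 2 ≤ 1 := by
    refine le_trans (le_of_eq ?_) (sum_indicator_le_one hD g)
    refine Finset.sum_congr rfl fun i _ => ?_
    split_ifs <;> simp
  have h5 : ∑ _i : ι, (1 : ℝ) ^ 2 = Fintype.card ι := by simp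
  have h6 : ∑ i, (if g ∈ D i then 0 else ‖z i‖) ^ 2 = ∑ i, (if g ∈ D i then 0 else ‖z i‖ ^ 2) := by
    refine Finset.sum_congr rfl fun i _ => ?_
    split_ifs <;> simp
  rw [h5, h6] at h3
  have h7 : 0 ≤ ∑ i, ‖z i‖ ^ 2 := Finset.sum_nonneg fun i _ => sq_nonneg _
  have h8 := h2.trans (mul_le_of_le_one_left h7 h4)
  calc ‖∑ i, c i * z i‖ ^ 2 ≤ (∑ i, (if g ∈ D i then (1 : ℝ) else 0) * ‖z i‖ +
        ∑ i, 1 * (if g ∈ D i then 0 else ‖z i‖)) ^ 2 :=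
        pow_le_pow_left₀ (norm_nonneg _) h1 2
    _ ≤ 2 * ((∑ i, (if g ∈ D i then (1 : ℝ) else 0) * ‖z i‖) ^ 2 +
        (∑ i, 1 * (if g ∈ D i then 0 else ‖z i‖)) ^ 2) := add_sq_le
    _ ≤ _ := by linarith

/-- If `h i` maps the complement of `D i` into `D i`, for disjoint sets `D i`, then the sum of `n`
translations by the `h i`, with coefficients of modulus at most `1`, has norm at most `2 √n`. -/
theorem norm_sum_smul_leftRegular_sq_le [Group G] {D : ι → Set G}
    (hD : Pairwise (Function.onFun Disjoint D)) {h : ι → G}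
    (hh : ∀ i g, g ∉ D i → h i * g ∈ D i) {c : ι → ℂ} (hc : ∀ i, ‖c i‖ ≤ 1) (ξ : EllTwo G) :
    ‖(∑ i, c i • leftRegular (h i)) ξ‖ ^ 2 ≤ 4 * Fintype.card ι * ‖ξ‖ ^ 2 := by
  classical
  set n : ℝ := (Fintype.card ι : ℝ) with hn
  have hn0 : 0 ≤ n := Nat.cast_nonneg _
  have happ : ∀ g, (∑ i, c i • leftRegular (h i)) ξ g = ∑ i, c i * ξ ((h i)⁻¹ * g) := by
    intro g
    rw [← inner_basisVec, sum_apply, inner_sum]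
    refine Finset.sum_congr rfl fun i _ => ?_
    rw [smul_apply, inner_smul_right, inner_basisVec, leftRegular_apply]
  have hξ := hasSum_norm_sq ξ
  have hF : HasSum (fun g => ∑ i, ‖ξ ((h i)⁻¹ * g)‖ ^ 2) (∑ _i : ι, ‖ξ‖ ^ 2) :=
    hasSum_sum fun i _ => (Equiv.mulLeft (h i)⁻¹).hasSum_iff.mpr hξ
  -- The substitution `k = (h i)⁻¹ g` in the part with `g ∉ D i`. If `h i * k ∉ D i` then `k ∈ D i`,
  -- so for each `k` at most one of these terms survives and the total is at most `‖ξ‖²`.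
  let b : ι → G → ℝ := fun i k => if h i * k ∈ D i then 0 else ‖ξ k‖ ^ 2
  have hb0 : ∀ i k, 0 ≤ b i k := fun i k => by
    simp only [b]; split_ifs
    · exact le_rfl
    · exact sq_nonneg _
  have hbs : ∀ i, Summable (b i) := fun i =>
    Summable.of_nonneg_of_le (hb0 i) (fun k => by
      simp only [b]; split_ifs
      · exact sq_nonneg _
      · exact le_rfl) hξ.summable
  have hH : HasSum (fun g => ∑ i, (if g ∈ D i then 0 else ‖ξ ((h i)⁻¹ * g)‖ ^ 2))
      (∑ i, ∑' k, b i k) := by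
    refine hasSum_sum fun i _ => ?_
    have h1 := (Equiv.mulLeft (h i)⁻¹).hasSum_iff.mpr (hbs i).hasSum
    refine h1.congr_fun fun g => ?_
    simp [b]
  have hbsum : ∑ i, ∑' k, b i k ≤ ‖ξ‖ ^ 2 := by
    have h1 : HasSum (fun k => ∑ i, b i k) (∑ i, ∑' k, b i k) :=
      hasSum_sum fun i _ => (hbs i).hasSum
    refine hasSum_le (fun k => ?_) h1 hξ
    have h2 : ∑ i, b i k ≤ ∑ i, (if k ∈ D i then (1 : ℝ) else 0) * ‖ξ k‖ ^ 2 := by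
      refine Finset.sum_le_sum fun i _ => ?_
      simp only [b]
      by_cases hk : k ∈ D i
      · rw [if_pos hk, one_mul]
        split_ifs
        · exact sq_nonneg _
        · exact le_rfl
      · rw [if_pos (hh i k hk), if_neg hk, zero_mul]
    rw [← Finset.sum_mul] at h2
    exact h2.trans (mul_le_of_le_one_left (sq_nonneg _) (sum_indicator_le_one hD k))
  -- Summing the pointwise estimate over `g`, each of its two terms contributes at most `2 n ‖ξ‖²`.
  have hle := hasSum_le (fun g => by
    rw [happ g]
    exact norm_sum_sq_le_of_disjoint hD g hc (z := fun i => ξ ((h i)⁻¹ * g)))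
    (hasSum_norm_sq ((∑ i, c i • leftRegular (h i)) ξ))
    ((hF.mul_left 2).add (hH.mul_left (2 * n)))
  have hcard : ∑ _i : ι, ‖ξ‖ ^ 2 = n * ‖ξ‖ ^ 2 := by simp [hn]
  rw [hcard] at hle
  nlinarith

end NormEstimate

/-! ### Shears and the free group -/

section Shear
variable {R : Type u} [CommRing R]

/-- The shear `(x, y) ↦ (x + r y, y)`. -/
def upperShear (r : R) : (R × R) ≃ₗ[R] (R × R) where
  toFun v := (v.1 + r * v.2, v.2)
  invFun v := (v.1 - r * v.2, v.2)
  left_inv v := by ext <;> simp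
  right_inv v := by ext <;> simp
  map_add' v w := by ext <;> simp; ring
  map_smul' c v := by ext <;> simp; ring

/-- The shear `(x, y) ↦ (x, y + r x)`. -/
def lowerShear (r : R) : (R × R) ≃ₗ[R] (R × R) where
  toFun v := (v.1, v.2 + r * v.1)
  invFun v := (v.1, v.2 - r * v.1)
  left_inv v := by ext <;> simp
  right_inv v := by ext <;> simp
  map_add' v w := by ext <;> simp; ring
  map_smul' c v := by ext <;> simp; ring

theorem upperShear_apply (r : R) (v : R × R) : upperShear r v = (v.1 + r * v.2, v.2) := rfl
theorem lowerShear_apply (r : R) (v : R × R) : lowerShear r v = (v.1, v.2 + r * v.1) := rfl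
theorem upperShear_inv_apply (r : R) (v : R × R) :
    (upperShear r)⁻¹ v = (v.1 - r * v.2, v.2) := rfl
theorem lowerShear_inv_apply (r : R) (v : R × R) :
    (lowerShear r)⁻¹ v = (v.1, v.2 - r * v.1) := rfl

/-- The action of the free group by the two shears with parameter `r`. -/
def shearRep (r : R) : FreeGroup (Fin 2) →* ((R × R) ≃ₗ[R] (R × R)) :=
  FreeGroup.lift ![upperShear r, lowerShear r]

theorem shearRep_of_zero (r : R) : shearRep r (FreeGroup.of 0) = upperShear r := by
  simp [shearRep]

theorem shearRep_of_one (r : R) : shearRep r (FreeGroup.of 1) = lowerShear r := by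
  simp [shearRep]

/-- A property of the shears and their inverses that is stable under products holds for the whole
free group. -/
theorem shearRep_induction (r : R) {p : ((R × R) ≃ₗ[R] (R × R)) → Prop} (h1 : p 1)
    (hmul : ∀ a b, p a → p b → p (a * b)) (hu : p (upperShear r)) (hu' : p (upperShear r)⁻¹)
    (hl : p (lowerShear r)) (hl' : p (lowerShear r)⁻¹) (g : FreeGroup (Fin 2)) :
    p (shearRep r g) := by
  induction g using FreeGroup.induction_on with
  | C1 => rwa [map_one]
  | of i =>
    fin_cases i
    · exact (shearRep_of_zero r).symm ▸ hu
    · exact (shearRep_of_one r).symm ▸ hl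
  | inv_of i _ =>
    rw [map_inv]
    fin_cases i
    · exact (shearRep_of_zero r).symm ▸ hu'
    · exact (shearRep_of_one r).symm ▸ hl'
  | mul g h hg hh => rw [map_mul]; exact hmul _ _ hg hh

/-- The shear actions are compatible with ring homomorphisms. -/
theorem map_shearRep {S : Type v} [CommRing S] (φ : R →+* S) (r : R) (g : FreeGroup (Fin 2))
    (v : R × R) : Prod.map φ φ (shearRep r g v) = shearRep (φ r) g (Prod.map φ φ v) := by
  induction g using FreeGroup.induction_on generalizing v with
  | C1 => simp
  | of i =>
    fin_cases i
    · change Prod.map φ φ (shearRep r (FreeGroup.of 0) v) =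
        shearRep (φ r) (FreeGroup.of 0) (Prod.map φ φ v)
      simp [shearRep_of_zero, upperShear_apply]
    · change Prod.map φ φ (shearRep r (FreeGroup.of 1) v) =
        shearRep (φ r) (FreeGroup.of 1) (Prod.map φ φ v)
      simp [shearRep_of_one, lowerShear_apply]
  | inv_of i _ =>
    fin_cases i
    · change Prod.map φ φ (shearRep r (FreeGroup.of 0)⁻¹ v) =
        shearRep (φ r) (FreeGroup.of 0)⁻¹ (Prod.map φ φ v)
      rw [map_inv, map_inv]
      simp [shearRep_of_zero, upperShear_inv_apply]
    · change Prod.map φ φ (shearRep r (FreeGroup.of 1)⁻¹ v) =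
        shearRep (φ r) (FreeGroup.of 1)⁻¹ (Prod.map φ φ v)
      rw [map_inv, map_inv]
      simp [shearRep_of_one, lowerShear_inv_apply]
  | mul g h hg hh =>
    rw [map_mul, map_mul]
    change Prod.map φ φ (shearRep r g (shearRep r h v)) =
      shearRep (φ r) g (shearRep (φ r) h (Prod.map φ φ v))
    rw [hg, hh]

end Shear

section PingPong

/-- The action of linear automorphisms on the nonzero vectors. -/
abbrev nonzeroAction (R : Type u) (M : Type v) [CommRing R] [AddCommGroup M] [Module R M] :
    MulAction (M ≃ₗ[R] M) {v : M // v ≠ 0} where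
  smul g v := ⟨g v, fun h => v.2 ((map_eq_zero_iff g g.injective).mp h)⟩
  one_smul _ := rfl
  mul_smul _ _ _ := rfl

/-- The difference `(x + k y)² - y²` factors as `(x + (k-1) y)(x + (k+1) y)`, and both factors have
the sign of `y`. The bound `3` is needed for strictness: for `k = 2` and `x = -y` the two squares
agree. All dynamics of the shears rest on this. -/
theorem sq_lt_sq_add_mul {x y k : ℤ} (hk : 3 ≤ k) (h : x ^ 2 ≤ y ^ 2) (hy : 0 < y ^ 2) :
    y ^ 2 < (x + k * y) ^ 2 ∧ 0 < (x + k * y) * y := by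
  have h1 := sq_nonneg (x + y)
  have h2 : 3 * y ^ 2 ≤ k * y ^ 2 := mul_le_mul_of_nonneg_right hk hy.le
  have h3 : 0 < (x + (k - 1) * y) * y := by nlinarith
  constructor
  · have h4 : 0 < (x + (k + 1) * y) * y := by nlinarith
    have h5 : 0 < ((x + (k - 1) * y) * y) * ((x + (k + 1) * y) * y) := mul_pos h3 h4
    have h6 : ((x + (k - 1) * y) * y) * ((x + (k + 1) * y) * y) =
        ((x + k * y) ^ 2 - y ^ 2) * y ^ 2 := by ring
    rw [h6] at h5
    linarith [(mul_pos_iff_of_pos_right hy).mp h5]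
  · nlinarith

theorem sq_pos_of_sq_le {x y : ℤ} (h0 : x ≠ 0 ∨ y ≠ 0) (h : x ^ 2 ≤ y ^ 2) : 0 < y ^ 2 := by
  rcases h0 with h0 | h0
  · exact (sq_pos_of_ne_zero h0).trans_le h
  · exact sq_pos_of_ne_zero h0

/-- Unless the first coordinate dominates with opposite sign, adding `3 y` does not cancel: either
the signs agree already, or `3 y` outweighs `x`. -/
theorem shear_pingPong {x y : ℤ} (h0 : x ≠ 0 ∨ y ≠ 0) (h : ¬(y ^ 2 < x ^ 2 ∧ x * y < 0)) :
    y ^ 2 < (x + 3 * y) ^ 2 ∧ 0 ≤ (x + 3 * y) * y := by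
  rcases lt_or_ge (y ^ 2) (x ^ 2) with h1 | h1
  · have h2 : 0 ≤ x * y := not_lt.mp fun h2 => h ⟨h1, h2⟩
    constructor <;> nlinarith [sq_nonneg y]
  · have hy : 0 < y ^ 2 := sq_pos_of_sq_le h0 h1
    exact ⟨(sq_lt_sq_add_mul le_rfl h1 hy).1, (sq_lt_sq_add_mul le_rfl h1 hy).2.le⟩

theorem shear_pingPong_inv {x y : ℤ} (h0 : x ≠ 0 ∨ y ≠ 0) (h : ¬(y ^ 2 < x ^ 2 ∧ 0 ≤ x * y)) :
    y ^ 2 < (x - 3 * y) ^ 2 ∧ (x - 3 * y) * y < 0 := by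
  rcases lt_or_ge (y ^ 2) (x ^ 2) with h1 | h1
  · have h2 : x * y < 0 := not_le.mp fun h2 => h ⟨h1, h2⟩
    constructor <;> nlinarith [sq_nonneg y]
  · have hy : 0 < y ^ 2 := sq_pos_of_sq_le h0 h1
    have h2 := sq_lt_sq_add_mul (x := x) (y := -y) le_rfl (by rwa [neg_sq]) (by rwa [neg_sq])
    constructor <;> nlinarith

/-- The two shears with parameter `3` generate a free group. -/
theorem shearRep_three_injective : Function.Injective (shearRep (3 : ℤ)) := by
  let _ := nonzeroAction ℤ (ℤ × ℤ)
  -- The first index stands for a dominant first coordinate, the second for a dominant second one.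
  -- The sign of the product separates attraction of the shear from attraction of its inverse;
  -- vectors on the axes are assigned to `X`, which keeps `X` and `Y` disjoint.
  let X : Fin 2 → Set {v : ℤ × ℤ // v ≠ 0} :=
    ![{v | v.1.2 ^ 2 < v.1.1 ^ 2 ∧ 0 ≤ v.1.1 * v.1.2},
      {v | v.1.1 ^ 2 < v.1.2 ^ 2 ∧ 0 ≤ v.1.2 * v.1.1}]
  let Y : Fin 2 → Set {v : ℤ × ℤ // v ≠ 0} :=
    ![{v | v.1.2 ^ 2 < v.1.1 ^ 2 ∧ v.1.1 * v.1.2 < 0},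
      {v | v.1.1 ^ 2 < v.1.2 ^ 2 ∧ v.1.2 * v.1.1 < 0}]
  have h0 : ∀ v : {v : ℤ × ℤ // v ≠ 0}, v.1.1 ≠ 0 ∨ v.1.2 ≠ 0 := by
    intro v
    by_contra! h
    exact v.2 (Prod.ext h.1 h.2)
  have hdisj : ∀ {Z Z' : Set {v : ℤ × ℤ // v ≠ 0}}, (∀ v, v ∈ Z → v ∈ Z' → False) →
      Disjoint Z Z' := fun h => Set.disjoint_left.mpr fun v hv hv' => h v hv hv'
  refine FreeGroup.injective_lift_of_ping_pong _ X Y ?_ ?_ ?_ ?_ ?_ ?_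
  · intro i
    fin_cases i
    · exact ⟨⟨(1, 0), by simp⟩, by simp [X]⟩
    · exact ⟨⟨(0, 1), by simp⟩, by simp [X]⟩
  · intro i j hij
    fin_cases i <;> fin_cases j
    · exact absurd rfl hij
    · exact hdisj fun v hv hv' => lt_asymm hv.1 hv'.1
    · exact hdisj fun v hv hv' => lt_asymm hv.1 hv'.1
    · exact absurd rfl hij
  · intro i j hij
    fin_cases i <;> fin_cases j
    · exact absurd rfl hij
    · exact hdisj fun v hv hv' => lt_asymm hv.1 hv'.1
    · exact hdisj fun v hv hv' => lt_asymm hv.1 hv'.1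
    · exact absurd rfl hij
  · intro i j
    fin_cases i <;> fin_cases j
    · exact hdisj fun v hv hv' => hv'.2.not_ge hv.2
    · exact hdisj fun v hv hv' => lt_asymm hv.1 hv'.1
    · exact hdisj fun v hv hv' => lt_asymm hv.1 hv'.1
    · exact hdisj fun v hv hv' => hv'.2.not_ge hv.2
  · intro i
    fin_cases i <;> rintro _ ⟨v, hv, rfl⟩
    · exact shear_pingPong (h0 v) hv
    · exact shear_pingPong (h0 v).symm hv
  · intro i
    fin_cases i <;> rintro _ ⟨v, hv, rfl⟩
    · exact shear_pingPong_inv (h0 v) hv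
    · exact shear_pingPong_inv (h0 v).symm hv

end PingPong

/-! ### Disjoint sets in the free group -/

section DisjointSets

/-- The elements of the free group that move the vector `(1, 0)` into the set `x ^ 2 < y ^ 2`. -/
def steepSet : Set (FreeGroup (Fin 2)) :=
  {g | (shearRep (3 : ℤ) g (1, 0)).1 ^ 2 < (shearRep (3 : ℤ) g (1, 0)).2 ^ 2}

/-- The lower shear adds `3 x` to `y`, which makes the second coordinate dominant when it was not.
-/
theorem of_one_mul_mem_steepSet {g : FreeGroup (Fin 2)} (hg : g ∉ steepSet) :
    FreeGroup.of 1 * g ∈ steepSet := by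
  set w := shearRep (3 : ℤ) g (1, 0) with hw
  have h0 : w ≠ 0 := by
    rw [hw, Ne, (shearRep (3 : ℤ) g).map_eq_zero_iff]
    simp
  have h1 : w.2 ^ 2 ≤ w.1 ^ 2 := not_lt.mp hg
  have h2 : shearRep (3 : ℤ) (FreeGroup.of 1 * g) (1, 0) = (w.1, w.2 + 3 * w.1) := by
    rw [map_mul, shearRep_of_one]
    rfl
  have h3 : w.2 ≠ 0 ∨ w.1 ≠ 0 := by
    by_contra! h
    exact h0 (Prod.ext h.2 h.1)
  change (shearRep (3 : ℤ) (FreeGroup.of 1 * g) (1, 0)).1 ^ 2 <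
    (shearRep (3 : ℤ) (FreeGroup.of 1 * g) (1, 0)).2 ^ 2
  rw [h2]
  exact (sq_lt_sq_add_mul le_rfl h1 (sq_pos_of_sq_le h3 h1)).1

theorem upperShear_pow_apply (n : ℕ) (v : ℤ × ℤ) :
    (upperShear (3 : ℤ) ^ n) v = (v.1 + 3 * n * v.2, v.2) := by
  induction n with
  | zero => simp
  | succ n ih =>
    rw [pow_succ']
    change upperShear 3 ((upperShear (3 : ℤ) ^ n) v) = _
    rw [ih, upperShear_apply]
    ext
    · push_cast; ring
    · rfl

/-- The power of the upper shear adds `3 n y` to `x`, and `3 n ≥ 3` makes the first coordinate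
dominant. Hence a nontrivial positive power of the first generator moves the steep set off itself.
-/
theorem of_zero_pow_mul_notMem_steepSet {g : FreeGroup (Fin 2)} (hg : g ∈ steepSet) {n : ℕ}
    (hn : n ≠ 0) : FreeGroup.of 0 ^ n * g ∉ steepSet := by
  set w := shearRep (3 : ℤ) g (1, 0) with hw
  have h1 : w.1 ^ 2 < w.2 ^ 2 := hg
  have h2 : shearRep (3 : ℤ) (FreeGroup.of 0 ^ n * g) (1, 0) = (w.1 + 3 * n * w.2, w.2) := by
    rw [map_mul, map_pow, shearRep_of_zero]
    exact upperShear_pow_apply n w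
  intro h3
  change (shearRep (3 : ℤ) (FreeGroup.of 0 ^ n * g) (1, 0)).1 ^ 2 <
    (shearRep (3 : ℤ) (FreeGroup.of 0 ^ n * g) (1, 0)).2 ^ 2 at h3
  rw [h2] at h3
  have hn1 : (1 : ℤ) ≤ n := by exact_mod_cast Nat.one_le_iff_ne_zero.mpr hn
  exact lt_asymm h3 (sq_lt_sq_add_mul (by linarith) h1.le ((sq_nonneg _).trans_lt h1)).1

/-- The translates `a^i W` of the set `W = steepSet`. -/
def steepTranslate (n : ℕ) (i : Fin n) : Set (FreeGroup (Fin 2)) :=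
  {g | (FreeGroup.of 0 ^ (i : ℕ))⁻¹ * g ∈ steepSet}

/-- With `a` the first generator and `i < j`, a common element `g` would give `a⁻ʲ g` and `a⁻ⁱ g =
aʲ⁻ⁱ (a⁻ʲ g)` both in the steep set. -/
theorem pairwise_disjoint_steepTranslate (n : ℕ) :
    Pairwise (Function.onFun Disjoint (steepTranslate n)) := by
  have key : ∀ i j : Fin n, i < j → ∀ g, g ∈ steepTranslate n i → g ∈ steepTranslate n j →
      False := by
    intro i j hij g hi hj
    have h1 := of_zero_pow_mul_notMem_steepSet hj (Nat.sub_ne_zero_of_lt hij)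
    refine h1 ?_
    have h2 : FreeGroup.of 0 ^ ((j : ℕ) - i) * ((FreeGroup.of 0 ^ (j : ℕ))⁻¹ * g) =
        (FreeGroup.of 0 ^ (i : ℕ))⁻¹ * g := by
      have h3 : (FreeGroup.of (0 : Fin 2)) ^ (j : ℕ) =
          FreeGroup.of 0 ^ (i : ℕ) * FreeGroup.of 0 ^ ((j : ℕ) - i) := by
        rw [← pow_add, Nat.add_sub_cancel' (Fin.lt_def.mp hij).le]
      rw [h3, mul_inv_rev, mul_assoc, mul_inv_cancel_left]
    rw [h2]
    exact hi
  intro i j hij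
  refine Set.disjoint_left.mpr fun g hi hj => ?_
  rcases lt_or_gt_of_ne hij with h | h
  · exact key i j h g hi hj
  · exact key j i h g hj hi

/-- The conjugates `a^i b a^{-i}` of the generator `b`. -/
def conjGenerator (n : ℕ) (i : Fin n) : FreeGroup (Fin 2) :=
  FreeGroup.of 0 ^ (i : ℕ) * FreeGroup.of 1 * (FreeGroup.of 0 ^ (i : ℕ))⁻¹

/-- Translation by `aⁱ` conjugates the action of the second generator on the steep set into that of
its conjugate on the translate. -/
theorem conjGenerator_mul_mem (n : ℕ) (i : Fin n) (g : FreeGroup (Fin 2))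
    (hg : g ∉ steepTranslate n i) : conjGenerator n i * g ∈ steepTranslate n i := by
  have h := of_one_mul_mem_steepSet hg
  have h1 : (FreeGroup.of 0 ^ (i : ℕ))⁻¹ * (conjGenerator n i * g) =
      FreeGroup.of 1 * ((FreeGroup.of 0 ^ (i : ℕ))⁻¹ * g) := by
    rw [conjGenerator]; group
  change (FreeGroup.of 0 ^ (i : ℕ))⁻¹ * (conjGenerator n i * g) ∈ steepSet
  rw [h1]
  exact h

/-- The norm of a combination of `n` free translations is at most `2 √n`. -/
theorem norm_sum_conjGenerator_le {n : ℕ} {c : Fin n → ℂ} (hc : ∀ i, ‖c i‖ ≤ 1) :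
    ‖∑ i, c i • (leftRegular (conjGenerator n i) :
      EllTwo (FreeGroup (Fin 2)) →L[ℂ] EllTwo (FreeGroup (Fin 2)))‖ ≤ 2 * √n := by
  refine ContinuousLinearMap.opNorm_le_bound _ (by positivity) fun ξ => ?_
  have h1 := norm_sum_smul_leftRegular_sq_le (pairwise_disjoint_steepTranslate n)
    (conjGenerator_mul_mem n) hc ξ
  rw [Fintype.card_fin] at h1
  refine le_of_sq_le_sq ?_ (by positivity)
  rw [mul_pow, mul_pow, Real.sq_sqrt (Nat.cast_nonneg n)]
  linarith

end DisjointSets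

/-! ### A total order on the free group -/

section TotalOrder

/-- A notion of positivity on an additive group. -/
structure IsStrictCone {M : Type u} [AddCommGroup M] (pos : M → Prop) : Prop where
  add : ∀ {x y}, pos x → pos y → pos (x + y)
  not_zero : ¬pos 0
  trichotomy : ∀ x, x = 0 ∨ pos x ∨ pos (-x)

/-- The elements `g` with `g e₁ > e₁`, or `g e₁ = e₁` and `g e₂ ≥ e₂`. -/
def lexCone {G : Type u} [Group G] {M : Type v} [AddCommGroup M] [DistribMulAction G M]
    {pos : M → Prop} (hpos : IsStrictCone pos) (hact : ∀ (g : G) x, pos x → pos (g • x))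
    (e₁ e₂ : M) : Submonoid G where
  carrier := {g | pos (g • e₁ - e₁) ∨ g • e₁ = e₁ ∧ (g • e₂ = e₂ ∨ pos (g • e₂ - e₂))}
  one_mem' := Or.inr ⟨one_smul _ _, Or.inl (one_smul _ _)⟩
  mul_mem' := by
    -- The displacement of a product telescopes, and the action preserves positivity, so
    -- displacements of the two factors can be added.
    have hsplit : ∀ (g h : G) (e : M), (g * h) • e - e = g • (h • e - e) + (g • e - e) := by
      intro g h e
      rw [mul_smul, smul_sub, sub_add_sub_cancel]
    rintro g h (hg | ⟨hg, hg'⟩) (hh | ⟨hh, hh'⟩)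
    · left; rw [hsplit]; exact hpos.add (hact g _ hh) hg
    · left; rw [mul_smul, hh]; exact hg
    · left; rw [hsplit, hg, sub_self, add_zero]; exact hact g _ hh
    · refine Or.inr ⟨by rw [mul_smul, hh, hg], ?_⟩
      rcases hh' with hh' | hh'
      · rwa [mul_smul, hh']
      · right
        rw [hsplit]
        rcases hg' with hg' | hg'
        · rw [hg', sub_self, add_zero]; exact hact g _ hh'
        · exact hpos.add (hact g _ hh') hg'

/-- Trichotomy for the displacement of `e₁`, then for that of `e₂`, decides between `g` and `g⁻¹`.
If both lie in the cone, both displacements vanish and `hfix` gives `g = 1`. -/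
theorem isTotalCone_lexCone {G : Type u} [Group G] {M : Type v} [AddCommGroup M]
    [DistribMulAction G M] {pos : M → Prop} (hpos : IsStrictCone pos)
    (hact : ∀ (g : G) x, pos x → pos (g • x)) {e₁ e₂ : M}
    (hfix : ∀ g : G, g • e₁ = e₁ → g • e₂ = e₂ → g = 1) :
    IsTotalCone (lexCone hpos hact e₁ e₂) := by
  have hneg : ∀ x, pos x → pos (-x) → False := fun x h h' =>
    hpos.not_zero (by simpa using hpos.add h h')
  -- Applying `g⁻¹` to `e - g e` gives `g⁻¹ e - e`, so inversion reverses the sign of a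
  -- displacement.
  have hinv : ∀ (g : G) (e : M), pos (-(g • e - e)) → pos (g⁻¹ • e - e) := by
    intro g e h
    have h1 := hact g⁻¹ _ h
    rwa [neg_sub, smul_sub, inv_smul_smul] at h1
  have hinv' : ∀ (g : G) (e : M), pos (g • e - e) → pos (-(g⁻¹ • e - e)) := by
    intro g e h
    have h1 := hact g⁻¹ _ h
    rwa [smul_sub, inv_smul_smul, ← neg_sub] at h1
  have hfixinv : ∀ (g : G) (e : M), g⁻¹ • e = e → g • e = e := fun g e h =>
    (inv_smul_eq_iff.mp h).symm
  constructor
  · intro g hg hg'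
    have h1 : g • e₁ = e₁ ∧ (g • e₂ = e₂ ∨ pos (g • e₂ - e₂)) := by
      refine hg.resolve_left fun h => ?_
      rcases hg' with h' | ⟨h', _⟩
      · exact hneg _ h' (hinv' g e₁ h)
      · rw [hfixinv g e₁ h', sub_self] at h
        exact hpos.not_zero h
    have h2 : g⁻¹ • e₂ = e₂ ∨ pos (g⁻¹ • e₂ - e₂) := by
      rcases hg' with h' | ⟨_, h'⟩
      · rw [inv_smul_eq_iff.mpr h1.1.symm, sub_self] at h'
        exact absurd h' hpos.not_zero
      · exact h'
    refine hfix g h1.1 (h1.2.resolve_right fun h => ?_)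
    rcases h2 with h' | h'
    · rw [hfixinv g e₂ h', sub_self] at h
      exact hpos.not_zero h
    · exact hneg _ h' (hinv' g e₂ h)
  · intro g
    rcases hpos.trichotomy (g • e₁ - e₁) with h | h | h
    · have h1 := sub_eq_zero.mp h
      have h1' := inv_smul_eq_iff.mpr h1.symm
      rcases hpos.trichotomy (g • e₂ - e₂) with h' | h' | h'
      · exact Or.inl (Or.inr ⟨h1, Or.inl (sub_eq_zero.mp h')⟩)
      · exact Or.inl (Or.inr ⟨h1, Or.inr h'⟩)
      · exact Or.inr (Or.inr ⟨h1', Or.inr (hinv g e₂ h')⟩)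
    · exact Or.inl (Or.inl h)
    · exact Or.inr (Or.inl (hinv g e₁ h))

open Polynomial

/-- A pair `(p, q)` of polynomials is positive if the first nonzero one of its coefficients
`p₀, q₀, p₁, q₁, …` is positive. -/
def pairPos (v : ℤ[X] × ℤ[X]) : Prop :=
  ∃ n, (∀ m < n, v.1.coeff m = 0 ∧ v.2.coeff m = 0) ∧
    (0 < v.1.coeff n ∨ v.1.coeff n = 0 ∧ 0 < v.2.coeff n)

/-- In a sum the leading pair with the smaller index decides; for equal indices the claim is that of
the lexicographic order on `ℤ × ℤ`. Trichotomy looks at the least index with a nonzero coefficient.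
-/
theorem isStrictCone_pairPos : IsStrictCone pairPos where
  add := by
    rintro x y ⟨n, hn, hx⟩ ⟨k, hk, hy⟩
    rcases lt_trichotomy n k with h | rfl | h
    · refine ⟨n, fun m hm => ?_, ?_⟩
      · simp [hn m hm, hk m (hm.trans h)]
      · simpa [hk n h] using hx
    · refine ⟨n, fun m hm => ?_, ?_⟩
      · simp [hn m hm, hk m hm]
      · simp only [Prod.fst_add, Prod.snd_add, coeff_add]
        omega
    · refine ⟨k, fun m hm => ?_, ?_⟩
      · simp [hk m hm, hn m (hm.trans h)]
      · simpa [hn k h] using hy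
  not_zero := by
    rintro ⟨n, _, h⟩
    simp at h
  trichotomy x := by
    classical
    by_cases hx : ∃ n, x.1.coeff n ≠ 0 ∨ x.2.coeff n ≠ 0
    · right
      have h1 : ∀ m < Nat.find hx, x.1.coeff m = 0 ∧ x.2.coeff m = 0 := by
        intro m hm
        have := Nat.find_min hx hm
        push Not at this
        exact this
      have h2 := Nat.find_spec hx
      have h3 : (0 < x.1.coeff (Nat.find hx) ∨ x.1.coeff (Nat.find hx) = 0 ∧
          0 < x.2.coeff (Nat.find hx)) ∨ (0 < -x.1.coeff (Nat.find hx) ∨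
          -x.1.coeff (Nat.find hx) = 0 ∧ 0 < -x.2.coeff (Nat.find hx)) := by omega
      rcases h3 with h3 | h3
      · exact Or.inl ⟨_, h1, h3⟩
      · exact Or.inr ⟨Nat.find hx, fun m hm => by simpa using h1 m hm, by simpa using h3⟩
    · left
      push Not at hx
      exact Prod.ext (Polynomial.ext fun n => (hx n).1) (Polynomial.ext fun n => (hx n).2)

/-- Multiplication by `X` raises the index of the leading coefficient, so a shear with parameter `X`
changes nothing up to the leading pair. -/
theorem coeff_X_mul_of_forall_lt {p : ℤ[X]} {n : ℕ} (h : ∀ m < n, p.coeff m = 0) {m : ℕ}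
    (hm : m ≤ n) : (X * p).coeff m = 0 := by
  cases m with
  | zero => simp
  | succ m => rw [coeff_X_mul]; exact h m hm

/-- The shears with parameter `X` preserve positivity. -/
theorem pairPos_shearRep (g : FreeGroup (Fin 2)) (v : ℤ[X] × ℤ[X]) (hv : pairPos v) :
    pairPos (shearRep X g v) := by
  revert v
  refine shearRep_induction X (p := fun f => ∀ v, pairPos v → pairPos (f v)) (fun v hv => hv)
    (fun a b ha hb v hv => ha _ (hb v hv)) ?_ ?_ ?_ ?_ g
  all_goals
    rintro v ⟨n, hn, hv⟩
    have h1 : ∀ m ≤ n, (X * v.1).coeff m = 0 := fun m hm =>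
      coeff_X_mul_of_forall_lt (fun m hm => (hn m hm).1) hm
    have h2 : ∀ m ≤ n, (X * v.2).coeff m = 0 := fun m hm =>
      coeff_X_mul_of_forall_lt (fun m hm => (hn m hm).2) hm
    refine ⟨n, fun m hm => ?_, ?_⟩
  · simp [upperShear_apply, h2 m hm.le, hn m hm]
  · simpa [upperShear_apply, h2 n le_rfl] using hv
  · rw [upperShear_inv_apply]; simp [h2 m hm.le, hn m hm]
  · rw [upperShear_inv_apply]; simpa [h2 n le_rfl] using hv
  · simp [lowerShear_apply, h1 m hm.le, hn m hm]
  · simpa [lowerShear_apply, h1 n le_rfl] using hv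
  · rw [lowerShear_inv_apply]; simp [h1 m hm.le, hn m hm]
  · rw [lowerShear_inv_apply]; simpa [h1 n le_rfl] using hv

/-- Evaluation at `X = 3` turns the fixed basis of `ℤ[X]²` into a fixed basis of `ℤ²`, where the
action of the free group is faithful by ping-pong. -/
theorem eq_one_of_shearRep_X_fix {g : FreeGroup (Fin 2)}
    (h₁ : shearRep (X : ℤ[X]) g (1, 0) = (1, 0)) (h₂ : shearRep (X : ℤ[X]) g (0, 1) = (0, 1)) :
    g = 1 := by
  have h3 := map_shearRep (evalRingHom (3 : ℤ)) X g (1, 0)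
  have h4 := map_shearRep (evalRingHom (3 : ℤ)) X g (0, 1)
  rw [h₁] at h3
  rw [h₂] at h4
  simp only [Prod.map_apply, coe_evalRingHom, eval_X, eval_one, eval_zero]
    at h3 h4
  refine shearRep_three_injective ?_
  rw [map_one]
  ext v : 1
  have h5 : v = v.1 • ((1, 0) : ℤ × ℤ) + v.2 • ((0, 1) : ℤ × ℤ) := by ext <;> simp
  rw [h5, map_add, map_smul, map_smul, ← h3, ← h4]
  rfl

/-- The free group on two generators has a total order. -/
theorem exists_isTotalCone_freeGroup :
    ∃ R : Submonoid (FreeGroup (Fin 2)), IsTotalCone R := by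
  let _ : DistribMulAction (FreeGroup (Fin 2)) (ℤ[X] × ℤ[X]) :=
    DistribMulAction.compHom _ (shearRep (X : ℤ[X]))
  exact ⟨lexCone isStrictCone_pairPos pairPos_shearRep (1, 0) (0, 1),
    isTotalCone_lexCone isStrictCone_pairPos pairPos_shearRep fun g =>
      eq_one_of_shearRep_X_fix⟩

end TotalOrder

end PGraphAlg

namespace PGraphAlg

open scoped CStarAlgebra

/-! ### The minimal C⋆-algebra of an ordered free group has no characters -/

section NoCharacter

/-- A nonzero character takes the unit `v 1` to `1`, so it takes each `v g` to a unitary of `ℂ`. -/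
theorem IsUnitaryRep.norm_character_eq_one {G : Type u} [Group G] {A : Type v}
    [NonUnitalCStarAlgebra A] {v : G → A} (hv : IsUnitaryRep v) {χ : A →⋆ₙₐ[ℂ] ℂ} (hχ : χ ≠ 0)
    (g : G) : ‖χ (v g)‖ = 1 := by
  have h1 : χ (v 1) = 1 := by
    obtain ⟨a, ha⟩ : ∃ a, χ a ≠ 0 := by
      by_contra! h
      exact hχ (DFunLike.ext _ _ h)
    have h2 : χ (v 1) * χ a = 1 * χ a := by rw [← _root_.map_mul, hv.one_mul, _root_.one_mul]
    exact mul_right_cancel₀ ha h2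
  have h3 : star (χ (v g)) * χ (v g) = 1 := by
    rw [← StarHomClass.map_star, ← _root_.map_mul, hv.map_star, hv.map_mul, inv_mul_cancel, h1]
  have h4 : ‖χ (v g)‖ * ‖χ (v g)‖ = 1 := by
    rw [← CStarRing.norm_star_mul_self, h3, norm_one]
  nlinarith [norm_nonneg (χ (v g))]

/-- A C⋆-algebra generated by a unitary representation of the free group on two generators that
is dominated by the regular representation has no characters. -/
theorem character_eq_zero {A : Type} [NonUnitalCStarAlgebra A] {v : FreeGroup (Fin 2) → A}
    (hv : IsUnitaryRep v)
    (hle : ∀ a, ‖groupLift hv a‖ ≤ ‖leftRegularHom (FreeGroup (Fin 2)) a‖) (χ : A →⋆ₙₐ[ℂ] ℂ) :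
    χ = 0 := by
  by_contra hχ
  have h1 := hv.norm_character_eq_one hχ
  -- The conjugate phases make every summand contribute exactly `1` to the character. Nine terms
  -- give `9 > 2√9 = 6` with an integral square root.
  let c : Fin 9 → ℂ := fun i => star (χ (v (conjGenerator 9 i)))
  have hc : ∀ i, ‖c i‖ ≤ 1 := fun i => by
    simp only [c]; rw [norm_star, h1]
  have h2 : χ (∑ i, c i • v (conjGenerator 9 i)) = 9 := by
    rw [map_sum]
    have h3 : ∀ i, χ (c i • v (conjGenerator 9 i)) = 1 := by
      intro i
      rw [map_smul, smul_eq_mul]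
      change star (χ (v (conjGenerator 9 i))) * χ (v (conjGenerator 9 i)) = 1
      rw [Complex.star_def, ← Complex.normSq_eq_conj_mul_self, Complex.normSq_eq_norm_sq, h1]
      norm_num
    simp [h3]
  have h4 : ‖∑ i, c i • v (conjGenerator 9 i)‖ ≤ 2 * √(9 : ℕ) := by
    have h5 := hle (∑ i, c i • fullRep (conjGenerator 9 i))
    simp only [map_sum, map_smul, groupLift_fullRep, leftRegularHom_fullRep] at h5
    exact h5.trans (norm_sum_conjGenerator_le hc)
  have h6 : √((9 : ℕ) : ℝ) = 3 := by
    rw [show ((9 : ℕ) : ℝ) = 3 ^ 2 by norm_num, Real.sqrt_sq (by norm_num)]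
  have h7 := NonUnitalStarAlgHom.norm_apply_le χ (∑ i, c i • v (conjGenerator 9 i))
  rw [h2] at h7
  norm_num at h7
  rw [h6] at h4
  linarith

theorem isUnitaryRep_complex_one {G : Type u} [Group G] : IsUnitaryRep fun _ : G => (1 : ℂ) where
  one_mul a := _root_.one_mul a
  mul_one a := _root_.mul_one a
  map_mul _ _ := _root_.one_mul 1
  map_star _ := star_one _

/-- The tight and the minimal C⋆-algebra of a totally ordered free group on two generators are not
isomorphic. -/
theorem isEmpty_equiv_of_isCoUniversalRep {R : Submonoid (FreeGroup (Fin 2))}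
    (hR : IsTotalCone R) {B : Type} [NonUnitalCStarAlgebra B]
    {S : Path (CategoryTheory.SingleObj R) → B}
    (hS : IsCoUniversalRep (CategoryTheory.Functor.id (CategoryTheory.SingleObj R)) S) :
    IsEmpty (TightCStar (CategoryTheory.SingleObj R) ≃⋆ₐ[ℂ] generatedCStar S) := by
  refine ⟨fun Ψ => ?_⟩
  have hs := isConeRep_of_isTight hR hS.isRep hS.isTight
  obtain ⟨δ, hδ, hn⟩ := hS.normal_gauge
  have hv := hs.isUnitaryRep_tightExtend hR
  have h1 := character_eq_zero hv
    (norm_groupLift_le_of_isNormalCoaction hv (hδ.apply_tightExtend hR hs) hn)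
  -- The character of the trivial representation, carried through the supposed isomorphism, is a
  -- character of `C⋆(S)` that is not zero at the image of the unit.
  let ε : GroupCStar (FreeGroup (Fin 2)) →⋆ₙₐ[ℂ] ℂ := groupLift isUnitaryRep_complex_one
  let χ : generatedCStar S →⋆ₙₐ[ℂ] ℂ := (ε.comp (tightToGroup hR)).comp
    (Ψ.symm : generatedCStar S →⋆ₙₐ[ℂ] TightCStar (CategoryTheory.SingleObj R))
  have h2 : χ (Ψ (tightExtend tightRep 1)) = 1 := by
    change ε (tightToGroup hR (Ψ.symm (Ψ (tightExtend tightRep 1)))) = 1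
    rw [StarAlgEquiv.symm_apply_apply, tightToGroup_tightExtend]
    exact groupLift_fullRep isUnitaryRep_complex_one 1
  rw [h1 χ] at h2
  exact zero_ne_one h2

theorem IsCoUniversalRep.isFaithfulTightGauge {G : Type u} [Group G] {P : Submonoid G}
    {Λ : Type w} [CategoryTheory.Category.{v} Λ] {B : Type u} [NonUnitalCStarAlgebra B]
    {d : CategoryTheory.Functor Λ (CategoryTheory.SingleObj P)} {S : Path Λ → B}
    (hS : IsCoUniversalRep d S) : IsFaithfulTightGauge d S where
  isRep := hS.isRep
  isFaithfulRep := hS.isFaithfulRep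
  isTight := hS.isTight
  gauge := hS.normal_gauge.imp fun _ h => h.1

end NoCharacter

end PGraphAlg

end

/-! ### The lemma and the corollary -/

theorem mainTheorem11 :
    (∀ (G : Type u) [Group G] (P : Submonoid G), PGraphAlg.IsTotalCone P →
      -- the one-object category `P`, with the identity as degree functor, is a finitely aligned
      -- `P`-graph over the weakly quasi-lattice ordered group `(G, P)`
      (PGraphAlg.IsWQLO P ∧
        PGraphAlg.IsPGraph (CategoryTheory.Functor.id (CategoryTheory.SingleObj P)) ∧
        PGraphAlg.IsFinitelyAligned (CategoryTheory.SingleObj P)) ∧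
      -- every tight representation extends uniquely to a unitary representation of `G`
      (∀ (B : Type v) [NonUnitalCStarAlgebra B]
        (t : PGraphAlg.Path (CategoryTheory.SingleObj P) → B),
        PGraphAlg.IsRep t → PGraphAlg.IsTight t →
        ∃ tbar : G → PGraphAlg.generatedCStar t,
          PGraphAlg.IsUnitaryRep tbar ∧
          (∀ p : P, tbar (p : G) = PGraphAlg.generator t (PGraphAlg.monoidPath p)) ∧
          (∀ p : P, tbar (p : G)⁻¹ = star (PGraphAlg.generator t (PGraphAlg.monoidPath p))) ∧
          ∀ u : G → PGraphAlg.generatedCStar t, PGraphAlg.IsUnitaryRep u →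
            (∀ p : P, u (p : G) = PGraphAlg.generator t (PGraphAlg.monoidPath p)) → u = tbar) ∧
      -- the tight algebra is `C⋆(G)`
      (∃ φ : PGraphAlg.TightCStar (CategoryTheory.SingleObj P) ≃⋆ₐ[ℂ] PGraphAlg.GroupCStar G,
        ∀ p : P, φ (PGraphAlg.generator PGraphAlg.tightRep (PGraphAlg.monoidPath p)) =
          PGraphAlg.fullRep (p : G)) ∧
      -- it has a gauge coaction, which is normal if and only if `G` is amenable
      (∃ δ, PGraphAlg.IsGaugeCoaction
        (CategoryTheory.Functor.id (CategoryTheory.SingleObj P)) PGraphAlg.tightRep δ) ∧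
      (∀ δ, PGraphAlg.IsGaugeCoaction
          (CategoryTheory.Functor.id (CategoryTheory.SingleObj P)) PGraphAlg.tightRep δ →
        (PGraphAlg.IsNormalCoaction δ ↔ PGraphAlg.IsAmenable G))) ∧
    -- the free group on two generators has a total order
    (∃ R : Submonoid (FreeGroup (Fin 2)), PGraphAlg.IsTotalCone R) ∧
    (∀ R : Submonoid (FreeGroup (Fin 2)), PGraphAlg.IsTotalCone R →
      -- the universal tight representation is faithful and tight, and has a gauge coaction
      PGraphAlg.IsFaithfulTightGauge (CategoryTheory.Functor.id (CategoryTheory.SingleObj R))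
        PGraphAlg.tightRep ∧
      -- the co-universal representation `S` exists, and `C⋆_tight` is not isomorphic to
      -- `C⋆_min = C⋆(S)`
      (∃ (B : Type) (_ : NonUnitalCStarAlgebra B)
        (S : PGraphAlg.Path (CategoryTheory.SingleObj R) → B),
        PGraphAlg.IsCoUniversalRep
          (CategoryTheory.Functor.id (CategoryTheory.SingleObj R)) S) ∧
      (∀ (B : Type) [NonUnitalCStarAlgebra B]
        (S : PGraphAlg.Path (CategoryTheory.SingleObj R) → B),
        PGraphAlg.IsCoUniversalRep
          (CategoryTheory.Functor.id (CategoryTheory.SingleObj R)) S →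
        IsEmpty (PGraphAlg.TightCStar (CategoryTheory.SingleObj R) ≃⋆ₐ[ℂ]
          PGraphAlg.generatedCStar S)) ∧
      -- there is no gauge-invariant uniqueness theorem
      ¬ ∀ (B B' : Type) [NonUnitalCStarAlgebra B] [NonUnitalCStarAlgebra B']
        (s : PGraphAlg.Path (CategoryTheory.SingleObj R) → B)
        (t : PGraphAlg.Path (CategoryTheory.SingleObj R) → B'),
        PGraphAlg.IsFaithfulTightGauge
          (CategoryTheory.Functor.id (CategoryTheory.SingleObj R)) s →
        PGraphAlg.IsFaithfulTightGauge
          (CategoryTheory.Functor.id (CategoryTheory.SingleObj R)) t →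
        PGraphAlg.CanonicallyIsomorphic s t) := by
  refine ⟨fun G _ P hP => ⟨⟨PGraphAlg.isWQLO_of_isTotalCone hP, PGraphAlg.isPGraph_singleObj,
    PGraphAlg.isFinitelyAligned_of_isTotalCone hP⟩, ?_, ?_, ?_, ?_⟩,
    PGraphAlg.exists_isTotalCone_freeGroup, fun R hR => ⟨?_, ?_, ?_, ?_⟩⟩
  · intro B _ t ht ht'
    exact PGraphAlg.exists_unique_unitary_extension hP ht ht'
  · exact ⟨PGraphAlg.tightEquivGroup hP, PGraphAlg.tightToGroup_generator hP⟩
  · exact PGraphAlg.exists_gaugeCoaction_tightRep hP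
  · exact fun δ hδ => PGraphAlg.isNormalCoaction_tightRep_iff hP hδ
  · exact PGraphAlg.isFaithfulTightGauge_tightRep hR
  · exact ⟨_, inferInstance, PGraphAlg.regularRep R, PGraphAlg.isCoUniversalRep_regularRep hR⟩
  · intro B _ S hS
    exact PGraphAlg.isEmpty_equiv_of_isCoUniversalRep hR hS
  -- Uniqueness would identify the universal tight representation with the regular one, whose
  -- C⋆-algebras are not even abstractly isomorphic.
  · intro h
    have hS := PGraphAlg.isCoUniversalRep_regularRep hR
    obtain ⟨φ, _⟩ := h _ _ _ _ (PGraphAlg.isFaithfulTightGauge_tightRep hR)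
      hS.isFaithfulTightGauge
    exact (PGraphAlg.isEmpty_equiv_of_isCoUniversalRep hR hS).false φ
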